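/- Let $T$ be a complete consistent (possibly many-sorted) first-order theory and let $M$ be a big saturated, strongly homogeneous model of $T$. All sets $A,B,C,\dots$ below are small sets of elements of $M$; $AB$ means $A\cup B$; $\operatorname{acl}$ is algebraic closure in $M$; and $A\equiv_D A'$ means that some automorphism of $M$ fixing $D$ pointwise maps $A$ onto $A'$. An *independence relation* for $T$ is a ternary relation $A\perp_C B$ between small sets such that: - (invariance) if $A\perp_CB$ and $g$ is an automorphism of $M$, then $g(A)\perp_{g(C)}g(B)$; - (monotonicity) if $A\perp_CB$, $A'\subseteq A$ and $B'\subseteq B$, then $A'\perp_CB'$; - (base monotonicity) if $D\subseteq C\subseteq B$ and $A\perp_DB$, then $A\perp_CB$; - (transitivity) if $D\subseteq C\subseteq B$, $B\perp_CA$ and $C\perp_DA$, then $B\perp_DA$; - (normality) if $A\perp_CB$, then $AC\perp_CB$; - (extension) if $A\perp_CB$ and $\hat B\supseteq B$, then there is $A'\equiv_{BC}A$ with $A'\perp_C\hat B$; - (finite character) if $A_0\perp_CB$ for all finite $A_0\subseteq A$, then $A\perp_CB$; - (local character) for every $A$ there is a small cardinal $\kappa(A)$ such that every $B$ has a subset $C$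 with $|C|<\kappa(A)$ and $A\perp_CB$. It is *strict* if moreover, for every element $a$, $\{a\}\perp_B\{a\}$ implies $a\in\operatorname{acl}B$. A relation $\perp$ is *finer* than $\perp'$ (and $\perp'$ *coarser* than $\perp$) if $A\perp_CB$ always implies $A\perp'_CB$. *M-dividing independence* $A\perp^{M}_CB$ means that $\operatorname{acl}(AC')\cap\operatorname{acl}(BC')=\operatorname{acl}(C')$ for every $C'$ with $C\subseteq C'\subseteq\operatorname{acl}(BC)$. *Thorn-forking independence* $A\perp^{\text{þ}}_CB$ means that for every $\hat B\supseteq B$ there is $A'\equiv_{BC}A$ with $A'\perp^{M}_C\hat B$. An *inconsistency pair* is a pair of formulas without parameters $(\varphi(\bar x;\bar y),\psi(\bar y_0,\dots,\bar y_{k-1}))$, with $\bar x,\bar y$ finite tuples of variables and $k<\omega$, such that $\bigwedge_{i<k}\varphi(\bar x;\bar y_i)\wedge\psi(\bar y_0,\dots,\bar y_{k-1})$ is inconsistent with $T$. $\Xi_M$ is the set of those inconsistency pairs in which $\bar y$ consists of one variable $u$ and a finite tuple $\bar v$, and $\psi$ is equivalent to $\bigwedge_{i<j<k}(u_i\ne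 u_j\wedge\bar v_i=\bar v_j)$. The formula $\varphi(\bar x;\bar b)$ *$(\varphi,\psi)$-divides* over $C$ if there are realisations $\bar c_0,\bar c_1,\dots$ of $\operatorname{tp}(\bar b/C)$ such that $\psi(\bar c_{i_0},\dots,\bar c_{i_{k-1}})$ holds for all $i_0<\dots<i_{k-1}<\omega$. For a linear order $I$, *there is a $(\varphi,\psi)$-dividing pattern of type $I$* (for the empty partial type) if there are tuples $(\bar b_i)_{i\in I}$ such that $\{\varphi(\bar x;\bar b_i):i\in I\}$ is consistent and each $\varphi(\bar x;\bar b_i)$ $(\varphi,\psi)$-divides over $\{\bar b_j:j<i\}$. The rank $D_{\varphi,\psi}(\emptyset)$ is $\infty$ if there are such patterns of every order type, and otherwise the greatest $n<\omega$ for which there is one of length $n$. **Theorem.** The following are equivalent: 0. $\perp^{\text{þ}}$ is an independence relation for $T$; 1. $\perp^{\text{þ}}$ satisfies local character; 2. $\perp^{M}$ satisfies local character; 3. $D_{\varphi,\psi}(\emptyset)<\infty$ for every $(\varphi,\psi)\in\Xi_M$; 4. $A\perp^{\text{þ}}_CB$ implies $B\perp^{\text{þ}}_CA$, for all $A,B,C$;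 5. $A\perp^{\text{þ}}_CB$ implies $B\perp^{M}_CA$, for all $A,B,C$; 6. there is a strict independence relation for $T$. If these conditions hold, then $\perp^{\text{þ}}$ is a strict independence relation for $T$, and it is the coarsest one. Let $M^{\mathrm{eq}}$ be the many-sorted structure obtained from $M$ by adding, for every $\emptyset$-definable equivalence relation on finite tuples of given sorts, a sort for its classes together with the projection onto it. It is the big model of $T^{\mathrm{eq}}=\operatorname{Th}(M^{\mathrm{eq}})$. Call $T$ *rosy* if $\perp^{\text{þ}}$, computed in $M^{\mathrm{eq}}$, is an independence relation for $T^{\mathrm{eq}}$. Then $T$ is rosy if and only if $T^{\mathrm{eq}}$ satisfies any one, equivalently every one, of conditions 1–6. -/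

import Mathlib

universe u v w

namespace ManySorted

/-! ### Many-sorted first-order logic -/

/-- A many-sorted first-order language: sorts, function symbols and relation symbols, each symbol
with a finite tuple of argument sorts. One-sorted languages are the case of a single sort. -/
structure Language where
  /-- the sorts -/
  Srt : Type u
  /-- the function symbols with given argument sorts and a given value sort -/
  Fn : (n : ℕ) → (Fin n → Srt) → Srt → Type u
  /-- the relation symbols with given argument sorts -/
  Rel : (n : ℕ) → (Fin n → Srt) → Type u

/-- Terms with free variables in `α`, where the variable `a` has the sort `σ a`. -/
inductive Term (L : Language.{u}) {α : Type w} (σ : α → L.Srt) : L.Srt → Type (max u w)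
  | var (a : α) : Term L σ (σ a)
  | app {n : ℕ} {d : Fin n → L.Srt} {s : L.Srt} (f : L.Fn n d s)
      (t : (i : Fin n) → Term L σ (d i)) : Term L σ s

/-- Formulas with free variables in `α` (of sorts `σ`) and further de Bruijn variables whose sorts
are listed in `l`; the quantifier `all s` binds the first variable of the list. -/
inductive BFormula (L : Language.{u}) {α : Type w} (σ : α → L.Srt) :
    List L.Srt → Type (max u w)
  | falsum {l : List L.Srt} : BFormula L σ l
  | equal {l : List L.Srt} {s : L.Srt} (t t' : Term L (Sum.elim σ l.get) s) : BFormula L σ l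
  | rel {l : List L.Srt} {n : ℕ} {d : Fin n → L.Srt} (r : L.Rel n d)
      (t : (i : Fin n) → Term L (Sum.elim σ l.get) (d i)) : BFormula L σ l
  | imp {l : List L.Srt} (φ φ' : BFormula L σ l) : BFormula L σ l
  | all {l : List L.Srt} (s : L.Srt) (φ : BFormula L σ (s :: l)) : BFormula L σ l

/-- First-order formulas whose free variables are among `α`, the variable `a` having sort `σ a`. -/
abbrev Formula (L : Language.{u}) {α : Type w} (σ : α → L.Srt) : Type (max u w) :=
  BFormula L σ []

/-- Sentences. -/
abbrev Sentence (L : Language.{u}) : Type u :=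
  Formula L (fun a : PEmpty.{u + 1} => (a.elim : L.Srt))

/-- Many-sorted structures; every sort is non-empty. -/
structure Structure (L : Language.{u}) where
  /-- the universe of each sort -/
  car : L.Srt → Type v
  nonempty : ∀ s, Nonempty (car s)
  /-- the interpretation of the function symbols -/
  fn : {n : ℕ} → {d : Fin n → L.Srt} → {s : L.Srt} → L.Fn n d s →
    ((i : Fin n) → car (d i)) → car s
  /-- the interpretation of the relation symbols -/
  rel : {n : ℕ} → {d : Fin n → L.Srt} → L.Rel n d → ((i : Fin n) → car (d i)) → Prop

variable {L : Language.{u}}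

/-- Combine values of two blocks of variables. -/
def join (M : Structure.{u, v} L) {α β : Type*} {σ : α → L.Srt} {τ : β → L.Srt}
    (a : (i : α) → M.car (σ i)) (b : (j : β) → M.car (τ j)) :
    (x : α ⊕ β) → M.car (Sum.elim σ τ x)
  | Sum.inl i => a i
  | Sum.inr j => b j

/-- Values of the list of variables `s :: l`. -/
def consVal (M : Structure.{u, v} L) {s : L.Srt} {l : List L.Srt} (a : M.car s)
    (b : (i : Fin l.length) → M.car (l.get i)) :
    (i : Fin (s :: l).length) → M.car ((s :: l).get i) :=
  Fin.cases a b

/-- The value of a term. -/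
def Term.value (M : Structure.{u, v} L) {α : Type w} {σ : α → L.Srt}
    (x : (a : α) → M.car (σ a)) : {s : L.Srt} → Term L σ s → M.car s
  | _, .var a => x a
  | _, .app f t => M.fn f (fun i => (t i).value M x)

/-- Tarski's truth definition. -/
def BFormula.Holds (M : Structure.{u, v} L) {α : Type w} {σ : α → L.Srt}
    (x : (a : α) → M.car (σ a)) :
    {l : List L.Srt} → BFormula L σ l → ((i : Fin l.length) → M.car (l.get i)) → Prop
  | _, .falsum, _ => False
  | _, .equal t t', y => t.value M (join M x y) = t'.value M (join M x y)
  | _, .rel r t, y => M.rel r (fun i => (t i).value M (join M x y))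
  | _, .imp φ φ', y => φ.Holds M x y → φ'.Holds M x y
  | _, .all s φ, y => ∀ a : M.car s, φ.Holds M x (consVal M a y)

/-- `φ.Realize M x`: the formula `φ` is true in `M` of the tuple `x`. -/
def BFormula.Realize (M : Structure.{u, v} L) {α : Type w} {σ : α → L.Srt} (φ : Formula L σ)
    (x : (a : α) → M.car (σ a)) : Prop :=
  φ.Holds M x (fun i => i.elim0)

/-- `M ⊨ φ` for a sentence `φ`. -/
def Structure.Sat (M : Structure.{u, v} L) (φ : Sentence L) : Prop :=
  φ.Realize M (fun a => a.elim)

/-- `M` is a model of the theory `T`. -/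
def Structure.IsModel (M : Structure.{u, v} L) (T : Set (Sentence L)) : Prop :=
  ∀ φ ∈ T, M.Sat φ

/-- The theory `T` is complete and consistent: it has a model, and it implies `φ` or `¬ φ` for every
sentence `φ`. -/
def IsCompleteTheory (T : Set (Sentence L)) : Prop :=
  (∃ N : Structure.{u, u + 1} L, N.IsModel T) ∧
    ∀ φ : Sentence L, (∀ N : Structure.{u, u + 1} L, N.IsModel T → N.Sat φ) ∨
      (∀ N : Structure.{u, u + 1} L, N.IsModel T → ¬ N.Sat φ)

/-! ### Elements, types, automorphisms, algebraic closure -/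

/-- The elements of `M`, of any sort. -/
abbrev Structure.El (M : Structure.{u, v} L) : Type (max u v) := Σ s : L.Srt, M.car s

/-- The set enumerated by a tuple. -/
def Structure.entries (M : Structure.{u, v} L) {α : Type w} {σ : α → L.Srt}
    (x : (a : α) → M.car (σ a)) : Set M.El :=
  Set.range fun a => (⟨σ a, x a⟩ : M.El)

/-- Formulas in the variables `σ` with parameters from the set `A`. -/
abbrev Structure.FormulaOver (M : Structure.{u, v} L) (A : Set M.El) {α : Type w}
    (σ : α → L.Srt) :=
  Formula L (Sum.elim σ fun a : A => a.1.1)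

/-- The tuple `x` satisfies the formula `φ` with parameters from `A`. -/
def Structure.RealizeOver (M : Structure.{u, v} L) {A : Set M.El} {α : Type w} {σ : α → L.Srt}
    (φ : M.FormulaOver A σ) (x : (a : α) → M.car (σ a)) : Prop :=
  φ.Realize M (join M x fun a : A => a.1.2)

/-- The tuples `x` and `y` have the same complete type over `A`, i.e. `y` realises `tp(x/A)`. -/
def Structure.SameType (M : Structure.{u, v} L) (A : Set M.El) {α : Type w} {σ : α → L.Srt}
    (x y : (a : α) → M.car (σ a)) : Prop :=
  ∀ φ : M.FormulaOver A σ, M.RealizeOver φ x ↔ M.RealizeOver φ y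

/-- Automorphisms of `M`. -/
structure Automorphism (M : Structure.{u, v} L) where
  /-- the permutation of each sort -/
  perm : (s : L.Srt) → M.car s ≃ M.car s
  map_fn : ∀ {n : ℕ} {d : Fin n → L.Srt} {s : L.Srt} (f : L.Fn n d s)
    (x : (i : Fin n) → M.car (d i)), perm s (M.fn f x) = M.fn f (fun i => perm (d i) (x i))
  map_rel : ∀ {n : ℕ} {d : Fin n → L.Srt} (r : L.Rel n d)
    (x : (i : Fin n) → M.car (d i)), M.rel r (fun i => perm (d i) (x i)) ↔ M.rel r x

/-- The action of an automorphism on elements. -/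
def Automorphism.act {M : Structure.{u, v} L} (g : Automorphism M) (e : M.El) : M.El :=
  ⟨e.1, g.perm e.1 e.2⟩

/-- `A ≡_D A'` for sets: some automorphism fixing `D` pointwise maps `A` onto `A'`. -/
def Structure.EquivOver (M : Structure.{u, v} L) (D A A' : Set M.El) : Prop :=
  ∃ g : Automorphism M, (∀ e ∈ D, g.act e = e) ∧ g.act '' A = A'

/-- The algebraic closure: all elements that satisfy a formula over `A` with finitely many
solutions. -/
def Structure.acl (M : Structure.{u, v} L) (A : Set M.El) : Set M.El :=
  {e | ∃ φ : M.FormulaOver A (fun _ : Unit => e.1),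
    M.RealizeOver φ (fun _ => e.2) ∧ {a : M.car e.1 | M.RealizeOver φ (fun _ => a)}.Finite}

/-- `M` is a big saturated model of `T`. "Small" means: of the size of some type in the universe of
the language. Every small partial type that is finitely satisfiable in `M` is realised in `M`
(saturation), and every elementary map between small sets extends to an automorphism of `M`
(strong homogeneity). -/
structure IsBigModel (T : Set (Sentence L)) (M : Structure.{u, u + 1} L) : Prop where
  isModel : M.IsModel T
  saturated : ∀ (A : Set M.El), Small.{u} A → ∀ (s : L.Srt)
    (p : Set (M.FormulaOver A (fun _ : Unit => s))),
    (∀ p₀ ⊆ p, p₀.Finite → ∃ a : M.car s, ∀ φ ∈ p₀, M.RealizeOver φ (fun _ => a)) →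
    ∃ a : M.car s, ∀ φ ∈ p, M.RealizeOver φ (fun _ => a)
  homogeneous : ∀ {ι : Type u} {σ : ι → L.Srt} (x y : (i : ι) → M.car (σ i)),
    M.SameType ∅ x y → ∃ g : Automorphism M, ∀ i, g.perm (σ i) (x i) = y i

/-! ### Independence relations -/

/-- Ternary relations between sets of elements; `R A C B` stands for "`A` is independent from `B`
over `C`". Only the values on small sets matter below. -/
abbrev TernaryRel (M : Structure.{u, u + 1} L) := Set M.El → Set M.El → Set M.El → Prop

section Axioms

variable {M : Structure.{u, u + 1} L} (R : TernaryRel M)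

def Invariance : Prop :=
  ∀ A B C : Set M.El, Small.{u} A → Small.{u} B → Small.{u} C → R A C B →
    ∀ g : Automorphism M, R (g.act '' A) (g.act '' C) (g.act '' B)

def Monotonicity : Prop :=
  ∀ A B C A' B' : Set M.El, Small.{u} A → Small.{u} B → Small.{u} C → R A C B →
    A' ⊆ A → B' ⊆ B → R A' C B'

def BaseMonotonicity : Prop :=
  ∀ A B C D : Set M.El, Small.{u} A → Small.{u} B → D ⊆ C → C ⊆ B → R A D B → R A C B

def Transitivity : Prop :=
  ∀ A B C D : Set M.El, Small.{u} A → Small.{u} B → D ⊆ C → C ⊆ B → R B C A → R C D A → R B D A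

def Normality : Prop :=
  ∀ A B C : Set M.El, Small.{u} A → Small.{u} B → Small.{u} C → R A C B → R (A ∪ C) C B

def Extension : Prop :=
  ∀ A B C B' : Set M.El, Small.{u} A → Small.{u} B → Small.{u} C → Small.{u} B' →
    R A C B → B ⊆ B' → ∃ A', M.EquivOver (B ∪ C) A A' ∧ R A' C B'

def FiniteCharacter : Prop :=
  ∀ A B C : Set M.El, Small.{u} A → Small.{u} B → Small.{u} C →
    (∀ A₀ ⊆ A, A₀.Finite → R A₀ C B) → R A C B

/-- For every `A` there is a (small) cardinal `κ` such that every `B` has a subset `C` of fewer than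
`κ` elements with `A` independent from `B` over `C`. -/
def LocalCharacter : Prop :=
  ∀ A : Set M.El, Small.{u} A → ∃ κ : Cardinal.{u}, ∀ B : Set M.El, Small.{u} B →
    ∃ C ⊆ B, Cardinal.mk C < Cardinal.lift.{u + 1} κ ∧ R A C B

def AntiReflexivity : Prop :=
  ∀ (a : M.El) (B : Set M.El), Small.{u} B → R {a} B {a} → a ∈ M.acl B

/-- Independence relations. -/
structure IsIndependenceRelation : Prop where
  invariance : Invariance R
  monotonicity : Monotonicity R
  baseMonotonicity : BaseMonotonicity R
  transitivity : Transitivity R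
  normality : Normality R
  extension : Extension R
  finiteCharacter : FiniteCharacter R
  localCharacter : LocalCharacter R

/-- Strict independence relations. -/
structure IsStrictIndependenceRelation : Prop extends IsIndependenceRelation R where
  antiReflexivity : AntiReflexivity R

end Axioms

/-- M-dividing independence. -/
def MInd (M : Structure.{u, u + 1} L) : TernaryRel M := fun A C B =>
  ∀ C' : Set M.El, C ⊆ C' → C' ⊆ M.acl (B ∪ C) →
    M.acl (A ∪ C') ∩ M.acl (B ∪ C') = M.acl C'

/-- Thorn-forking independence. -/
def ThornInd (M : Structure.{u, u + 1} L) : TernaryRel M := fun A C B =>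
  ∀ B' : Set M.El, Small.{u} B' → B ⊆ B' → ∃ A', M.EquivOver (B ∪ C) A A' ∧ MInd M A' C B'

/-! ### Inconsistency pairs and local ranks -/

/-- An inconsistency pair `(φ(x; y), ψ(y₀, …, y_{k-1}))` with left variables `x`: the formula
`φ(x; y₀) ∧ … ∧ φ(x; y_{k-1}) ∧ ψ(y₀, …, y_{k-1})` is inconsistent. -/
structure InconsistencyPair (M : Structure.{u, u + 1} L) {m : ℕ} (x : Fin m → L.Srt) where
  /-- the length of the tuple of variables `y` -/
  n : ℕ
  /-- the sorts of the variables `y` -/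
  y : Fin n → L.Srt
  /-- the number of copies of `y` in the inconsistency witness -/
  k : ℕ
  /-- the formula `φ(x; y)` -/
  φ : Formula L (Sum.elim x y)
  /-- the inconsistency witness `ψ(y₀, …, y_{k-1})` -/
  ψ : Formula L (fun j : Fin k × Fin n => y j.2)
  inconsistent : ¬ ∃ (a : (i : Fin m) → M.car (x i)) (b : (j : Fin k × Fin n) → M.car (y j.2)),
    (∀ i : Fin k, φ.Realize M (join M a fun l => b (i, l))) ∧ ψ.Realize M b

section Rank

variable {M : Structure.{u, u + 1} L} {m : ℕ} {x : Fin m → L.Srt}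

/-- Membership in `Ξ_M`: one of the variables `y`, called `u`, is singled out, the others form the
tuple `v`, and `ψ` is equivalent to the conjunction of `uᵢ ≠ uⱼ ∧ vᵢ = vⱼ` over `i < j < k`. -/
def InconsistencyPair.MemXiM (q : InconsistencyPair M x) : Prop :=
  ∃ u₀ : Fin q.n, ∀ b : (j : Fin q.k × Fin q.n) → M.car (q.y j.2),
    q.ψ.Realize M b ↔
      ∀ i j : Fin q.k, i < j → b (i, u₀) ≠ b (j, u₀) ∧ ∀ l : Fin q.n, l ≠ u₀ → b (i, l) = b (j, l)

/-- For `q = (φ, ψ)`: the formula `φ(x; b)` `(φ, ψ)`-divides over `C`. -/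
def InconsistencyPair.Divides (q : InconsistencyPair M x) (b : (l : Fin q.n) → M.car (q.y l))
    (C : Set M.El) : Prop :=
  ∃ c : ℕ → (l : Fin q.n) → M.car (q.y l),
    (∀ i, M.SameType C b (c i)) ∧
    ∀ f : Fin q.k → ℕ, StrictMono f → q.ψ.Realize M (fun j => c (f j.1) j.2)

/-- The sequence `ξ` of inconsistency pairs is a dividing pattern for the partial type `p` over `C`:
there are tuples `b i` such that `p ∪ {φᵢ(x; b i) | i}` is consistent and each `φᵢ(x; b i)`
`(φᵢ, ψᵢ)`-divides over `C ∪ {b j | j < i}`. -/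
def IsDividingPattern {C : Set M.El} (p : Set (M.FormulaOver C x)) {I : Type w} [LinearOrder I]
    (ξ : I → InconsistencyPair M x) : Prop :=
  ∃ b : (i : I) → (l : Fin (ξ i).n) → M.car ((ξ i).y l),
    (∀ (p₀ : Set (M.FormulaOver C x)) (I₀ : Set I), p₀ ⊆ p → p₀.Finite → I₀.Finite →
      ∃ a : (i : Fin m) → M.car (x i),
        (∀ θ ∈ p₀, M.RealizeOver θ a) ∧ ∀ i ∈ I₀, (ξ i).φ.Realize M (join M a (b i))) ∧
    ∀ i, (ξ i).Divides (b i) (C ∪ ⋃ j : Set.Iio i, M.entries (b j))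

open Classical in
/-- The rank `D_Δ(p)`: it is `∞` if `p` has `Δ`-dividing patterns of arbitrary order type, and
otherwise the greatest `n` such that `p` has a `Δ`-dividing pattern of length `n`. -/
noncomputable def rankD (Δ : Set (InconsistencyPair M x)) {C : Set M.El}
    (p : Set (M.FormulaOver C x)) : ℕ∞ :=
  if ∀ (I : Type u) [LinearOrder I],
      ∃ ξ : I → InconsistencyPair M x, (∀ i, ξ i ∈ Δ) ∧ IsDividingPattern p ξ
  then ⊤
  else sSup {N : ℕ∞ | ∃ n : ℕ, N = n ∧
    ∃ ξ : Fin n → InconsistencyPair M x, (∀ i, ξ i ∈ Δ) ∧ IsDividingPattern p ξ}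

end Rank

/-- `D_{φ,ψ}(∅) < ∞` for every `(φ, ψ) ∈ Ξ_M`. -/
def FiniteXiMRanks (M : Structure.{u, u + 1} L) : Prop :=
  ∀ (m : ℕ) (x : Fin m → L.Srt) (q : InconsistencyPair M x), q.MemXiM →
    rankD {q} (∅ : Set (M.FormulaOver (∅ : Set M.El) x)) < ⊤

/-! ### Imaginaries -/

/-- The imaginary sorts: formulas without parameters that define an equivalence relation on the
finite tuples of given sorts. -/
structure ImaginarySort (M : Structure.{u, u + 1} L) where
  /-- the length of the tuples -/
  n : ℕ
  /-- the sorts of the tuples -/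
  s : Fin n → L.Srt
  /-- the formula that defines the equivalence relation -/
  E : Formula L (Sum.elim s s)
  equiv : Equivalence fun a b : (i : Fin n) → M.car (s i) => E.Realize M (join M a b)

/-- The equivalence relation of an imaginary sort. -/
def ImaginarySort.setoid {M : Structure.{u, u + 1} L} (S : ImaginarySort M) :
    Setoid ((i : Fin S.n) → M.car (S.s i)) :=
  ⟨fun a b => S.E.Realize M (join M a b), S.equiv⟩

/-- The function symbols of `L^eq`: those of `L` and the projections onto the imaginary sorts. -/
inductive EqFn (M : Structure.{u, u + 1} L) :
    (n : ℕ) → (Fin n → L.Srt ⊕ ImaginarySort M) → L.Srt ⊕ ImaginarySort M → Type u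
  | old {n : ℕ} {d : Fin n → L.Srt} {s : L.Srt} (f : L.Fn n d s) :
      EqFn M n (fun i => Sum.inl (d i)) (Sum.inl s)
  | proj (S : ImaginarySort M) : EqFn M S.n (fun i => Sum.inl (S.s i)) (Sum.inr S)

/-- The relation symbols of `L^eq`: those of `L`. -/
inductive EqRel (M : Structure.{u, u + 1} L) :
    (n : ℕ) → (Fin n → L.Srt ⊕ ImaginarySort M) → Type u
  | old {n : ℕ} {d : Fin n → L.Srt} (r : L.Rel n d) : EqRel M n (fun i => Sum.inl (d i))

/-- The language `L^eq` (for the complete theory of `M`). -/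
def eqLanguage (M : Structure.{u, u + 1} L) : Language.{u} where
  Srt := L.Srt ⊕ ImaginarySort M
  Fn := EqFn M
  Rel := EqRel M

/-- The universes of `M^eq`. -/
def eqCar (M : Structure.{u, u + 1} L) : L.Srt ⊕ ImaginarySort M → Type (u + 1)
  | Sum.inl s => M.car s
  | Sum.inr S => Quotient S.setoid

/-- The function symbols in `M^eq`. -/
def eqFnVal (M : Structure.{u, u + 1} L) : {n : ℕ} → {d : Fin n → L.Srt ⊕ ImaginarySort M} →
    {s : L.Srt ⊕ ImaginarySort M} → EqFn M n d s → ((i : Fin n) → eqCar M (d i)) → eqCar M s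
  | _, _, _, .old f, a => M.fn f a
  | _, _, _, .proj S, a => Quotient.mk S.setoid a

/-- The relation symbols in `M^eq`. -/
def eqRelVal (M : Structure.{u, u + 1} L) : {n : ℕ} → {d : Fin n → L.Srt ⊕ ImaginarySort M} →
    EqRel M n d → ((i : Fin n) → eqCar M (d i)) → Prop
  | _, _, .old r, a => M.rel r a

theorem eqCar_nonempty (M : Structure.{u, u + 1} L) (s : L.Srt ⊕ ImaginarySort M) :
    Nonempty (eqCar M s) := by
  cases s with
  | inl s => exact M.nonempty s
  | inr S => exact ⟨Quotient.mk S.setoid fun i => (M.nonempty (S.s i)).some⟩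

/-- The structure `M^eq`. If `M` is the big model of `T`, then `T^eq` is the theory of `M^eq`, and
`M^eq` is its big model. -/
def Structure.eq (M : Structure.{u, u + 1} L) : Structure.{u, u + 1} (eqLanguage M) where
  car := eqCar M
  nonempty := eqCar_nonempty M
  fn := eqFnVal M
  rel := eqRelVal M

/-- The complete theory with big model `M` is rosy: thorn-forking independence, evaluated in
`M^eq`, is an independence relation. -/
def IsRosy (M : Structure.{u, u + 1} L) : Prop :=
  IsIndependenceRelation (ThornInd M.eq)

end ManySorted

/-! Everything is governed by formulas φ(x; u, v) that bound, uniformly in x and v, the number of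
solutions u (`AlgForm`). If φ(a; u, v) holds with u, v in acl(BC) and u is not algebraic over Cv,
then a is not M-independent from B over C; by `exists_algForm` every failure of M-independence has
such a witness. Compactness then shows that thorn-forking is witnessed by a finite disjunction of
such instances (`exists_dividing_of_not_thornInd`).

The combinatorial core is `HasBoundedPatterns`: for each φ there is a bound on the length of
sequences (uᵢ, vᵢ) that satisfy φ with one common a while uᵢ is not algebraic over vᵢ and the
earlier tuples. This is the finiteness of the ranks, because for pairs in Ξ_M dividing over C just
means that u is not algebraic over Cv (`InconsistencyPair.divides_iff`).

Bounded patterns give local character: for each finite set Δ of formulas choose a finite subset of B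
over which patterns for a are as short as possible, and let C be the union of these subsets. If a
forked with B over C through Δ, a pattern of maximal length could be moved so that it stays a
pattern over the forking parameters, and one forking instance in front of it would make it too long.
They also give symmetry: if A is thorn-independent from B over C but B forks with A, then
independent copies of the forking parameters can be stacked into arbitrarily long patterns for an
enumeration of B.

Conversely, an unbounded pattern can be stretched by compactness to any order type. Along a long
regular cardinal it refutes local character of M-independence. Along ω, the limit of the sequence
for a non-principal ultrafilter has a type finitely satisfiable in the sequence, hence is
thorn-independent from x over it, although x is not M-independent from that limit; so even the weak
form of symmetry fails.

A strict independence relation is finer than M-independence, since both sides may be closed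
algebraically and anti-reflexivity applies to a common element; by extension it is finer than
thorn-independence (`IsStrictIndependenceRelation.thornInd`). So it passes local character on, and
thorn-independence is the coarsest such relation.

Only saturation and strong homogeneity of M enter. Both pass to M^eq by computing with
representatives (`IsSaturatedHomogeneous.eq`), which yields the statement on rosy theories. -/

namespace ManySorted

variable {L : Language.{u}}

/-! ### Substitution of terms into formulas -/

section Substitution

variable {α : Type*} {β : Type*} {σ : α → L.Srt} {τ : β → L.Srt}

/-- Simultaneous substitution of terms for variables. -/
def Term.subst (t : ∀ a, Term L τ (σ a)) : {s : L.Srt} → Term L σ s → Term L τ s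
  | _, .var a => t a
  | _, .app f r => .app f fun i => (r i).subst t

theorem Term.value_subst (M : Structure.{u, v} L) (t : ∀ a, Term L τ (σ a))
    (x : ∀ b, M.car (τ b)) {s : L.Srt} (r : Term L σ s) :
    (r.subst t).value M x = r.value M fun a => (t a).value M x := by
  induction r with
  | var a => rfl
  | app f r ih => simp only [Term.subst, Term.value, ih]

/-- Weakening of a term by a further bound variable. -/
def Term.shift (s₀ : L.Srt) {l : List L.Srt} {s : L.Srt} (r : Term L (Sum.elim τ l.get) s) :
    Term L (Sum.elim τ (s₀ :: l).get) s :=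
  r.subst fun
    | .inl a => .var (σ := Sum.elim τ (s₀ :: l).get) (.inl a)
    | .inr i => .var (σ := Sum.elim τ (s₀ :: l).get) (.inr i.succ)

theorem Term.value_shift (M : Structure.{u, v} L) {s₀ : L.Srt} {l : List L.Srt} {s : L.Srt}
    (r : Term L (Sum.elim τ l.get) s) (x : ∀ b, M.car (τ b))
    (y : (i : Fin l.length) → M.car (l.get i)) (a : M.car s₀) :
    (r.shift s₀).value M (join M x (consVal M a y)) = r.value M (join M x y) := by
  unfold Term.shift
  rw [Term.value_subst]
  congr 1
  funext z
  rcases z with z | z <;> rfl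

/-- The substitution under a quantifier. -/
def liftSubst (s₀ : L.Srt) {l l' : List L.Srt}
    (t : ∀ z, Term L (Sum.elim τ l'.get) (Sum.elim σ l.get z)) :
    ∀ z, Term L (Sum.elim τ (s₀ :: l').get) (Sum.elim σ (s₀ :: l).get z)
  | .inl a => (t (.inl a)).shift s₀
  | .inr i => Fin.cases (motive := fun i => Term L (Sum.elim τ (s₀ :: l').get) ((s₀ :: l).get i))
      (.var (σ := Sum.elim τ (s₀ :: l').get) (.inr 0)) (fun j => (t (.inr j)).shift s₀) i

/-- Substitution of terms for the free and the bound variables of a formula. -/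
def BFormula.bsubst : {l l' : List L.Srt} →
    (∀ z, Term L (Sum.elim τ l'.get) (Sum.elim σ l.get z)) → BFormula L σ l → BFormula L τ l'
  | _, _, _, .falsum => .falsum
  | _, _, t, .equal r r' => .equal (r.subst t) (r'.subst t)
  | _, _, t, .rel R r => .rel R fun i => (r i).subst t
  | _, _, t, .imp φ φ' => .imp (φ.bsubst t) (φ'.bsubst t)
  | _, _, t, .all s φ => .all s (φ.bsubst (liftSubst s t))

/-- The target list and both assignments stay general in the induction because each quantifier
prepends a bound variable to both lists and weakens the substituted terms. -/
theorem BFormula.holds_bsubst (M : Structure.{u, v} L) {l : List L.Srt} (φ : BFormula L σ l) :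
    ∀ {l' : List L.Srt} (t : ∀ z, Term L (Sum.elim τ l'.get) (Sum.elim σ l.get z))
      (x : ∀ a, M.car (σ a)) (y : (i : Fin l.length) → M.car (l.get i))
      (x' : ∀ b, M.car (τ b)) (y' : (i : Fin l'.length) → M.car (l'.get i)),
      (∀ z, (t z).value M (join M x' y') = join M x y z) →
      ((φ.bsubst t).Holds M x' y' ↔ φ.Holds M x y) := by
  induction φ with
  | falsum => intros; rfl
  | equal r r' =>
    intro l' t x y x' y' h
    simp only [BFormula.bsubst, BFormula.Holds, Term.value_subst, h]
  | rel R r =>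
    intro l' t x y x' y' h
    simp only [BFormula.bsubst, BFormula.Holds, Term.value_subst, h]
  | imp φ φ' ih ih' =>
    intro l' t x y x' y' h
    simp only [BFormula.bsubst, BFormula.Holds, ih t x y x' y' h, ih' t x y x' y' h]
  | all s φ ih =>
    intro l' t x y x' y' h
    simp only [BFormula.bsubst, BFormula.Holds]
    refine forall_congr' fun a => ih _ _ _ _ _ ?_
    rintro (z | z)
    · exact (Term.value_shift M _ _ _ _).trans (h (.inl z))
    · refine Fin.cases ?_ (fun j => ?_) z
      · rfl
      · exact (Term.value_shift M _ _ _ _).trans (h (.inr j))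

end Substitution

/-! ### Parameter-free definable predicates and their closure properties -/

section Definable

variable (M : Structure.{u, v} L) {α : Type*} {β : Type*} {σ : α → L.Srt} {τ : β → L.Srt}

/-- Predicates of tuples that are definable without parameters. -/
def Definable (σ : α → L.Srt) (P : (∀ a, M.car (σ a)) → Prop) : Prop :=
  ∃ φ : Formula L σ, ∀ x, φ.Realize M x ↔ P x

variable {M}

theorem definable_realize (φ : Formula L σ) : Definable M σ fun x => φ.Realize M x :=
  ⟨φ, fun _ => Iff.rfl⟩

theorem Definable.congr {P Q : (∀ a, M.car (σ a)) → Prop} (h : Definable M σ P)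
    (e : ∀ x, P x ↔ Q x) : Definable M σ Q := by
  obtain ⟨φ, hφ⟩ := h
  exact ⟨φ, fun x => (hφ x).trans (e x)⟩

theorem definable_false : Definable M σ fun _ => False :=
  ⟨.falsum, fun _ => Iff.rfl⟩

theorem Definable.imp {P Q : (∀ a, M.car (σ a)) → Prop} (hP : Definable M σ P)
    (hQ : Definable M σ Q) : Definable M σ fun x => P x → Q x := by
  obtain ⟨φ, hφ⟩ := hP
  obtain ⟨χ, hχ⟩ := hQ
  exact ⟨.imp φ χ, fun x => imp_congr (hφ x) (hχ x)⟩

theorem Definable.not {P : (∀ a, M.car (σ a)) → Prop} (hP : Definable M σ P) :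
    Definable M σ fun x => ¬ P x :=
  hP.imp definable_false

theorem definable_true : Definable M σ fun _ => True :=
  definable_false.not.congr fun _ => by simp

theorem Definable.and {P Q : (∀ a, M.car (σ a)) → Prop} (hP : Definable M σ P)
    (hQ : Definable M σ Q) : Definable M σ fun x => P x ∧ Q x :=
  (hP.imp hQ.not).not.congr fun _ => by tauto

theorem definable_forall_mem_finite {κ : Type*} {s : Set κ} (hs : s.Finite)
    (P : κ → (∀ a, M.car (σ a)) → Prop) (hP : ∀ k ∈ s, Definable M σ (P k)) :
    Definable M σ fun x => ∀ k ∈ s, P k x := by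
  induction s, hs using Set.Finite.induction_on with
  | empty => exact definable_true.congr fun _ => by simp
  | insert _ _ ih =>
    refine ((hP _ (Set.mem_insert _ _)).and
      (ih fun k hk => hP k (Set.mem_insert_of_mem _ hk))).congr fun x => ?_
    simp

theorem definable_forall_finite {κ : Type*} [Finite κ]
    (P : κ → (∀ a, M.car (σ a)) → Prop) (hP : ∀ k, Definable M σ (P k)) :
    Definable M σ fun x => ∀ k, P k x :=
  (definable_forall_mem_finite Set.finite_univ P fun k _ => hP k).congr fun x => by simp

theorem definable_exists_finite {κ : Type*} [Finite κ]
    (P : κ → (∀ a, M.car (σ a)) → Prop) (hP : ∀ k, Definable M σ (P k)) :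
    Definable M σ fun x => ∃ k, P k x :=
  (definable_forall_finite _ fun k => (hP k).not).not.congr fun x => by simp

/-- A term as a term with no bound variables around. -/
def Term.lift {s : L.Srt} (l : List L.Srt) (t : Term L σ s) : Term L (Sum.elim σ l.get) s :=
  t.subst fun a => .var (σ := Sum.elim σ l.get) (.inl a)

theorem Term.value_lift {s : L.Srt} {l : List L.Srt} (t : Term L σ s) (x : ∀ a, M.car (σ a))
    (y : (i : Fin l.length) → M.car (l.get i)) :
    (t.lift l).value M (join M x y) = t.value M x :=
  Term.value_subst (τ := Sum.elim σ l.get) M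
    (fun a => .var (σ := Sum.elim σ l.get) (.inl a)) (join M x y) t

theorem definable_equal {s : L.Srt} (t t' : Term L σ s) :
    Definable M σ fun x => t.value M x = t'.value M x :=
  ⟨.equal (t.lift []) (t'.lift []), fun x => by
    simp only [BFormula.Realize, BFormula.Holds, Term.value_lift]⟩

theorem definable_rel {n : ℕ} {d : Fin n → L.Srt} (r : L.Rel n d)
    (t : (i : Fin n) → Term L σ (d i)) :
    Definable M σ fun x => M.rel r fun i => (t i).value M x :=
  ⟨.rel r fun i => (t i).lift [], fun x => by
    simp only [BFormula.Realize, BFormula.Holds, Term.value_lift]⟩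

theorem Definable.subst {P : (∀ a, M.car (σ a)) → Prop} (hP : Definable M σ P)
    (t : ∀ a, Term L τ (σ a)) :
    Definable M τ fun x => P fun a => (t a).value M x := by
  obtain ⟨φ, hφ⟩ := hP
  refine ⟨φ.bsubst (l' := []) fun
    | .inl a => (t a).lift []
    | .inr i => i.elim0, fun x => ?_⟩
  refine (BFormula.holds_bsubst M φ _ _ _ _ _ ?_).trans (hφ _)
  rintro (a | i)
  · exact Term.value_lift _ _ _
  · exact i.elim0

/-- Substitution of variables, where the sorts match up to a proof. -/
theorem Definable.comp {P : (∀ a, M.car (σ a)) → Prop} (hP : Definable M σ P) (f : α → β)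
    (hf : ∀ a, τ (f a) = σ a) (Q : (∀ b, M.car (τ b)) → Prop)
    (hQ : ∀ x, Q x ↔ P fun a => hf a ▸ x (f a)) : Definable M τ Q := by
  refine (hP.subst fun a => hf a ▸ Term.var (f a)).congr fun x => ?_
  rw [hQ]
  have : ∀ a, Term.value M x (hf a ▸ Term.var (L := L) (σ := τ) (f a)) = hf a ▸ x (f a) := by
    intro a
    generalize hf a = e
    revert e
    generalize σ a = s
    rintro rfl
    rfl
  simp only [this]

theorem Definable.forall_last {s : L.Srt}
    {P : (∀ a, M.car (Sum.elim σ (fun _ : Unit => s) a)) → Prop}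
    (hP : Definable M (Sum.elim σ fun _ : Unit => s) P) :
    Definable M σ fun x => ∀ a : M.car s, P (join M x fun _ => a) := by
  obtain ⟨φ, hφ⟩ := hP
  refine ⟨.all s (φ.bsubst (σ := Sum.elim σ fun _ : Unit => s) (τ := σ) (l' := [s]) fun
    | .inl (.inl a) => .var (σ := Sum.elim σ [s].get) (.inl a)
    | .inl (.inr _) => .var (σ := Sum.elim σ [s].get) (.inr 0)
    | .inr i => i.elim0), fun x => ?_⟩
  simp only [BFormula.Realize, BFormula.Holds]
  refine forall_congr' fun a => (BFormula.holds_bsubst M φ _ _ _ _ _ ?_).trans (hφ _)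
  rintro ((z | z) | i)
  · rfl
  · rfl
  · exact i.elim0

theorem Definable.exists_last {s : L.Srt}
    {P : (∀ a, M.car (Sum.elim σ (fun _ : Unit => s) a)) → Prop}
    (hP : Definable M (Sum.elim σ fun _ : Unit => s) P) :
    Definable M σ fun x => ∃ a : M.car s, P (join M x fun _ => a) :=
  hP.not.forall_last.not.congr fun _ => by simp

/-- The first variable of the block is moved to the free ones and quantified last; hence the
induction runs over all blocks of free variables. -/
theorem Definable.exists_fin {n : ℕ} : ∀ {α : Type*} {σ : α → L.Srt} {τ : Fin n → L.Srt}
    {P : (∀ a, M.car (Sum.elim σ τ a)) → Prop}, Definable M (Sum.elim σ τ) P →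
    Definable M σ fun x => ∃ b : ∀ i, M.car (τ i), P (join M x b) := by
  induction n with
  | zero =>
    intro α σ τ P hP
    refine (hP.subst (τ := σ) fun z => match z with
      | .inl a => .var a
      | .inr i => i.elim0).congr fun x => ?_
    constructor
    · intro h
      refine ⟨fun i => i.elim0, ?_⟩
      convert h using 1
      funext z
      rcases z with z | z
      · rfl
      · exact z.elim0
    · rintro ⟨b, h⟩
      convert h using 1
      funext z
      rcases z with z | z
      · rfl
      · exact z.elim0
  | succ n ih =>
    intro α σ τ P hP
    have h1 : Definable M (Sum.elim (Sum.elim σ fun _ : Unit => τ 0) fun i : Fin n => τ i.succ)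
        fun x => P (join M (fun a => x (.inl (.inl a)))
          (Fin.cases (motive := fun i => M.car (τ i)) (x (.inl (.inr ()))) fun i => x (.inr i))) := by
      refine (hP.subst (τ := Sum.elim (Sum.elim σ fun _ : Unit => τ 0) fun i : Fin n => τ i.succ)
        (fun z => match z with
        | .inl a => .var (σ := Sum.elim (Sum.elim σ fun _ : Unit => τ 0) fun i : Fin n => τ i.succ)
            (.inl (.inl a))
        | .inr i => Fin.cases (motive := fun i => Term L (Sum.elim (Sum.elim σ fun _ : Unit => τ 0)
            fun i : Fin n => τ i.succ) (τ i))
            (.var (σ := Sum.elim (Sum.elim σ fun _ : Unit => τ 0) fun i : Fin n => τ i.succ)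
              (.inl (.inr ())))
            (fun j => .var (σ := Sum.elim (Sum.elim σ fun _ : Unit => τ 0)
              fun i : Fin n => τ i.succ) (.inr j)) i)).congr fun x => ?_
      refine iff_of_eq (congrArg P ?_)
      funext z
      rcases z with z | z
      · rfl
      · refine Fin.cases ?_ (fun j => ?_) z <;> rfl
    refine (ih h1).exists_last.congr fun x => ?_
    constructor
    · rintro ⟨a, b, h⟩
      exact ⟨_, h⟩
    · rintro ⟨b, h⟩
      refine ⟨b 0, fun i => b i.succ, ?_⟩
      refine (iff_of_eq (congrArg P ?_)).mp h
      funext z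
      rcases z with z | z
      · rfl
      · refine Fin.cases ?_ (fun j => ?_) z <;> rfl

end Definable

end ManySorted

namespace ManySorted

variable {L : Language.{u}}

/-! ### Finite support, and quantification over arbitrary blocks -/

section Support

variable {M : Structure.{u, v} L} {α : Type*} {β : Type*} {σ : α → L.Srt} {τ : β → L.Srt}

theorem Term.exists_support (M : Structure.{u, v} L) {l : List L.Srt} {s : L.Srt}
    (t : Term L (Sum.elim σ l.get) s) :
    ∃ F : Set α, F.Finite ∧ ∀ S, F ⊆ S →
      ∃ t' : Term L (Sum.elim (fun a : S => σ a) l.get) s, ∀ (x : ∀ a, M.car (σ a)) y,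
        t'.value M (join M (fun a : S => x a) y) = t.value M (join M x y) := by
  induction t with
  | var z =>
    rcases z with a | i
    · refine ⟨{a}, Set.finite_singleton a, fun S hS => ?_⟩
      exact ⟨.var (σ := Sum.elim (fun a : S => σ a) l.get) (.inl ⟨a, hS rfl⟩), fun _ _ => rfl⟩
    · refine ⟨∅, Set.finite_empty, fun S _ => ?_⟩
      exact ⟨.var (σ := Sum.elim (fun a : S => σ a) l.get) (.inr i), fun _ _ => rfl⟩
  | app f r ih =>
    choose F hF h using ih
    refine ⟨⋃ i, F i, Set.finite_iUnion hF, fun S hS => ?_⟩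
    choose t ht using fun i => h i S ((Set.subset_iUnion F i).trans hS)
    exact ⟨.app f t, fun x y => by simp only [Term.value, ht]⟩

/-- Allowing every S above F lets the supports of subformulas be enlarged to a common one. -/
theorem BFormula.exists_support (M : Structure.{u, v} L) {l : List L.Srt} (φ : BFormula L σ l) :
    ∃ F : Set α, F.Finite ∧ ∀ S, F ⊆ S →
      ∃ φ' : BFormula L (fun a : S => σ a) l, ∀ (x : ∀ a, M.car (σ a)) y,
        φ'.Holds M (fun a : S => x a) y ↔ φ.Holds M x y := by
  induction φ with
  | falsum => exact ⟨∅, Set.finite_empty, fun S _ => ⟨.falsum, fun _ _ => Iff.rfl⟩⟩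
  | equal r r' =>
    obtain ⟨F, hF, h⟩ := r.exists_support M
    obtain ⟨F', hF', h'⟩ := r'.exists_support M
    refine ⟨F ∪ F', hF.union hF', fun S hS => ?_⟩
    obtain ⟨t, ht⟩ := h S (Set.subset_union_left.trans hS)
    obtain ⟨t', ht'⟩ := h' S (Set.subset_union_right.trans hS)
    exact ⟨.equal t t', fun x y => by simp only [BFormula.Holds, ht, ht']⟩
  | rel R r =>
    choose F hF h using fun i => (r i).exists_support M
    refine ⟨⋃ i, F i, Set.finite_iUnion hF, fun S hS => ?_⟩
    choose t ht using fun i => h i S ((Set.subset_iUnion F i).trans hS)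
    exact ⟨.rel R t, fun x y => by simp only [BFormula.Holds, ht]⟩
  | imp φ φ' ih ih' =>
    obtain ⟨F, hF, h⟩ := ih
    obtain ⟨F', hF', h'⟩ := ih'
    refine ⟨F ∪ F', hF.union hF', fun S hS => ?_⟩
    obtain ⟨t, ht⟩ := h S (Set.subset_union_left.trans hS)
    obtain ⟨t', ht'⟩ := h' S (Set.subset_union_right.trans hS)
    exact ⟨.imp t t', fun x y => by simp only [BFormula.Holds, ht, ht']⟩
  | all s φ ih =>
    obtain ⟨F, hF, h⟩ := ih
    refine ⟨F, hF, fun S hS => ?_⟩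
    obtain ⟨t, ht⟩ := h S hS
    exact ⟨.all s t, fun x y => by simp only [BFormula.Holds, ht]⟩

theorem Definable.exists_support {P : (∀ a, M.car (σ a)) → Prop} (hP : Definable M σ P) :
    ∃ F : Set α, F.Finite ∧ ∀ S, F ⊆ S →
      ∃ P' : (∀ a : S, M.car (σ a)) → Prop, Definable M (fun a : S => σ a) P' ∧
        ∀ x, P' (fun a => x a) ↔ P x := by
  obtain ⟨φ, hφ⟩ := hP
  obtain ⟨F, hF, h⟩ := BFormula.exists_support M φ
  refine ⟨F, hF, fun S hS => ?_⟩
  obtain ⟨φ', h'⟩ := h S hS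
  exact ⟨_, definable_realize φ', fun x => (h' x _).trans (hφ x)⟩

theorem eqRec_apply (x : ∀ b, M.car (τ b)) {b b' : β} (h : b = b') (e : τ b = τ b') :
    e ▸ x b = x b' := by
  subst h
  rfl

theorem Definable.exists_finite [Finite β] {P : (∀ a, M.car (Sum.elim σ τ a)) → Prop}
    (hP : Definable M (Sum.elim σ τ) P) :
    Definable M σ fun x => ∃ b : ∀ i, M.car (τ i), P (join M x b) := by
  obtain ⟨n, ⟨e⟩⟩ := Finite.exists_equiv_fin β
  have hf : ∀ a, Sum.elim σ (fun i => τ (e.symm i)) (Sum.map id e a) = Sum.elim σ τ a := by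
    rintro (a | b)
    · rfl
    · exact congrArg τ (e.symm_apply_apply b)
  have h1 := hP.comp (τ := Sum.elim σ fun i => τ (e.symm i)) (Sum.map id e) hf _ fun _ => Iff.rfl
  refine h1.exists_fin.congr fun x => ?_
  constructor
  · rintro ⟨b, hb⟩
    refine ⟨fun i => Eq.rec (motive := fun s _ => M.car s) (b (e i)) (hf (.inr i)),
      (iff_of_eq (congrArg P ?_)).mp hb⟩
    funext z
    rcases z with z | z <;> rfl
  · rintro ⟨b, hb⟩
    refine ⟨fun i => b (e.symm i), (iff_of_eq (congrArg P ?_)).mp hb⟩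
    funext z
    rcases z with z | z
    · rfl
    · exact (eqRec_apply b (e.symm_apply_apply z) (hf (.inr z))).symm

open Classical in
/-- A tuple with prescribed values on a part of the index set. -/
noncomputable def extendTuple (M : Structure.{u, v} L) {τ : β → L.Srt} {S : Set β}
    (x : ∀ b : S, M.car (τ b)) (b : β) : M.car (τ b) :=
  if h : b ∈ S then x ⟨b, h⟩ else (M.nonempty (τ b)).some

theorem extendTuple_mem {S : Set β} (x : ∀ b : S, M.car (τ b)) (b : S) :
    extendTuple M x b = x b := by
  simp [extendTuple]

/-- Definable predicates are closed under quantification over arbitrary blocks of variables. -/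
theorem Definable.exists_block {P : (∀ a, M.car (Sum.elim σ τ a)) → Prop}
    (hP : Definable M (Sum.elim σ τ) P) :
    Definable M σ fun x => ∃ b : ∀ i, M.car (τ i), P (join M x b) := by
  obtain ⟨F, hF, h⟩ := hP.exists_support
  let G : Set β := {b | Sum.inr b ∈ F}
  have hG : G.Finite := hF.preimage Sum.inr_injective.injOn
  have : Finite G := hG
  obtain ⟨P', hP', hP'P⟩ := h (Set.range Sum.inl ∪ Sum.inr '' G) (by
    rintro (a | b) hz
    · exact Or.inl ⟨a, rfl⟩
    · exact Or.inr ⟨b, hz, rfl⟩)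
  let t : ∀ z : ↥(Set.range (Sum.inl : α → α ⊕ β) ∪ Sum.inr '' G),
      Term L (Sum.elim σ fun b : G => τ b) (Sum.elim σ τ z) := fun z => match z with
    | ⟨.inl a, _⟩ => .var (σ := Sum.elim σ fun b : G => τ b) (.inl a)
    | ⟨.inr b, hb⟩ => .var (σ := Sum.elim σ fun b : G => τ b) (.inr ⟨b, by simpa using hb⟩)
  have h1 := hP'.subst t
  have key : ∀ (x : ∀ a, M.car (σ a)) (b : ∀ i, M.car (τ i)),
      (P' fun z => (t z).value M (join M x fun i : G => b i)) ↔ P (join M x b) := by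
    intro x b
    rw [← hP'P]
    refine iff_of_eq (congrArg P' ?_)
    funext z
    obtain ⟨z | z, hz⟩ := z <;> rfl
  refine h1.exists_finite.congr fun x => ?_
  constructor
  · rintro ⟨b, hb⟩
    -- Variables outside the support do not matter and get arbitrary values, which exist because
    -- sorts are non-empty.
    refine ⟨extendTuple M b, (key x _).mp ?_⟩
    simpa only [extendTuple_mem] using hb
  · rintro ⟨b, hb⟩
    exact ⟨fun i => b i, (key x b).mpr hb⟩

end Support

/-! ### Definability with parameters, and types -/

section Parameters

variable {M : Structure.{u, v} L} {α : Type*} {β : Type*} {σ : α → L.Srt} {τ : β → L.Srt}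
  {A B : Set M.El}

/-- Predicates of tuples that are definable with parameters from `A`. -/
def DefinableOver (A : Set M.El) (σ : α → L.Srt) (P : (∀ a, M.car (σ a)) → Prop) : Prop :=
  ∃ φ : M.FormulaOver A σ, ∀ x, M.RealizeOver φ x ↔ P x

theorem definableOver_realizeOver (φ : M.FormulaOver A σ) :
    DefinableOver A σ fun x => M.RealizeOver φ x :=
  ⟨φ, fun _ => Iff.rfl⟩

/-- Parameters are treated as one more block of variables, so closure properties over A reduce to
the parameter-free ones. -/
theorem definableOver_iff {P : (∀ a, M.car (σ a)) → Prop} :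
    DefinableOver A σ P ↔ ∃ Q, Definable M (Sum.elim σ fun a : A => a.1.1) Q ∧
      ∀ x, Q (join M x fun a : A => a.1.2) ↔ P x := by
  constructor
  · rintro ⟨φ, hφ⟩
    exact ⟨_, definable_realize φ, hφ⟩
  · rintro ⟨Q, ⟨φ, hφ⟩, h⟩
    exact ⟨φ, fun x => (hφ _).trans (h x)⟩

/-- A definable predicate becomes definable over `A` when elements of `A` are plugged in. -/
theorem Definable.definableOver {Q : (∀ a, M.car (Sum.elim σ τ a)) → Prop}
    (hQ : Definable M (Sum.elim σ τ) Q) (w : ∀ b, M.car (τ b))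
    (hw : M.entries w ⊆ A) : DefinableOver A σ fun x => Q (join M x w) := by
  refine definableOver_iff.mpr ⟨_, hQ.subst (τ := Sum.elim σ fun a : A => a.1.1) (fun z => match z with
    | .inl a => .var (σ := Sum.elim σ fun a : A => a.1.1) (.inl a)
    | .inr b => .var (σ := Sum.elim σ fun a : A => a.1.1) (.inr ⟨⟨τ b, w b⟩, hw ⟨b, rfl⟩⟩)),
    fun x => ?_⟩
  refine iff_of_eq (congrArg Q ?_)
  funext z
  rcases z with z | z <;> rfl

theorem Definable.over {P : (∀ a, M.car (σ a)) → Prop} (hP : Definable M σ P) (A : Set M.El) :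
    DefinableOver A σ P :=
  definableOver_iff.mpr ⟨_, hP.subst (τ := Sum.elim σ fun a : A => a.1.1) (fun a =>
    .var (σ := Sum.elim σ fun a : A => a.1.1) (.inl a)), fun _ => Iff.rfl⟩

theorem DefinableOver.congr {P Q : (∀ a, M.car (σ a)) → Prop} (h : DefinableOver A σ P)
    (e : ∀ x, P x ↔ Q x) : DefinableOver A σ Q := by
  obtain ⟨φ, hφ⟩ := h
  exact ⟨φ, fun x => (hφ x).trans (e x)⟩

theorem DefinableOver.mono {P : (∀ a, M.car (σ a)) → Prop} (h : DefinableOver A σ P)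
    (hAB : A ⊆ B) : DefinableOver B σ P := by
  obtain ⟨Q, hQ, hP⟩ := definableOver_iff.mp h
  refine (hQ.definableOver (A := B) (fun a : A => a.1.2) ?_).congr hP
  rintro _ ⟨a, rfl⟩
  exact hAB a.2

theorem DefinableOver.not {P : (∀ a, M.car (σ a)) → Prop} (h : DefinableOver A σ P) :
    DefinableOver A σ fun x => ¬ P x := by
  obtain ⟨Q, hQ, hP⟩ := definableOver_iff.mp h
  exact definableOver_iff.mpr ⟨_, hQ.not, fun x => not_congr (hP x)⟩

theorem DefinableOver.and {P P' : (∀ a, M.car (σ a)) → Prop} (h : DefinableOver A σ P)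
    (h' : DefinableOver A σ P') : DefinableOver A σ fun x => P x ∧ P' x := by
  obtain ⟨Q, hQ, hP⟩ := definableOver_iff.mp h
  obtain ⟨Q', hQ', hP'⟩ := definableOver_iff.mp h'
  exact definableOver_iff.mpr ⟨_, hQ.and hQ', fun x => and_congr (hP x) (hP' x)⟩

theorem definableOver_forall_mem_finite {κ : Type*} {s : Set κ} (hs : s.Finite)
    (P : κ → (∀ a, M.car (σ a)) → Prop) (hP : ∀ k ∈ s, DefinableOver A σ (P k)) :
    DefinableOver A σ fun x => ∀ k ∈ s, P k x := by
  induction s, hs using Set.Finite.induction_on with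
  | empty => exact (definable_true.over A).congr fun _ => by simp
  | insert _ _ ih =>
    refine ((hP _ (Set.mem_insert _ _)).and
      (ih fun k hk => hP k (Set.mem_insert_of_mem _ hk))).congr fun x => ?_
    simp

theorem DefinableOver.subst {P : (∀ a, M.car (σ a)) → Prop} (h : DefinableOver A σ P)
    (t : ∀ a, Term L τ (σ a)) : DefinableOver A τ fun x => P fun a => (t a).value M x := by
  obtain ⟨Q, hQ, hP⟩ := definableOver_iff.mp h
  refine definableOver_iff.mpr ⟨_, hQ.subst (τ := Sum.elim τ fun a : A => a.1.1) (fun z => match z with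
    | .inl a => (t a).subst fun b => .var (σ := Sum.elim τ fun a : A => a.1.1) (.inl b)
    | .inr b => .var (σ := Sum.elim τ fun a : A => a.1.1) (.inr b)), fun x => ?_⟩
  rw [← hP]
  refine iff_of_eq (congrArg Q ?_)
  funext z
  rcases z with z | z
  · exact Term.value_subst (τ := Sum.elim τ fun a : A => a.1.1) M
      (fun b => .var (σ := Sum.elim τ fun a : A => a.1.1) (.inl b)) _ (t z)
  · rfl

theorem DefinableOver.reindex {f : β → α}
    {P : (∀ b, M.car (σ (f b))) → Prop} (h : DefinableOver A (fun b => σ (f b)) P) :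
    DefinableOver A σ fun x => P fun b => x (f b) :=
  h.subst fun b => .var (f b)

theorem DefinableOver.exists_block {P : (∀ a, M.car (Sum.elim σ τ a)) → Prop}
    (hP : DefinableOver A (Sum.elim σ τ) P) :
    DefinableOver A σ fun x => ∃ b : ∀ i, M.car (τ i), P (join M x b) := by
  obtain ⟨Q, hQ, hP⟩ := definableOver_iff.mp hP
  have h1 := hQ.subst (τ := Sum.elim (Sum.elim σ fun a : A => a.1.1) τ) (fun z => match z with
    | .inl (.inl a) => .var (σ := Sum.elim (Sum.elim σ fun a : A => a.1.1) τ) (.inl (.inl a))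
    | .inl (.inr b) => .var (σ := Sum.elim (Sum.elim σ fun a : A => a.1.1) τ) (.inr b)
    | .inr a => .var (σ := Sum.elim (Sum.elim σ fun a : A => a.1.1) τ) (.inl (.inr a)))
  refine definableOver_iff.mpr ⟨_, h1.exists_block, fun x => exists_congr fun b => ?_⟩
  rw [← hP]
  refine iff_of_eq (congrArg Q ?_)
  funext z
  rcases z with (z | z) | z <;> rfl

/-- A predicate that is definable over `A` uses finitely many parameters and variables. -/
theorem DefinableOver.exists_support {P : (∀ a, M.car (σ a)) → Prop} (h : DefinableOver A σ P) :
    ∃ A₀ ⊆ A, A₀.Finite ∧ ∃ F : Set α, F.Finite ∧ ∀ S, F ⊆ S →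
      ∃ P' : (∀ a : S, M.car (σ a)) → Prop, DefinableOver A₀ (fun a : S => σ a) P' ∧
        ∀ x, P' (fun a => x a) ↔ P x := by
  obtain ⟨Q, hQ, hP⟩ := definableOver_iff.mp h
  obtain ⟨F, hF, h⟩ := hQ.exists_support
  let A₀ : Set M.El := Subtype.val '' (Sum.inr ⁻¹' F)
  refine ⟨A₀, by simp [A₀], (hF.preimage Sum.inr_injective.injOn).image _,
    Sum.inl ⁻¹' F, hF.preimage Sum.inl_injective.injOn, fun S hS => ?_⟩
  obtain ⟨Q', hQ', hQ'Q⟩ := h F le_rfl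
  have h1 := hQ'.subst (τ := Sum.elim (fun a : S => σ a) fun a : A₀ => a.1.1) (fun z => match z with
    | ⟨.inl a, ha⟩ =>
      .var (σ := Sum.elim (fun a : S => σ a) fun a : A₀ => a.1.1) (.inl ⟨a, hS ha⟩)
    | ⟨.inr a, ha⟩ =>
      .var (σ := Sum.elim (fun a : S => σ a) fun a : A₀ => a.1.1) (.inr ⟨a, ⟨a, ha, rfl⟩⟩))
  refine ⟨_, definableOver_iff.mpr ⟨_, h1, fun _ => Iff.rfl⟩, fun x => ?_⟩
  rw [← hP, ← hQ'Q]
  refine iff_of_eq (congrArg Q' ?_)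
  funext z
  obtain ⟨z | z, hz⟩ := z <;> rfl

theorem DefinableOver.exists_finite_params {P : (∀ a, M.car (σ a)) → Prop}
    (h : DefinableOver A σ P) : ∃ A₀ ⊆ A, A₀.Finite ∧ DefinableOver A₀ σ P := by
  obtain ⟨A₀, hA, hfin, F, -, h⟩ := h.exists_support
  obtain ⟨P', hP', h'⟩ := h F le_rfl
  exact ⟨A₀, hA, hfin, hP'.reindex.congr h'⟩

theorem sameType_iff {x y : ∀ a, M.car (σ a)} :
    M.SameType A x y ↔ ∀ P, DefinableOver A σ P → (P x ↔ P y) := by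
  constructor
  · rintro h P ⟨φ, hφ⟩
    rw [← hφ, ← hφ]
    exact h φ
  · exact fun h φ => h _ (definableOver_realizeOver φ)

theorem sameType_of_imp {x y : ∀ a, M.car (σ a)}
    (h : ∀ P, DefinableOver A σ P → P x → P y) : M.SameType A x y :=
  sameType_iff.mpr fun P hP => ⟨h P hP, fun hy => by_contra fun hx => h _ hP.not hx hy⟩

theorem sameType_iff_finite {x y : ∀ a, M.car (σ a)} :
    M.SameType A x y ↔ ∀ A₀ ⊆ A, A₀.Finite → M.SameType A₀ x y := by
  constructor
  · exact fun h A₀ hA _ => sameType_iff.mpr fun P hP => sameType_iff.mp h P (hP.mono hA)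
  · intro h
    refine sameType_iff.mpr fun P hP => ?_
    obtain ⟨A₀, hA, hfin, hP⟩ := hP.exists_finite_params
    exact sameType_iff.mp (h A₀ hA hfin) P hP

theorem sameType_mono {x y : ∀ a, M.car (σ a)} (h : M.SameType B x y) (hAB : A ⊆ B) :
    M.SameType A x y :=
  sameType_iff.mpr fun P hP => sameType_iff.mp h P (hP.mono hAB)

theorem definableOver_empty_iff {P : (∀ a, M.car (σ a)) → Prop} :
    DefinableOver ∅ σ P ↔ Definable M σ P := by
  refine ⟨fun hP => ?_, fun hP => hP.over _⟩
  obtain ⟨Q, hQ, hP⟩ := definableOver_iff.mp hP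
  refine (hQ.subst (τ := σ) (fun z => match z with
    | .inl a => .var a
    | .inr a => absurd a.2 (Set.notMem_empty _))).congr fun x => ?_
  rw [← hP]
  refine iff_of_eq (congrArg Q ?_)
  funext z
  rcases z with z | z
  · rfl
  · exact absurd z.2 (Set.notMem_empty _)

theorem sameType_empty_iff {x y : ∀ a, M.car (σ a)} :
    M.SameType ∅ x y ↔ ∀ P, Definable M σ P → (P x ↔ P y) := by
  simp only [sameType_iff, definableOver_empty_iff]

end Parameters

end ManySorted

namespace ManySorted

variable {L : Language.{u}}

/-! ### Automorphisms preserve definable predicates -/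

section Automorphisms

variable {M : Structure.{u, v} L} {α : Type*} {σ : α → L.Srt} {A : Set M.El}

def Automorphism.refl (M : Structure.{u, v} L) : Automorphism M where
  perm _ := Equiv.refl _
  map_fn _ _ := rfl
  map_rel _ _ := Iff.rfl

def Automorphism.symm (g : Automorphism M) : Automorphism M where
  perm s := (g.perm s).symm
  map_fn f x := by
    rw [Equiv.symm_apply_eq, g.map_fn]
    simp
  map_rel r x := by
    rw [← g.map_rel]
    simp

/-- The composition `h ∘ g`. -/
def Automorphism.trans (g h : Automorphism M) : Automorphism M where
  perm s := (g.perm s).trans (h.perm s)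
  map_fn f x := by simp [g.map_fn, h.map_fn]
  map_rel r x := by simp [g.map_rel, h.map_rel]

/-- The action on tuples. -/
def Automorphism.map (g : Automorphism M) (x : ∀ a, M.car (σ a)) (a : α) : M.car (σ a) :=
  g.perm _ (x a)

@[simp] theorem Automorphism.act_trans (g h : Automorphism M) (e : M.El) :
    (g.trans h).act e = h.act (g.act e) := rfl

@[simp] theorem Automorphism.act_symm_act (g : Automorphism M) (e : M.El) :
    g.symm.act (g.act e) = e := by
  obtain ⟨s, a⟩ := e
  exact congrArg (Sigma.mk s) (Equiv.symm_apply_apply _ a)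

@[simp] theorem Automorphism.act_act_symm (g : Automorphism M) (e : M.El) :
    g.act (g.symm.act e) = e := by
  obtain ⟨s, a⟩ := e
  exact congrArg (Sigma.mk s) (Equiv.apply_symm_apply _ a)

@[simp] theorem Automorphism.map_symm_map (g : Automorphism M) (x : ∀ a, M.car (σ a)) :
    g.symm.map (g.map x) = x := by
  funext a
  simp [map, symm]

@[simp] theorem Automorphism.map_map_symm (g : Automorphism M) (x : ∀ a, M.car (σ a)) :
    g.map (g.symm.map x) = x := by
  funext a
  simp [map, symm]

theorem Automorphism.act_injective (g : Automorphism M) : Function.Injective g.act :=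
  Function.LeftInverse.injective g.act_symm_act

theorem Automorphism.image_trans (g h : Automorphism M) (A : Set M.El) :
    (g.trans h).act '' A = h.act '' (g.act '' A) := by
  rw [Set.image_image]
  rfl

@[simp] theorem Automorphism.image_symm_image (g : Automorphism M) (A : Set M.El) :
    g.symm.act '' (g.act '' A) = A := by
  simp [Set.image_image]

@[simp] theorem Automorphism.image_image_symm (g : Automorphism M) (A : Set M.El) :
    g.act '' (g.symm.act '' A) = A := by
  simp [Set.image_image]

theorem Automorphism.image_eq_self {g : Automorphism M} (h : ∀ e ∈ A, g.act e = e) :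
    g.act '' A = A := by
  rw [Set.image_congr h, Set.image_id']

theorem Automorphism.symm_fixes {g : Automorphism M} (h : ∀ e ∈ A, g.act e = e) :
    ∀ e ∈ A, g.symm.act e = e := fun e he => by
  conv_lhs => rw [← h e he]
  simp

theorem Automorphism.entries_map (g : Automorphism M) (x : ∀ a, M.car (σ a)) :
    M.entries (g.map x) = g.act '' M.entries x := by
  unfold Structure.entries
  rw [← Set.range_comp]
  rfl

theorem Automorphism.map_eq_self {g : Automorphism M} {x : ∀ a, M.car (σ a)}
    (h : ∀ e ∈ M.entries x, g.act e = e) : g.map x = x := by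
  funext a
  have := h _ ⟨a, rfl⟩
  change g.perm _ (x a) = x a
  simpa [act] using this

theorem Automorphism.value_map (g : Automorphism M) (x : ∀ a, M.car (σ a)) {s : L.Srt}
    (t : Term L σ s) : t.value M (g.map x) = g.perm s (t.value M x) := by
  induction t with
  | var a => rfl
  | app f r ih => simp only [Term.value, ih, g.map_fn]

theorem Automorphism.holds_map (g : Automorphism M) (x : ∀ a, M.car (σ a)) {l : List L.Srt}
    (φ : BFormula L σ l) (y : (i : Fin l.length) → M.car (l.get i)) :
    φ.Holds M (g.map x) (fun i => g.perm _ (y i)) ↔ φ.Holds M x y := by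
  have key : ∀ {l : List L.Srt} (y : (i : Fin l.length) → M.car (l.get i)),
      join M (g.map x) (fun i => g.perm _ (y i)) = g.map (join M x y) := by
    intro l y
    funext z
    rcases z with z | z <;> rfl
  induction φ with
  | falsum => rfl
  | equal t t' => simp only [BFormula.Holds, key, g.value_map, EmbeddingLike.apply_eq_iff_eq]
  | rel r t => simp only [BFormula.Holds, key, g.value_map, g.map_rel]
  | imp φ φ' ih ih' => simp only [BFormula.Holds, ih, ih']
  | @all l s φ ih =>
    simp only [BFormula.Holds]
    refine (g.perm s).forall_congr_right.symm.trans (forall_congr' fun a => ?_)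
    refine (iff_of_eq (congrArg _ ?_)).trans (ih _)
    funext z
    refine Fin.cases ?_ (fun j => ?_) z <;> rfl

theorem Definable.map_iff {P : (∀ a, M.car (σ a)) → Prop} (hP : Definable M σ P)
    (g : Automorphism M) (x : ∀ a, M.car (σ a)) : P (g.map x) ↔ P x := by
  obtain ⟨φ, hφ⟩ := hP
  rw [← hφ, ← hφ]
  refine (iff_of_eq (congrArg (φ.Holds M (g.map x)) ?_)).trans
    (g.holds_map x φ fun i => i.elim0)
  funext z
  exact z.elim0

theorem DefinableOver.image {P : (∀ a, M.car (σ a)) → Prop} (hP : DefinableOver A σ P)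
    (g : Automorphism M) : DefinableOver (g.act '' A) σ fun x => P (g.symm.map x) := by
  obtain ⟨Q, hQ, hP⟩ := definableOver_iff.mp hP
  refine (hQ.definableOver (g.map fun a : A => a.1.2) ?_).congr fun x => ?_
  · rw [g.entries_map]
    refine Set.image_mono ?_
    rintro _ ⟨a, rfl⟩
    exact a.2
  · rw [← hP]
    refine (iff_of_eq (congrArg Q ?_)).trans (hQ.map_iff g _)
    funext z
    rcases z with z | z
    · exact (congrFun (g.map_map_symm x) z).symm
    · rfl

theorem DefinableOver.map_iff {P : (∀ a, M.car (σ a)) → Prop} (hP : DefinableOver A σ P)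
    {g : Automorphism M} (hg : ∀ e ∈ A, g.act e = e) (x : ∀ a, M.car (σ a)) :
    P (g.map x) ↔ P x := by
  obtain ⟨Q, hQ, hP⟩ := definableOver_iff.mp hP
  rw [← hP, ← hP]
  refine (iff_of_eq (congrArg Q ?_)).trans (hQ.map_iff g _)
  have h : g.map (fun a : A => a.1.2) = fun a : A => a.1.2 := by
    refine Automorphism.map_eq_self ?_
    rintro _ ⟨a, rfl⟩
    exact hg _ a.2
  funext z
  rcases z with z | z
  · rfl
  · exact (congrFun h z).symm

theorem sameType_map {g : Automorphism M} (hg : ∀ e ∈ A, g.act e = e) (x : ∀ a, M.car (σ a)) :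
    M.SameType A x (g.map x) :=
  sameType_iff.mpr fun _ hP => (hP.map_iff hg x).symm

end Automorphisms

/-- Saturated and strongly homogeneous structures. -/
structure IsSaturatedHomogeneous (M : Structure.{u, u + 1} L) : Prop where
  saturated : ∀ (A : Set M.El), Small.{u} A → ∀ (s : L.Srt)
    (p : Set (M.FormulaOver A (fun _ : Unit => s))),
    (∀ p₀ ⊆ p, p₀.Finite → ∃ a : M.car s, ∀ φ ∈ p₀, M.RealizeOver φ (fun _ => a)) →
    ∃ a : M.car s, ∀ φ ∈ p, M.RealizeOver φ (fun _ => a)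
  homogeneous : ∀ {ι : Type u} {σ : ι → L.Srt} (x y : (i : ι) → M.car (σ i)),
    M.SameType ∅ x y → ∃ g : Automorphism M, ∀ i, g.perm (σ i) (x i) = y i

theorem IsBigModel.isSaturatedHomogeneous {T : Set (Sentence L)} {M : Structure.{u, u + 1} L}
    (hM : IsBigModel T M) : IsSaturatedHomogeneous M :=
  ⟨hM.saturated, hM.homogeneous⟩

/-! ### Compactness for small tuples in a saturated structure -/

section Compactness

variable {M : Structure.{u, u + 1} L} {ι : Type*} {σ : ι → L.Srt} {A D : Set M.El}

theorem exists_entries_eq (A : Set M.El) [Small.{u} A] :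
    ∃ (κ : Type u) (σ : κ → L.Srt) (x : ∀ i, M.car (σ i)), M.entries x = A := by
  refine ⟨Shrink.{u} A, fun i => ((equivShrink A).symm i).1.1,
    fun i => ((equivShrink A).symm i).1.2, ?_⟩
  ext e
  constructor
  · rintro ⟨i, rfl⟩
    exact ((equivShrink A).symm i).2
  · intro he
    exact ⟨equivShrink A ⟨e, he⟩, by simp⟩

instance small_entries [Small.{u} ι] (x : ∀ i, M.car (σ i)) : Small.{u} (M.entries x) :=
  small_range _

/-- Appending an enumeration of D to both tuples turns equality of types over D into equality of
types over ∅, to which homogeneity applies. -/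
theorem IsSaturatedHomogeneous.exists_automorphism (hM : IsSaturatedHomogeneous M)
    [Small.{u} ι] (hD : Small.{u} D) {x y : ∀ i, M.car (σ i)} (h : M.SameType D x y) :
    ∃ g : Automorphism M, (∀ e ∈ D, g.act e = e) ∧ g.map x = y := by
  obtain ⟨κ, ρ, d, rfl⟩ := exists_entries_eq D
  let e := equivShrink.{u} ι
  have key : M.SameType ∅ (join M (fun i => x (e.symm i)) d) (join M (fun i => y (e.symm i)) d) := by
    refine sameType_empty_iff.mpr fun P hP => ?_
    exact sameType_iff.mp h _ (DefinableOver.reindex (hP.definableOver d le_rfl))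
  obtain ⟨g, hg⟩ := hM.homogeneous _ _ key
  refine ⟨g, ?_, ?_⟩
  · rintro _ ⟨k, rfl⟩
    exact congrArg (Sigma.mk (ρ k)) (hg (.inr k))
  · funext i
    obtain ⟨j, rfl⟩ := e.symm.surjective i
    exact hg (.inl j)

theorem IsSaturatedHomogeneous.saturated' (hM : IsSaturatedHomogeneous M) (hA : Small.{u} A)
    (s : L.Srt) (p : Set (M.car s → Prop))
    (hp : ∀ P ∈ p, DefinableOver A (fun _ : Unit => s) fun x => P (x ()))
    (hfin : ∀ p₀ ⊆ p, p₀.Finite → ∃ a, ∀ P ∈ p₀, P a) : ∃ a, ∀ P ∈ p, P a := by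
  obtain ⟨a, ha⟩ := hM.saturated A hA s
    {φ | ∃ P ∈ p, ∀ x : Unit → M.car s, M.RealizeOver φ x ↔ P (x ())} (by
      intro p₀ hp₀ hf
      choose! f hf₁ hf₂ using hp₀
      obtain ⟨a, ha⟩ := hfin (f '' p₀) (by rintro _ ⟨φ, hφ, rfl⟩; exact hf₁ hφ) (hf.image f)
      exact ⟨a, fun φ hφ => (hf₂ hφ _).mpr (ha _ ⟨φ, hφ, rfl⟩)⟩)
  refine ⟨a, fun P hP => ?_⟩
  obtain ⟨φ, hφ⟩ := hp P hP
  exact (hφ fun _ => a).mp (ha φ ⟨P, hP, hφ⟩)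

/-- The part of a tuple with indices in `J` satisfies everything over `A` that holds for
`U`-almost all tuples. -/
def RealizesLimit (A : Set M.El) (U : Ultrafilter (∀ i, M.car (σ i))) (J : Set ι)
    (a : ∀ i, M.car (σ i)) : Prop :=
  ∀ P : (∀ j : J, M.car (σ j)) → Prop, DefinableOver A (fun j : J => σ j) P →
    (∀ᶠ x in (U : Filter (∀ i, M.car (σ i))), P fun j => x j) → P fun j => a j

/-- The conditions on the new coordinate, with a plugged in for J, are finitely satisfiable: a
finite conjunction holds almost everywhere, so its existential closure is a limit property of the
J-part and holds of a. Saturation in one variable does the rest. -/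
theorem IsSaturatedHomogeneous.realizesLimit_insert (hM : IsSaturatedHomogeneous M)
    [Small.{u} ι] (hA : Small.{u} A) {U : Ultrafilter (∀ i, M.car (σ i))} {J : Set ι}
    {a : ∀ i, M.car (σ i)} (h : RealizesLimit A U J a) {i₀ : ι} (hi₀ : i₀ ∉ J) :
    ∃ a', RealizesLimit A U (insert i₀ J) a' ∧ ∀ j ∈ J, a' j = a j := by
  classical
  let p : Set (M.car (σ i₀) → Prop) := {R | ∃ Q : (∀ z : J ⊕ Unit,
    M.car (Sum.elim (fun j : J => σ j) (fun _ => σ i₀) z)) → Prop,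
    DefinableOver A (Sum.elim (fun j : J => σ j) fun _ : Unit => σ i₀) Q ∧
    (∀ᶠ x in (U : Filter (∀ i, M.car (σ i))),
      Q (join M (fun j : J => x j) fun _ : Unit => x i₀)) ∧
    ∀ t, R t ↔ Q (join M (fun j : J => a j) fun _ : Unit => t)}
  obtain ⟨t, ht⟩ := hM.saturated' (A := A ∪ M.entries a) (small_union _ _) (σ i₀) p (by
      rintro R ⟨Q, hQ, -, hR⟩
      obtain ⟨Q', hQ', hQ'Q⟩ := definableOver_iff.mp hQ
      have h1 := hQ'.subst (τ := Sum.elim (fun _ : Unit => σ i₀)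
          (Sum.elim (fun j : J => σ j) fun a : A => a.1.1)) (fun z => match z with
        | .inl (.inl j) => .var (σ := Sum.elim (fun _ : Unit => σ i₀)
            (Sum.elim (fun j : J => σ j) fun a : A => a.1.1)) (.inr (.inl j))
        | .inl (.inr _) => .var (σ := Sum.elim (fun _ : Unit => σ i₀)
            (Sum.elim (fun j : J => σ j) fun a : A => a.1.1)) (.inl ())
        | .inr b => .var (σ := Sum.elim (fun _ : Unit => σ i₀)
            (Sum.elim (fun j : J => σ j) fun a : A => a.1.1)) (.inr (.inr b)))
      refine (h1.definableOver (A := A ∪ M.entries a)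
        (join M (fun j : J => a j) fun b : A => b.1.2) ?_).congr fun x => ?_
      · rintro _ ⟨z | z, rfl⟩
        · exact Or.inr ⟨z, rfl⟩
        · exact Or.inl z.2
      · rw [hR, ← hQ'Q]
        refine iff_of_eq (congrArg Q' ?_)
        funext z
        rcases z with (z | z) | z <;> rfl) (by
      intro p₀ hp₀ hfin
      replace hp₀ : ∀ R, R ∈ p₀ → R ∈ p := fun R hR => hp₀ hR
      choose! Q hQ hU hR using hp₀
      have h1 := definableOver_forall_mem_finite hfin Q fun R hR => hQ R hR
      have h2 := h _ h1.exists_block (by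
        have : ∀ᶠ x in (U : Filter (∀ i, M.car (σ i))), ∀ R ∈ p₀,
            Q R (join M (fun j : J => x j) fun _ : Unit => x i₀) :=
          (Filter.eventually_all_finite hfin).mpr fun R hR => hU R hR
        filter_upwards [this] with x hx
        exact ⟨_, hx⟩)
      obtain ⟨b, hb⟩ := h2
      exact ⟨b (), fun R hR' => (hR R hR' _).mpr (hb R hR')⟩)
  refine ⟨Function.update a i₀ t, fun P hP hU => ?_, fun j hj => ?_⟩
  · have hex : ∀ j : ↥(insert i₀ J), ∃ r : Term L (Sum.elim (fun j : J => σ j)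
        fun _ : Unit => σ i₀) (σ j), ∀ (x : ∀ i, M.car (σ i)) (c : M.car (σ i₀)),
        r.value M (join M (fun j : J => x j) fun _ : Unit => c) = Function.update x i₀ c j := by
      rintro ⟨j, hj⟩
      by_cases hji : j = i₀
      · subst hji
        exact ⟨.var (σ := Sum.elim (fun j : J => σ j) fun _ : Unit => σ j) (.inr ()),
          fun x c => (Function.update_self j c x).symm⟩
      · exact ⟨.var (σ := Sum.elim (fun j : J => σ j) fun _ : Unit => σ i₀)
          (.inl ⟨j, hj.resolve_left hji⟩), fun x c => by rw [Function.update_of_ne hji]; rfl⟩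
    choose r hr using hex
    have h3 := ht _ ⟨_, hP.subst r, by
      simp only [hr, Function.update_eq_self]
      exact hU, fun t => Iff.rfl⟩
    simpa only [hr] using h3
  · exact Function.update_of_ne (ne_of_mem_of_not_mem hj hi₀) _ _

/-- Zorn's lemma on partial realisations of the limit type: unions of chains work because a formula
sees finitely many coordinates, and a maximal realisation is total because one more coordinate can
always be added. -/
theorem IsSaturatedHomogeneous.exists_realizesLimit (hM : IsSaturatedHomogeneous M)
    [Small.{u} ι] (hA : Small.{u} A) (U : Ultrafilter (∀ i, M.car (σ i))) :
    ∃ a, ∀ P : (∀ i, M.car (σ i)) → Prop, DefinableOver A σ P →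
      (∀ᶠ x in (U : Filter (∀ i, M.car (σ i))), P x) → P a := by
  classical
  let Z := {q : Set ι × (∀ i, M.car (σ i)) // RealizesLimit A U q.1 q.2}
  let r : Z → Z → Prop := fun q q' => q.1.1 ⊆ q'.1.1 ∧ ∀ j ∈ q.1.1, q.1.2 j = q'.1.2 j
  have hr : ∀ {q q' q''}, r q q' → r q' q'' → r q q'' := fun h h' =>
    ⟨h.1.trans h'.1, fun j hj => (h.2 j hj).trans (h'.2 j (h.1 hj))⟩
  obtain ⟨⟨⟨J, a⟩, hJ⟩, hmax⟩ := exists_maximal_of_chains_bounded (r := r) (by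
    intro c hc
    rcases c.eq_empty_or_nonempty with rfl | hne
    · refine ⟨⟨(∅, fun i => (M.nonempty (σ i)).some), fun P hP hU => ?_⟩, by simp⟩
      obtain ⟨x, hx⟩ := hU.exists
      refine (iff_of_eq (congrArg P ?_)).mp hx
      funext j
      exact absurd j.2 (Set.notMem_empty _)
    have hdir : DirectedOn r c := by
      intro q hq q' hq'
      by_cases hqq : q = q'
      · exact ⟨q, hq, ⟨subset_rfl, fun _ _ => rfl⟩, hqq ▸ ⟨subset_rfl, fun _ _ => rfl⟩⟩
      · rcases hc hq hq' hqq with h | h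
        · exact ⟨q', hq', h, ⟨subset_rfl, fun _ _ => rfl⟩⟩
        · exact ⟨q, hq, ⟨subset_rfl, fun _ _ => rfl⟩, h⟩
    -- Members of the chain agree on common coordinates, so any member that covers i may supply the
    -- value.
    let b : ∀ i, M.car (σ i) := fun i =>
      if h : ∃ q ∈ c, i ∈ q.1.1 then h.choose.1.2 i else (M.nonempty (σ i)).some
    have hb : ∀ q ∈ c, ∀ i ∈ q.1.1, b i = q.1.2 i := by
      intro q hq i hi
      have h : ∃ q ∈ c, i ∈ q.1.1 := ⟨q, hq, hi⟩
      simp only [b, dif_pos h]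
      obtain ⟨q'', -, h1, h2⟩ := hdir _ h.choose_spec.1 q hq
      exact (h1.2 _ h.choose_spec.2).trans (h2.2 _ hi).symm
    refine ⟨⟨(⋃ q ∈ c, q.1.1, b), fun P hP hU => ?_⟩, fun q hq =>
      ⟨Set.subset_biUnion_of_mem (u := fun q : Z => q.1.1) hq, fun j hj => (hb q hq j hj).symm⟩⟩
    -- Only finitely many coordinates occur in P, so a single member of the chain covers all of
    -- them.
    obtain ⟨A₀, hA₀, -, F, hF, h⟩ := hP.exists_support
    obtain ⟨P', hP', hP'P⟩ := h F le_rfl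
    obtain ⟨q, hq, hqF⟩ := DirectedOn.exists_mem_subset_of_finset_subset_biUnion hne
      (f := fun q : Z => q.1.1) (hdir.mono fun _ _ h => h.1) (s := (hF.image Subtype.val).toFinset) (by
        rintro _ hj
        obtain ⟨j, -, rfl⟩ := (Set.Finite.mem_toFinset _).mp hj
        exact j.2)
    have hFq : ∀ j : F, j.1.1 ∈ q.1.1 := fun j =>
      hqF (Finset.mem_coe.mpr ((Set.Finite.mem_toFinset _).mpr ⟨j.1, j.2, rfl⟩))
    have h1 := q.2 (fun x => P' fun j => x ⟨j.1.1, hFq j⟩)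
      ((hP'.mono hA₀).reindex (σ := fun j : q.1.1 => σ j)
        (f := fun j : F => (⟨j.1.1, hFq j⟩ : q.1.1))) (by
        filter_upwards [hU] with x hx
        exact (hP'P _).mpr hx)
    refine (hP'P _).mp ((iff_of_eq (congrArg P' ?_)).mp h1)
    funext j
    exact (hb q hq _ (hFq j)).symm) hr
  have hJu : J = Set.univ := by
    by_contra hne
    obtain ⟨i, hi⟩ := (Set.ne_univ_iff_exists_notMem J).mp hne
    obtain ⟨a', ha', haa'⟩ := hM.realizesLimit_insert hA hJ hi
    exact hi ((hmax ⟨(insert i J, a'), ha'⟩ ⟨Set.subset_insert _ _, fun j hj =>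
      (haa' j hj).symm⟩).1 (Set.mem_insert i J))
  subst hJu
  refine ⟨a, fun P hP hU => ?_⟩
  obtain ⟨A₀, hA₀, -, F, -, h⟩ := hP.exists_support
  obtain ⟨P', hP', hP'P⟩ := h Set.univ (Set.subset_univ _)
  refine (hP'P _).mp (hJ P' (hP'.mono hA₀) ?_)
  filter_upwards [hU] with x hx
  exact (hP'P _).mpr hx

/-- Intersections of predicates that are definable over `A`. -/
def TypeDefinableOver (A : Set M.El) (σ : ι → L.Srt) (R : (∀ i, M.car (σ i)) → Prop) : Prop :=
  ∃ p : Set ((∀ i, M.car (σ i)) → Prop), (∀ P ∈ p, DefinableOver A σ P) ∧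
    ∀ x, R x ↔ ∀ P ∈ p, P x

theorem DefinableOver.typeDefinableOver {P : (∀ i, M.car (σ i)) → Prop}
    (h : DefinableOver A σ P) : TypeDefinableOver A σ P :=
  ⟨{P}, by simpa using h, by simp⟩

theorem typeDefinableOver_sameType (x : ∀ i, M.car (σ i)) :
    TypeDefinableOver A σ fun y => M.SameType A x y := by
  refine ⟨{P | DefinableOver A σ P ∧ P x}, fun P hP => hP.1, fun y => ?_⟩
  exact ⟨fun h P hP => (sameType_iff.mp h P hP.1).mp hP.2,
    fun h => sameType_of_imp fun P hP hx => h P ⟨hP, hx⟩⟩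

theorem TypeDefinableOver.mono {R : (∀ i, M.car (σ i)) → Prop} (h : TypeDefinableOver A σ R)
    (hAD : A ⊆ D) : TypeDefinableOver D σ R := by
  obtain ⟨p, hp, hR⟩ := h
  exact ⟨p, fun P hP => (hp P hP).mono hAD, hR⟩

/-- The solution sets generate a proper filter; a tuple realising the limit type of an ultrafilter
above it satisfies every condition. -/
theorem IsSaturatedHomogeneous.compactness (hM : IsSaturatedHomogeneous M) [Small.{u} ι]
    (hA : Small.{u} A) {Θ : Type*} (R : Θ → (∀ i, M.car (σ i)) → Prop)
    (hR : ∀ θ, TypeDefinableOver A σ (R θ))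
    (hfin : ∀ s : Set Θ, s.Finite → ∃ x, ∀ θ ∈ s, R θ x) : ∃ x, ∀ θ, R θ x := by
  choose p hp hRp using hR
  have hne : (Filter.generate (Set.range fun θ => {x | R θ x})).NeBot := by
    rw [Filter.generate_neBot_iff]
    intro t ht htf
    have := htf.to_subtype
    choose f hf using ht
    obtain ⟨x, hx⟩ := hfin _ (Set.finite_range fun S : t => f S.2)
    refine ⟨x, fun S hS => ?_⟩
    rw [← hf hS]
    exact hx _ ⟨⟨S, hS⟩, rfl⟩
  obtain ⟨a, ha⟩ := hM.exists_realizesLimit hA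
    (Ultrafilter.of (Filter.generate (Set.range fun θ => {x | R θ x})))
  refine ⟨a, fun θ => (hRp θ a).mpr fun P hP => ha P (hp θ P hP) ?_⟩
  refine Ultrafilter.of_le _ (Filter.mem_of_superset
    (Filter.mem_generate_of_mem (Set.mem_range_self θ)) fun x hx => (hRp θ x).mp hx P hP)

end Compactness

end ManySorted

namespace ManySorted

variable {L : Language.{u}}

/-! ### Bounding the number of solutions by a formula -/

section FewSolutions

variable {M : Structure.{u, v} L} {β : Type*} {τ : β → L.Srt}

/-- The set `S` has fewer than `k` elements. -/
def FewerThan {X : Type*} (k : ℕ) (S : Set X) : Prop :=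
  ∀ z : Fin k → X, (∀ i, z i ∈ S) → ∃ i j, i < j ∧ z i = z j

theorem FewerThan.finite {X : Type*} {k : ℕ} {S : Set X} (h : FewerThan k S) : S.Finite := by
  by_contra hS
  have := Set.infinite_coe_iff.mpr hS
  obtain ⟨i, j, hij, he⟩ := h (fun i => (Infinite.natEmbedding S i : S)) fun i => Subtype.coe_prop _
  have := (Infinite.natEmbedding S).injective (Subtype.coe_injective he)
  exact hij.ne (Fin.ext this)

theorem _root_.Set.Finite.exists_fewerThan {X : Type*} {S : Set X} (h : S.Finite) :
    ∃ k, 2 ≤ k ∧ FewerThan k S := by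
  have := h.to_subtype
  obtain ⟨n, ⟨e⟩⟩ := Finite.exists_equiv_fin S
  refine ⟨n + 2, by omega, fun z hz => ?_⟩
  obtain ⟨i, j, hij, he⟩ := Fintype.exists_ne_map_eq_of_card_lt
    (fun i => e ⟨z i, hz i⟩) (by simp)
  have he : z i = z j := congrArg Subtype.val (e.injective he)
  rcases hij.lt_or_gt with h | h
  · exact ⟨i, j, h, he⟩
  · exact ⟨j, i, h, he.symm⟩

theorem Definable.fewerThan {s : L.Srt}
    {P : (∀ b, M.car (Sum.elim (fun _ : Unit => s) τ b)) → Prop}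
    (hP : Definable M (Sum.elim (fun _ : Unit => s) τ) P) (k : ℕ) :
    Definable M τ fun y => FewerThan k {t | P (join M (fun _ : Unit => t) y)} := by
  have h1 : ∀ i : Fin k, Definable M (Sum.elim τ fun _ : Fin k => s) fun y =>
      P (join M (fun _ : Unit => y (.inr i)) fun b => y (.inl b)) := fun i => by
    refine (hP.subst (τ := Sum.elim τ fun _ : Fin k => s) (fun z => match z with
      | .inl _ => .var (σ := Sum.elim τ fun _ : Fin k => s) (.inr i)
      | .inr b => .var (σ := Sum.elim τ fun _ : Fin k => s) (.inl b))).congr fun y => ?_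
    refine iff_of_eq (congrArg P ?_)
    funext z
    rcases z with z | z <;> rfl
  have h2 : ∀ p : {p : Fin k × Fin k // p.1 < p.2}, Definable M (Sum.elim τ fun _ : Fin k => s)
      fun y => y (.inr p.1.1) = y (.inr p.1.2) := fun p =>
    definable_equal (s := s) (.var (σ := Sum.elim τ fun _ : Fin k => s) (.inr p.1.1))
      (.var (σ := Sum.elim τ fun _ : Fin k => s) (.inr p.1.2))
  refine ((definable_forall_finite _ h1).imp
    (definable_exists_finite _ h2)).not.exists_block.not.congr fun y => ?_
  simp only [not_exists, not_not]
  refine forall_congr' fun z => imp_congr Iff.rfl ?_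
  constructor
  · rintro ⟨⟨p, hp⟩, h⟩
    exact ⟨p.1, p.2, hp, h⟩
  · rintro ⟨i, j, hij, h⟩
    exact ⟨⟨(i, j), hij⟩, h⟩

theorem DefinableOver.fewerThan {A : Set M.El} {s : L.Srt}
    {P : (∀ b, M.car (Sum.elim (fun _ : Unit => s) τ b)) → Prop}
    (hP : DefinableOver A (Sum.elim (fun _ : Unit => s) τ) P) (k : ℕ) :
    DefinableOver A τ fun y => FewerThan k {t | P (join M (fun _ : Unit => t) y)} := by
  obtain ⟨Q, hQ, hP⟩ := definableOver_iff.mp hP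
  have h1 := hQ.subst (τ := Sum.elim (fun _ : Unit => s) (Sum.elim τ fun a : A => a.1.1))
    (fun z => match z with
    | .inl (.inl _) =>
      .var (σ := Sum.elim (fun _ : Unit => s) (Sum.elim τ fun a : A => a.1.1)) (.inl ())
    | .inl (.inr b) =>
      .var (σ := Sum.elim (fun _ : Unit => s) (Sum.elim τ fun a : A => a.1.1)) (.inr (.inl b))
    | .inr a =>
      .var (σ := Sum.elim (fun _ : Unit => s) (Sum.elim τ fun a : A => a.1.1)) (.inr (.inr a)))
  refine definableOver_iff.mpr ⟨_, h1.fewerThan k, fun y => ?_⟩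
  refine iff_of_eq (congrArg _ (Set.ext fun t => ?_))
  refine Iff.trans ?_ (hP _)
  refine iff_of_eq (congrArg Q ?_)
  funext z
  rcases z with (z | z) | z <;> rfl

end FewSolutions

/-! ### Algebraic closure in terms of definable predicates -/

section AlgebraicClosure

variable {M : Structure.{u, v} L} {β : Type*} {τ : β → L.Srt} {A B D : Set M.El} {e : M.El}

theorem mem_acl_iff : e ∈ M.acl A ↔ ∃ P : M.car e.1 → Prop,
    DefinableOver A (fun _ : Unit => e.1) (fun x => P (x ())) ∧ P e.2 ∧ {a | P a}.Finite := by
  constructor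
  · rintro ⟨φ, hφ, hfin⟩
    exact ⟨fun a => M.RealizeOver φ fun _ => a, definableOver_realizeOver φ, hφ, hfin⟩
  · rintro ⟨P, ⟨φ, hφ⟩, he, hfin⟩
    refine ⟨φ, (hφ _).mpr he, ?_⟩
    convert hfin using 1
    ext a
    exact hφ _

theorem acl_mono (h : A ⊆ B) : M.acl A ⊆ M.acl B := by
  intro e he
  obtain ⟨P, hP, h1, h2⟩ := mem_acl_iff.mp he
  exact mem_acl_iff.mpr ⟨P, hP.mono h, h1, h2⟩

theorem subset_acl : A ⊆ M.acl A := by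
  intro e he
  refine mem_acl_iff.mpr ⟨fun a => a = e.2, ?_, rfl, by simp⟩
  refine (Definable.definableOver (τ := fun _ : Unit => e.1) (definable_equal (s := e.1)
    (.var (σ := Sum.elim (fun _ : Unit => e.1) fun _ : Unit => e.1) (.inl ()))
    (.var (σ := Sum.elim (fun _ : Unit => e.1) fun _ : Unit => e.1) (.inr ())))
    (fun _ => e.2) ?_).congr fun x => Iff.rfl
  rintro _ ⟨_, rfl⟩
  exact he

theorem exists_finite_mem_acl (he : e ∈ M.acl A) : ∃ A₀ ⊆ A, A₀.Finite ∧ e ∈ M.acl A₀ := by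
  obtain ⟨P, hP, h1, h2⟩ := mem_acl_iff.mp he
  obtain ⟨A₀, hA, hfin, hP⟩ := hP.exists_finite_params
  exact ⟨A₀, hA, hfin, mem_acl_iff.mpr ⟨P, hP, h1, h2⟩⟩

theorem Automorphism.act_mem_acl (g : Automorphism M) (he : e ∈ M.acl A) :
    g.act e ∈ M.acl (g.act '' A) := by
  obtain ⟨P, hP, h1, h2⟩ := mem_acl_iff.mp he
  refine mem_acl_iff.mpr ⟨fun a => P ((g.perm e.1).symm a), hP.image g, ?_, ?_⟩
  · simpa [act] using h1
  · exact h2.preimage (Equiv.injective _).injOn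

theorem Automorphism.act_mem_acl_iff (g : Automorphism M) :
    g.act e ∈ M.acl (g.act '' A) ↔ e ∈ M.acl A := by
  refine ⟨fun h => ?_, g.act_mem_acl⟩
  simpa using g.symm.act_mem_acl h

theorem Automorphism.image_acl (g : Automorphism M) : g.act '' M.acl A = M.acl (g.act '' A) := by
  ext e
  constructor
  · rintro ⟨e, he, rfl⟩
    exact g.act_mem_acl he
  · intro he
    refine ⟨g.symm.act e, ?_, by simp⟩
    simpa using g.symm.act_mem_acl he

/-- Membership in the algebraic closure of a set and a tuple. -/
theorem mem_acl_union_entries {w : ∀ b, M.car (τ b)} :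
    e ∈ M.acl (D ∪ M.entries w) ↔
      ∃ Q, DefinableOver D (Sum.elim (fun _ : Unit => e.1) τ) Q ∧
        Q (join M (fun _ => e.2) w) ∧ {t | Q (join M (fun _ => t) w)}.Finite := by
  constructor
  · intro he
    obtain ⟨P, hP, h1, h2⟩ := mem_acl_iff.mp he
    obtain ⟨Q, hQ, hQP⟩ := definableOver_iff.mp hP
    have hex : ∀ a : ↥(D ∪ M.entries w), ∃ r : Term L (Sum.elim (Sum.elim (fun _ : Unit => e.1) τ)
        fun a : D => a.1.1) a.1.1, ∀ t : M.car e.1, r.value M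
          (join M (join M (fun _ : Unit => t) w) fun a : D => a.1.2) = a.1.2 := by
      rintro ⟨_, h | ⟨b, rfl⟩⟩
      · exact ⟨.var (σ := Sum.elim (Sum.elim (fun _ : Unit => e.1) τ) fun a : D => a.1.1)
          (.inr ⟨_, h⟩), fun _ => rfl⟩
      · exact ⟨.var (σ := Sum.elim (Sum.elim (fun _ : Unit => e.1) τ) fun a : D => a.1.1)
          (.inl (.inr b)), fun _ => rfl⟩
    choose r hr using hex
    let r' : ∀ z : Unit ⊕ ↥(D ∪ M.entries w), Term L (Sum.elim (Sum.elim (fun _ : Unit => e.1) τ)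
        fun a : D => a.1.1) (Sum.elim (fun _ : Unit => e.1) (fun a => a.1.1) z) := fun z =>
      match z with
      | .inl _ => .var (σ := Sum.elim (Sum.elim (fun _ : Unit => e.1) τ) fun a : D => a.1.1)
        (.inl (.inl ()))
      | .inr a => r a
    have h3 := hQ.subst r'
    have h4 : ∀ t, (Q fun z => (r' z).value M
        (join M (join M (fun _ : Unit => t) w) fun a : D => a.1.2)) ↔ P t := fun t => by
      refine Iff.trans (iff_of_eq (congrArg Q ?_)) (hQP fun _ => t)
      funext z
      rcases z with z | z
      · rfl
      · exact hr z t
    refine ⟨_, definableOver_iff.mpr ⟨_, h3, fun _ => Iff.rfl⟩, (h4 _).mpr h1, ?_⟩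
    convert h2 using 1
    ext t
    exact h4 t
  · rintro ⟨Q, hQ, h1, h2⟩
    obtain ⟨Q', hQ', hQ'Q⟩ := definableOver_iff.mp hQ
    refine mem_acl_iff.mpr ⟨_, ?_, h1, h2⟩
    have h3 := hQ'.subst (τ := Sum.elim (fun _ : Unit => e.1) (Sum.elim τ fun a : D => a.1.1))
      (fun z => match z with
      | .inl (.inl _) =>
        .var (σ := Sum.elim (fun _ : Unit => e.1) (Sum.elim τ fun a : D => a.1.1)) (.inl ())
      | .inl (.inr b) =>
        .var (σ := Sum.elim (fun _ : Unit => e.1) (Sum.elim τ fun a : D => a.1.1)) (.inr (.inl b))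
      | .inr a =>
        .var (σ := Sum.elim (fun _ : Unit => e.1) (Sum.elim τ fun a : D => a.1.1)) (.inr (.inr a)))
    refine (h3.definableOver (A := D ∪ M.entries w) (join M w fun a : D => a.1.2) ?_).congr
      fun x => ?_
    · rintro _ ⟨z | z, rfl⟩
      · exact Or.inr ⟨z, rfl⟩
      · exact Or.inl z.2
    · rw [← hQ'Q]
      refine iff_of_eq (congrArg Q' ?_)
      funext z
      rcases z with (z | z) | z <;> rfl

/-- If a coordinate of a tuple is algebraic over `D` and other coordinates, then the same holds for
all tuples that satisfy some predicate over `D`. -/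
theorem exists_definableOver_of_mem_acl {κ : Type*} {ρ : κ → L.Srt} {f : β → κ}
    (z : ∀ k, M.car (ρ k)) (k : κ)
    (h : (⟨ρ k, z k⟩ : M.El) ∈ M.acl (D ∪ M.entries fun b => z (f b))) :
    ∃ P, DefinableOver D ρ P ∧ P z ∧
      ∀ z', P z' → (⟨ρ k, z' k⟩ : M.El) ∈ M.acl (D ∪ M.entries fun b => z' (f b)) := by
  obtain ⟨Q, hQ, h1, h2⟩ := mem_acl_union_entries.mp h
  obtain ⟨n, -, hn⟩ := h2.exists_fewerThan
  have h3 := (hQ.fewerThan n).reindex (σ := ρ)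
  have h4 := hQ.subst (τ := ρ) (fun z => match z with
    | .inl _ => .var k
    | .inr b => .var (f b))
  refine ⟨_, h4.and h3, ⟨?_, hn⟩, fun z' hz' =>
    mem_acl_union_entries.mpr ⟨Q, hQ, ?_, hz'.2.finite⟩⟩
  · refine (iff_of_eq (congrArg Q ?_)).mp h1
    funext z
    rcases z with z | z <;> rfl
  · refine (iff_of_eq (congrArg Q ?_)).mp hz'.1
    funext z
    rcases z with z | z <;> rfl

end AlgebraicClosure

/-! ### Algebraic closure in the big model -/

section Big

variable {M : Structure.{u, u + 1} L} {A B D E : Set M.El} {e : M.El}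

/-- An algebraic coordinate has a witness over D that forces the coordinate to be algebraic for
every tuple satisfying it; the negations of all such witnesses define non-algebraicity. -/
theorem typeDefinableOver_notMem_acl {β κ : Type*} {ρ : κ → L.Srt} (f : β → κ) (k : κ) :
    TypeDefinableOver D ρ fun z : ∀ k, M.car (ρ k) =>
      (⟨ρ k, z k⟩ : M.El) ∉ M.acl (D ∪ M.entries fun b => z (f b)) := by
  refine ⟨{P | DefinableOver D ρ P ∧ ∀ z, ¬ P z →
    (⟨ρ k, z k⟩ : M.El) ∈ M.acl (D ∪ M.entries fun b => z (f b))}, fun P hP => hP.1,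
    fun z => ⟨fun hz P hP => by_contra fun h => hz (hP.2 z h), fun h hz => ?_⟩⟩
  obtain ⟨P, hP, hPz, h1⟩ := exists_definableOver_of_mem_acl z k hz
  exact h (fun z => ¬ P z) ⟨hP.not, fun z hz => h1 z (not_not.mp hz)⟩ hPz

/-- The closure is a union of finite solution sets indexed by formulas in variables that enumerate
A, and these formulas form a small type. -/
instance small_acl [hA : Small.{u} A] : Small.{u} (M.acl A) := by
  obtain ⟨ι, σ, x, rfl⟩ := exists_entries_eq A
  let S : (s : L.Srt) × {φ : Formula L (Sum.elim (fun _ : Unit => s) σ) //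
      {t | φ.Realize M (join M (fun _ => t) x)}.Finite} → Set M.El := fun p =>
    Sigma.mk p.1 '' {t | p.2.1.Realize M (join M (fun _ => t) x)}
  have hS : ∀ p, Small.{u} (S p) := fun p => by
    have := (p.2.2.image (Sigma.mk p.1)).to_subtype
    infer_instance
  refine small_subset (s := ⋃ p, S p) fun e he => ?_
  rw [← Set.empty_union (M.entries x), mem_acl_union_entries] at he
  obtain ⟨Q, hQ, h1, h2⟩ := he
  obtain ⟨φ, hφ⟩ := definableOver_empty_iff.mp hQ
  simp only [← hφ] at h1 h2
  exact Set.mem_iUnion.mpr ⟨⟨e.1, φ, h2⟩, e.2, h1, rfl⟩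

/-- A non-algebraic element can be moved out of the algebraic closure of any small set. -/
theorem IsSaturatedHomogeneous.exists_act_notMem_acl (hM : IsSaturatedHomogeneous M)
    (hD : Small.{u} D) (hE : Small.{u} E)
    (he : e ∉ M.acl D) : ∃ g : Automorphism M, (∀ d ∈ D, g.act d = d) ∧ g.act e ∉ M.acl E := by
  obtain ⟨t, ht⟩ := hM.saturated' (A := D ∪ E) (small_union _ _) e.1
    {P | (DefinableOver D (fun _ : Unit => e.1) (fun x => P (x ())) ∧ P e.2) ∨
      (DefinableOver E (fun _ : Unit => e.1) (fun x => P (x ())) ∧ {t | ¬ P t}.Finite)} (by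
    rintro P (hP | hP)
    · exact hP.1.mono Set.subset_union_left
    · exact hP.1.mono Set.subset_union_right) (by
    intro p₀ hp₀ hfin
    by_contra! hcon
    -- If p₀ had no realisation, every solution of its members over D that hold of e would lie in
    -- one of finitely many finite sets, and e would be algebraic over D.
    let p₁ := {P ∈ p₀ | DefinableOver D (fun _ : Unit => e.1) (fun x => P (x ())) ∧ P e.2}
    have hp₁ : p₁.Finite := hfin.subset (Set.sep_subset _ _)
    refine he (mem_acl_iff.mpr ⟨fun t => ∀ P ∈ p₁, P t,
      definableOver_forall_mem_finite (σ := fun _ : Unit => e.1) hp₁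
        (fun (P : M.car e.1 → Prop) x => P (x ())) fun P hP => hP.2.1,
      fun P hP => hP.2.2, ?_⟩)
    refine ((hfin.subset (Set.sep_subset p₀ fun P => {t | ¬ P t}.Finite)).biUnion
      (t := fun P => {t | ¬ P t}) fun P hP => hP.2).subset fun t ht => ?_
    obtain ⟨P, hP, hPt⟩ := hcon t
    refine Set.mem_biUnion (x := P) ⟨hP, ?_⟩ hPt
    rcases hp₀ hP with h | h
    · exact absurd (ht P ⟨hP, h⟩) hPt
    · exact h.2)
  have h1 : M.SameType D (fun _ : Unit => e.2) (fun _ => t) :=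
    sameType_of_imp fun P hP he => ht (fun t => P fun _ => t) (Or.inl ⟨hP, he⟩)
  obtain ⟨g, hg, hgt⟩ := hM.exists_automorphism hD h1
  refine ⟨g, hg, fun hmem => ?_⟩
  have h2 : g.act e = ⟨e.1, t⟩ := congrArg (Sigma.mk e.1) (congrFun hgt ())
  rw [h2] at hmem
  obtain ⟨P, hP, hPt, hfin⟩ := mem_acl_iff.mp hmem
  exact ht (fun t => ¬ P t) (Or.inr ⟨hP.not, by simpa using hfin⟩) hPt

/-- An automorphism fixing A pointwise preserves acl(acl A) as a set, but could move an element
outside acl A out of it. -/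
theorem IsSaturatedHomogeneous.acl_acl (hM : IsSaturatedHomogeneous M) (hA : Small.{u} A) :
    M.acl (M.acl A) = M.acl A := by
  refine Set.Subset.antisymm (fun e he => by_contra fun hn => ?_) subset_acl
  obtain ⟨g, hg, hge⟩ := hM.exists_act_notMem_acl hA (E := M.acl (M.acl A)) inferInstance hn
  refine hge (subset_acl ?_)
  have := g.act_mem_acl (M := M) he
  rwa [g.image_acl, Automorphism.image_eq_self hg] at this

end Big

end ManySorted

namespace ManySorted

variable {L : Language.{u}} {M : Structure.{u, u + 1} L} {A B C D E A' B' C' : Set M.El} {e : M.El}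

/-! ### Axioms that M-independence always satisfies -/

section MDividing

theorem IsSaturatedHomogeneous.acl_subset_iff (hM : IsSaturatedHomogeneous M) (hB : Small.{u} B) :
    M.acl A ⊆ M.acl B ↔ A ⊆ M.acl B := by
  refine ⟨subset_acl.trans, fun h => ?_⟩
  rw [← hM.acl_acl hB]
  exact acl_mono h

theorem IsSaturatedHomogeneous.acl_union_eq (hM : IsSaturatedHomogeneous M) (hB : Small.{u} B)
    (hC : Small.{u} C) (h₁ : C ⊆ C') (h₂ : C' ⊆ M.acl (B ∪ C)) :
    M.acl (B ∪ C') = M.acl (B ∪ C) := by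
  refine Set.Subset.antisymm ((hM.acl_subset_iff (small_union _ _)).mpr
    (Set.union_subset ?_ h₂)) (acl_mono (Set.union_subset_union_right _ h₁))
  exact Set.subset_union_left.trans subset_acl

theorem mInd_iff : MInd M A C B ↔ ∀ C', C ⊆ C' → C' ⊆ M.acl (B ∪ C) →
    ∀ e ∈ M.acl (A ∪ C'), e ∈ M.acl (B ∪ C') → e ∈ M.acl C' := by
  refine forall₃_congr fun C' h1 h2 => ⟨fun h e he he' => h ▸ ⟨he, he'⟩, fun h => ?_⟩
  exact Set.Subset.antisymm (fun e he => h e he.1 he.2)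
    (Set.subset_inter (acl_mono Set.subset_union_right) (acl_mono Set.subset_union_right))

theorem MInd.mono (h : MInd M A C B) (hA : A' ⊆ A) (hB : B' ⊆ B) : MInd M A' C B' :=
  mInd_iff.mpr fun C' h1 h2 e he he' => mInd_iff.mp h C' h1
    (h2.trans (acl_mono (Set.union_subset_union_left _ hB))) e
    (acl_mono (Set.union_subset_union_left _ hA) he)
    (acl_mono (Set.union_subset_union_left _ hB) he')

theorem MInd.image (h : MInd M A C B) (g : Automorphism M) :
    MInd M (g.act '' A) (g.act '' C) (g.act '' B) := by
  intro C' h1 h2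
  have h3 := h (g.symm.act '' C') (by simpa using Set.image_mono (f := g.symm.act) h1) (by
    have := Set.image_mono (f := g.symm.act) h2
    simpa [Automorphism.image_acl, Set.image_union] using this)
  have h4 := congrArg (g.act '' ·) h3
  simpa [Automorphism.image_acl, Set.image_union, Set.image_inter g.act_injective] using h4

theorem MInd.base_mono (h : MInd M A D B) (h₁ : D ⊆ C) (h₂ : C ⊆ B) : MInd M A C B := by
  intro C' h3 h4
  refine h C' (h₁.trans h3) ?_
  rw [Set.union_eq_self_of_subset_right h₂] at h4
  exact h4.trans (acl_mono Set.subset_union_left)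

theorem MInd.normality (h : MInd M A C B) : MInd M (A ∪ C) C B := by
  intro C' h1 h2
  rw [Set.union_assoc, Set.union_eq_self_of_subset_left h1]
  exact h C' h1 h2

/-- A common element of the two closures over D' is pushed first into acl(C ∪ D'), by independence
over C, and then into acl(D'). -/
theorem MInd.trans (h₁ : D ⊆ C) (h₂ : MInd M B C A) (h₃ : MInd M C D A) : MInd M B D A := by
  rw [mInd_iff] at *
  intro D' h5 h6 e he he'
  have hsub : D' ⊆ M.acl (A ∪ C) := h6.trans (acl_mono (Set.union_subset_union_right _ h₁))
  refine h₃ D' h5 h6 e ?_ he'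
  refine h₂ (C ∪ D') Set.subset_union_left (Set.union_subset
    (Set.subset_union_right.trans subset_acl) hsub) e (acl_mono ?_ he) (acl_mono ?_ he')
  · exact Set.union_subset_union_right _ Set.subset_union_right
  · exact Set.union_subset_union_right _ Set.subset_union_right

end MDividing

/-! ### Axioms that thorn-independence always satisfies -/

section Thorn

theorem ThornInd.mInd (hB : Small.{u} B) (h : ThornInd M A C B) : MInd M A C B := by
  obtain ⟨A', ⟨g, hg, rfl⟩, h1⟩ := h B hB subset_rfl
  have h2 := h1.image g.symm
  have h3 := Automorphism.symm_fixes hg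
  rwa [Automorphism.image_symm_image,
    Automorphism.image_eq_self fun e he => h3 e (Or.inr he),
    Automorphism.image_eq_self fun e he => h3 e (Or.inl he)] at h2

theorem ThornInd.image (h : ThornInd M A C B) (g : Automorphism M) :
    ThornInd M (g.act '' A) (g.act '' C) (g.act '' B) := by
  intro B' hB' hBB'
  obtain ⟨A', ⟨k, hk, rfl⟩, h1⟩ := h (g.symm.act '' B') inferInstance
    (by simpa using Set.image_mono (f := g.symm.act) hBB')
  refine ⟨_, ⟨(g.symm.trans k).trans g, ?_, rfl⟩, ?_⟩
  · rintro _ (⟨e, he, rfl⟩ | ⟨e, he, rfl⟩)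
    · simp [hk e (Or.inl he)]
    · simp [hk e (Or.inr he)]
  · have := h1.image g
    simpa [Automorphism.image_trans] using this

theorem ThornInd.mono (hB : Small.{u} B) (h : ThornInd M A C B) (hA : A' ⊆ A) (hBB : B' ⊆ B) :
    ThornInd M A' C B' := by
  intro E hE hE'
  obtain ⟨_, ⟨g, hg, rfl⟩, h1⟩ := h (E ∪ B) (small_union _ _) Set.subset_union_right
  exact ⟨_, ⟨g, fun e he => hg e (Set.union_subset_union_left _ hBB he), rfl⟩,
    h1.mono (Set.image_mono hA) Set.subset_union_left⟩

theorem ThornInd.base_mono (h : ThornInd M A D B) (h₁ : D ⊆ C) (h₂ : C ⊆ B) :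
    ThornInd M A C B := by
  intro E hE hBE
  obtain ⟨A', ⟨g, hg, rfl⟩, h1⟩ := h E hE hBE
  exact ⟨_, ⟨g, fun e he => hg e (Or.inl (he.elim id fun he => h₂ he)), rfl⟩,
    h1.base_mono h₁ (h₂.trans hBE)⟩

theorem ThornInd.normality (h : ThornInd M A C B) : ThornInd M (A ∪ C) C B := by
  intro E hE hBE
  obtain ⟨A', ⟨g, hg, rfl⟩, h1⟩ := h E hE hBE
  refine ⟨_, ⟨g, hg, rfl⟩, ?_⟩
  rw [Set.image_union, Automorphism.image_eq_self fun e he => hg e (Or.inr he)]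
  exact h1.normality

/-- If every conjugate of x over B ∪ C failed, each would have a small superset of B' as a
counterexample. One counterexample per type over B' ∪ C suffices, there are only a small number of
types, and thorn-independence can be applied to the union of the chosen sets. -/
theorem ThornInd.extend {σ : Type*} {s : σ → L.Srt} [Small.{u} σ] (hM : IsSaturatedHomogeneous M)
    (hC : Small.{u} C) (hB' : Small.{u} B') {x : ∀ i, M.car (s i)}
    (h : ThornInd M (M.entries x) C B) (hBB : B ⊆ B') :
    ∃ g : Automorphism M, (∀ e ∈ B ∪ C, g.act e = e) ∧ ThornInd M (M.entries (g.map x)) C B' := by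
  by_contra! hcon
  let S := {g : Automorphism M // ∀ e ∈ B ∪ C, g.act e = e}
  obtain ⟨ι, ρ, d, hd⟩ := exists_entries_eq (B' ∪ C)
  let t := (equivShrink.{u} σ).symm
  -- There need not be a small number of automorphisms, so they are classified by the type of the
  -- image of x.
  let T : S → Set (Formula L (Sum.elim (fun i => s (t i)) ρ)) := fun g =>
    {φ | φ.Realize M (join M (fun i => g.1.map x (t i)) d)}
  have hbad : ∀ g : S, ∃ E : Set M.El, Small.{u} E ∧ B' ⊆ E ∧
      ∀ A', M.EquivOver (B' ∪ C) (M.entries (g.1.map x)) A' → ¬ MInd M A' C E := by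
    intro g
    have := hcon g.1 g.2
    unfold ThornInd at this
    push Not at this
    exact this
  choose E hE hBE hbad using hbad
  obtain ⟨_, ⟨g, hg, rfl⟩, h1⟩ := h (B' ∪ ⋃ τ : Set.range T, E τ.2.choose)
    (small_union _ _) (hBB.trans Set.subset_union_left)
  -- The conjugate that is independent from the union has the same type as the representative chosen
  -- for it, and this carries independence over to a conjugate excluded by that representative's bad
  -- set.
  let τ : Set.range T := ⟨T ⟨g, hg⟩, ⟨_, rfl⟩⟩
  have hτ := τ.2.choose_spec
  have hsame : M.SameType (B' ∪ C) (τ.2.choose.1.map x) (g.map x) := by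
    refine sameType_iff.mpr fun P hP => ?_
    obtain ⟨Q, hQ, hQP⟩ := definableOver_iff.mp hP
    have hex : ∀ z : σ ⊕ ↥(B' ∪ C), ∃ r : Term L (Sum.elim (fun i => s (t i)) ρ)
        (Sum.elim s (fun a => a.1.1) z), ∀ y : ∀ i, M.car (s i),
        r.value M (join M (fun i => y (t i)) d) = join M y (fun a : ↥(B' ∪ C) => a.1.2) z := by
      rintro (i | ⟨a, ha⟩)
      · obtain ⟨j, rfl⟩ := t.surjective i
        exact ⟨.var (σ := Sum.elim (fun i => s (t i)) ρ) (.inl j), fun _ => rfl⟩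
      · rw [← hd] at ha
        obtain ⟨j, rfl⟩ := ha
        exact ⟨.var (σ := Sum.elim (fun i => s (t i)) ρ) (.inr j), fun _ => rfl⟩
    choose r hr using hex
    obtain ⟨φ, hφ⟩ := hQ.subst r
    have h2 : φ ∈ T τ.2.choose ↔ φ ∈ T ⟨g, hg⟩ := by rw [hτ]
    have h3 : ∀ k : S, φ ∈ T k ↔ P (k.1.map x) := fun k => by
      refine (hφ _).trans (Iff.trans ?_ (hQP _))
      refine iff_of_eq (congrArg Q (funext fun z => hr z _))
    rw [h3, h3] at h2
    exact h2
  obtain ⟨k, hk, hkx⟩ := hM.exists_automorphism (small_union B' C) hsame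
  refine hbad τ.2.choose (M.entries (g.map x)) ⟨k, hk, ?_⟩ ?_
  · rw [← hkx, k.entries_map]
  · rw [g.entries_map]
    exact h1.mono subset_rfl
      ((Set.subset_iUnion (fun τ : Set.range T => E τ.2.choose) τ).trans Set.subset_union_right)

/-- First move C so that it is M-independent from the larger set E over D, carry B along, then move
B over A and the new C; transitivity of M-independence combines the two. -/
theorem ThornInd.trans (h₁ : D ⊆ C) (h₃ : ThornInd M B C A) (h₄ : ThornInd M C D A) :
    ThornInd M B D A := by
  intro E hE hAE
  obtain ⟨_, ⟨g, hg, rfl⟩, h5⟩ := h₄ E hE hAE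
  have hgA : g.act '' A = A := Automorphism.image_eq_self fun e he => hg e (Or.inl he)
  have hgD : g.act '' D = D := Automorphism.image_eq_self fun e he => hg e (Or.inr he)
  have h6 := h₃.image g
  rw [hgA] at h6
  obtain ⟨_, ⟨k, hk, rfl⟩, h7⟩ := h6 E hE hAE
  have hkC : k.act '' (g.act '' C) = g.act '' C :=
    Automorphism.image_eq_self fun e he => hk e (Or.inr he)
  have hDC : D ⊆ g.act '' C := by
    rw [← hgD]
    exact Set.image_mono h₁
  refine ⟨_, ⟨g.trans k, ?_, rfl⟩, ?_⟩
  · rintro e (he | he)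
    · rw [Automorphism.act_trans, hg e (Or.inl he), hk e (Or.inl he)]
    · rw [Automorphism.act_trans, hg e (Or.inr he), hk e (Or.inr (hDC he))]
  · rw [Automorphism.image_trans]
    exact MInd.trans hDC h7 h5

theorem thornInd_extension (hM : IsSaturatedHomogeneous M) : Extension (ThornInd M) := by
  intro A B C B' hA hB hC hB' h hBB
  obtain ⟨κ, σ, x, rfl⟩ := exists_entries_eq A
  obtain ⟨g, hg, h1⟩ := h.extend hM hC hB' hBB
  exact ⟨_, ⟨g, hg, rfl⟩, by rwa [g.entries_map] at h1⟩

theorem thornInd_antiReflexivity : AntiReflexivity (ThornInd M) := by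
  intro a B _ h
  exact mInd_iff.mp (h.mInd inferInstance) B subset_rfl
    (Set.subset_union_right.trans subset_acl) a (subset_acl (Or.inl rfl)) (subset_acl (Or.inl rfl))

end Thorn

/-! ### Strict independence relations are finer than thorn-independence -/

section Existence

variable {R : TernaryRel M}

/-- Local character and base monotonicity give independence over the right side. -/
theorem rel_self_of_localCharacter (hl : LocalCharacter R) (hb : BaseMonotonicity R)
    (hA : Small.{u} A) (hC : Small.{u} C) : R A C C := by
  obtain ⟨κ, hκ⟩ := hl A hA
  obtain ⟨C₀, hC₀, -, h⟩ := hκ C hC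
  exact hb A C C C₀ hA hC hC₀ subset_rfl h

/-- acl A is independent from A over A; extending the right side to A ∪ B replaces acl A by a
conjugate over A, which is acl A itself. -/
theorem IsIndependenceRelation.rel_acl_left (hR : IsIndependenceRelation R) (hA : Small.{u} A)
    (hB : Small.{u} B) : R (M.acl A) A B := by
  obtain ⟨_, ⟨g, hg, rfl⟩, h⟩ := hR.extension (M.acl A) A A (A ∪ B) inferInstance hA hA
    (small_union _ _) (rel_self_of_localCharacter hR.localCharacter hR.baseMonotonicity
      inferInstance hA) Set.subset_union_left
  rw [g.image_acl, Automorphism.image_eq_self fun e he => hg e (Or.inl he)] at h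
  exact hR.monotonicity _ _ _ _ _ inferInstance (small_union _ _) hA h subset_rfl
    Set.subset_union_right

/-- The conjugating automorphism of the extension axiom fixes B ∪ C, so it preserves acl(B ∪ C) and
can be undone by invariance. -/
theorem IsIndependenceRelation.rel_acl_right (hR : IsIndependenceRelation R) (hA : Small.{u} A)
    (hB : Small.{u} B) (hC : Small.{u} C) (h : R A C B) : R A C (M.acl (B ∪ C)) := by
  obtain ⟨_, ⟨g, hg, rfl⟩, h⟩ := hR.extension A B C (M.acl (B ∪ C)) hA hB hC
    inferInstance h (Set.subset_union_left.trans subset_acl)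
  have h1 := hR.invariance _ _ _ inferInstance inferInstance hC h g.symm
  have h3 := Automorphism.symm_fixes hg
  rwa [Automorphism.image_symm_image, Automorphism.image_acl, Automorphism.image_eq_self h3,
    Automorphism.image_eq_self fun e he => h3 e (Or.inr he)] at h1

/-- After base monotonicity to C' both sides are closed algebraically. A common element of the
closures is then independent from itself over C', and anti-reflexivity puts it in acl C'. -/
theorem IsStrictIndependenceRelation.mInd (hR : IsStrictIndependenceRelation R) (hA : Small.{u} A)
    (hB : Small.{u} B) (hC : Small.{u} C) (h : R A C B) : MInd M A C B := by
  refine mInd_iff.mpr fun C' h1 h2 e he he' => ?_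
  have hC' : Small.{u} C' := small_subset h2
  have h3 := hR.baseMonotonicity _ _ C' _ hA inferInstance h1 h2
    (hR.rel_acl_right hA hB hC h)
  have h4 := hR.rel_acl_right hA inferInstance hC' h3
  have h5 := hR.transitivity _ _ (A ∪ C') C' (inferInstance : Small.{u} (M.acl (M.acl (B ∪ C) ∪ C')))
    inferInstance Set.subset_union_right subset_acl
    (hR.rel_acl_left (small_union _ _) inferInstance)
    (hR.normality _ _ _ hA inferInstance hC' h4)
  refine hR.antiReflexivity e C' hC' (hR.monotonicity _ _ _ _ _ inferInstance inferInstance hC' h5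
    (Set.singleton_subset_iff.mpr he) (Set.singleton_subset_iff.mpr (acl_mono ?_ he')))
  exact Set.union_subset_union_left _ (Set.subset_union_left.trans subset_acl)

theorem IsStrictIndependenceRelation.thornInd (hR : IsStrictIndependenceRelation R)
    (hA : Small.{u} A) (hB : Small.{u} B) (hC : Small.{u} C) (h : R A C B) : ThornInd M A C B := by
  intro E hE hBE
  obtain ⟨_, ⟨g, hg, rfl⟩, h1⟩ := hR.extension A B C E hA hB hC hE h hBE
  exact ⟨_, ⟨g, hg, rfl⟩, hR.mInd inferInstance hE hC h1⟩

end Existence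

end ManySorted

namespace ManySorted

variable {L : Language.{u}}

/-! ### Formulas with few solutions as witnesses of algebraicity -/

section AlgForm

variable {M : Structure.{u, v} L} {ι : Type*} {σ : ι → L.Srt} {V : Set M.El}

/-- The elements of a tuple other than the one with index `u₀`. -/
def others {n : ℕ} {y : Fin n → L.Srt} (u₀ : Fin n) (b : ∀ l, M.car (y l)) : Set M.El :=
  M.entries fun l : {l // l ≠ u₀} => b l

theorem others_subset {n : ℕ} {y : Fin n → L.Srt} (u₀ : Fin n) (b : ∀ l, M.car (y l)) :
    others u₀ b ⊆ M.entries b := by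
  rintro _ ⟨l, rfl⟩
  exact ⟨l, rfl⟩

theorem mem_entries (x : ∀ i, M.car (σ i)) (i : ι) : (⟨σ i, x i⟩ : M.El) ∈ M.entries x :=
  ⟨i, rfl⟩

theorem entries_subset_union_others {n : ℕ} {y : Fin n → L.Srt} (u₀ : Fin n)
    (b : ∀ l, M.car (y l)) : M.entries b ⊆ insert ⟨y u₀, b u₀⟩ (others u₀ b) := by
  rintro _ ⟨l, rfl⟩
  by_cases hl : l = u₀
  · subst hl
    exact Or.inl rfl
  · exact Or.inr ⟨⟨l, hl⟩, rfl⟩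

theorem others_map {n : ℕ} {y : Fin n → L.Srt} (u₀ : Fin n) (b : ∀ l, M.car (y l))
    (g : Automorphism M) : others u₀ (g.map b) = g.act '' others u₀ b :=
  g.entries_map fun l : {l // l ≠ u₀} => b l

/-- For all values of the other variables, the formula `φ(x; y)` has fewer than `k` solutions for
the variable with index `u₀`. -/
def HasFewSolutions (M : Structure.{u, v} L) {n : ℕ} {y : Fin n → L.Srt} (u₀ : Fin n) (k : ℕ)
    (φ : Formula L (Sum.elim σ y)) : Prop :=
  ∀ (x : ∀ i, M.car (σ i)) (b : Fin k → ∀ l, M.car (y l)), (∀ i, φ.Realize M (join M x (b i))) →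
    (∀ i j, ∀ l ≠ u₀, b i l = b j l) → ∃ i j, i < j ∧ b i u₀ = b j u₀

/-- Formulas `φ(x; y)` that make one of the variables `y` algebraic over the other variables. -/
structure AlgForm (M : Structure.{u, v} L) (σ : ι → L.Srt) where
  n : ℕ
  y : Fin n → L.Srt
  u₀ : Fin n
  k : ℕ
  two_le : 2 ≤ k
  φ : Formula L (Sum.elim σ y)
  few : HasFewSolutions M u₀ k φ

/-- The formula holds of the given tuples. -/
def AlgForm.Sat (q : AlgForm M σ) (x : ∀ i, M.car (σ i)) (b : ∀ l, M.car (q.y l)) : Prop :=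
  q.φ.Realize M (join M x b)

theorem AlgForm.definableOver_sat (q : AlgForm M σ) {b : ∀ l, M.car (q.y l)}
    (hb : M.entries b ⊆ V) : DefinableOver V σ fun x => q.Sat x b :=
  (definable_realize q.φ).definableOver b hb

theorem AlgForm.sat_map (q : AlgForm M σ) (g : Automorphism M) (x : ∀ i, M.car (σ i))
    (b : ∀ l, M.car (q.y l)) : q.Sat (g.map x) (g.map b) ↔ q.Sat x b := by
  have h : join M (g.map x) (g.map b) = g.map (join M x b) := by
    funext z
    rcases z with z | z <;> rfl
  unfold Sat
  rw [h]
  exact (definable_realize q.φ).map_iff g _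

theorem AlgForm.Sat.mem_acl {q : AlgForm M σ} {x : ∀ i, M.car (σ i)} {b : ∀ l, M.car (q.y l)}
    (h : q.Sat x b) : (⟨q.y q.u₀, b q.u₀⟩ : M.El) ∈ M.acl (M.entries x ∪ others q.u₀ b) := by
  classical
  let τ : Unit ⊕ (ι ⊕ {l // l ≠ q.u₀}) → L.Srt :=
    Sum.elim (fun _ : Unit => q.y q.u₀) (Sum.elim σ fun l : {l // l ≠ q.u₀} => q.y l)
  have hex : ∀ l, ∃ r : Term L τ (q.y l), ∀ t : M.car (q.y q.u₀),
      r.value M (join M (fun _ : Unit => t) (join M x fun l : {l // l ≠ q.u₀} => b l)) =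
        Function.update b q.u₀ t l := by
    intro l
    by_cases hl : l = q.u₀
    · subst hl
      exact ⟨.var (σ := τ) (.inl ()), fun t => by rw [Function.update_self]; rfl⟩
    · exact ⟨.var (σ := τ) (.inr (.inr ⟨l, hl⟩)), fun t => by rw [Function.update_of_ne hl]; rfl⟩
  choose r hr using hex
  let r' : ∀ z : ι ⊕ Fin q.n, Term L τ (Sum.elim σ q.y z) := fun z => match z with
    | .inl i => .var (σ := τ) (.inr (.inl i))
    | .inr l => r l
  have hr' : ∀ t : M.car (q.y q.u₀), (fun z => (r' z).value M (join M (fun _ : Unit => t)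
      (join M x fun l : {l // l ≠ q.u₀} => b l))) = join M x (Function.update b q.u₀ t) := by
    intro t
    funext z
    rcases z with z | z
    · rfl
    · exact hr z t
  have h1 := ((definable_realize (M := M) q.φ).subst r').definableOver
    (A := M.entries x ∪ others q.u₀ b) (join M x fun l : {l // l ≠ q.u₀} => b l) (by
      rintro _ ⟨z | z, rfl⟩
      · exact Or.inl ⟨z, rfl⟩
      · exact Or.inr ⟨z, rfl⟩)
  refine mem_acl_iff.mpr ⟨fun t => q.Sat x (Function.update b q.u₀ t), h1.congr fun z => ?_, ?_, ?_⟩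
  · exact iff_of_eq (congrArg _ (hr' (z ())))
  · simpa using h
  · refine FewerThan.finite (k := q.k) fun z hz => ?_
    obtain ⟨i, j, hij, he⟩ := q.few x (fun i => Function.update b q.u₀ (z i)) hz
      fun i j l hl => by simp [Function.update_of_ne hl]
    exact ⟨i, j, hij, by simpa using he⟩

/-- Every element of the algebraic closure is witnessed by some formula with few solutions. -/
theorem exists_algForm {e : M.El} {x : ∀ i, M.car (σ i)} (he : e ∈ M.acl (V ∪ M.entries x)) :
    ∃ (q : AlgForm M σ) (b : ∀ l, M.car (q.y l)), q.Sat x b ∧ ⟨q.y q.u₀, b q.u₀⟩ = e ∧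
      others q.u₀ b ⊆ V := by
  obtain ⟨A₀, hA₀, hfin, he⟩ := exists_finite_mem_acl he
  have := (hfin.inter_of_left V).to_subtype
  obtain ⟨n, ⟨c⟩⟩ := Finite.exists_equiv_fin ↥(A₀ ∩ V)
  let y : Fin (n + 1) → M.El := Fin.cons e fun i => (c.symm i).1
  have he : e ∈ M.acl (∅ ∪ M.entries (join M x fun i : Fin n => (y i.succ).2)) := by
    refine acl_mono (fun a ha => Or.inr ?_) he
    rcases hA₀ ha with h | ⟨i, rfl⟩
    · exact ⟨.inr (c ⟨a, ha, h⟩), by simp [y, join]⟩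
    · exact ⟨.inl i, rfl⟩
  obtain ⟨Q, hQ, h1, h2⟩ := mem_acl_union_entries.mp he
  rw [definableOver_empty_iff] at hQ
  obtain ⟨k, hk, hfew⟩ := h2.exists_fewerThan
  let τ : ι ⊕ Fin (n + 1) → L.Srt := Sum.elim σ fun l => (y l).1
  have h3 := hQ.subst (τ := τ) (fun z => match z with
    | .inl _ => .var (σ := τ) (.inr 0)
    | .inr (.inl i) => .var (σ := τ) (.inl i)
    | .inr (.inr i) => .var (σ := τ) (.inr i.succ))
  have h4 := (hQ.fewerThan k).subst (τ := τ) (fun z => match z with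
    | .inl i => .var (σ := τ) (.inl i)
    | .inr i => .var (σ := τ) (.inr i.succ))
  -- Adding the bound on the number of solutions to the formula makes it valid for all values of the
  -- variables, not just the given ones.
  obtain ⟨φ, hφ⟩ := h3.and h4
  have key : ∀ (x : ∀ i, M.car (σ i)) (b : ∀ l, M.car (y l).1), φ.Realize M (join M x b) ↔
      Q (join M (fun _ => b 0) (join M x fun i : Fin n => b i.succ)) ∧
      FewerThan k {t | Q (join M (fun _ => t) (join M x fun i : Fin n => b i.succ))} := by
    intro x b
    refine (hφ _).trans (and_congr (iff_of_eq (congrArg Q ?_))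
      (iff_of_eq (congrArg _ (Set.ext fun t => iff_of_eq (congrArg Q ?_)))))
    · funext z
      rcases z with z | z | z <;> rfl
    · funext z
      rcases z with z | z | z <;> rfl
  refine ⟨⟨n + 1, fun l => (y l).1, 0, k, hk, φ, fun x b hb hbb => ?_⟩, fun l => (y l).2,
    (key _ _).mpr ⟨h1, hfew⟩, rfl, ?_⟩
  · have hk0 : 0 < k := by omega
    refine ((key _ _).mp (hb ⟨0, hk0⟩)).2 (fun i => b i 0) fun i => ?_
    have h5 := ((key _ _).mp (hb i)).1
    have h6 : (fun i : Fin n => b ⟨0, hk0⟩ i.succ) = fun j : Fin n => b i j.succ :=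
      funext fun l => hbb _ _ _ (Fin.succ_ne_zero l)
    change Q (join M (fun _ => b i 0) (join M x fun i : Fin n => b ⟨0, hk0⟩ i.succ))
    rw [h6]
    exact h5
  · rintro _ ⟨⟨l, hl⟩, rfl⟩
    obtain ⟨j, rfl⟩ := Fin.exists_succ_eq.mpr hl
    exact (c.symm j).2.2

/-- A formula with few solutions only depends on finitely many of the variables `x`. -/
theorem AlgForm.exists_restrict (q : AlgForm M σ) : ∃ (m : ℕ) (f : Fin m → ι)
    (φ : Formula L (Sum.elim (fun i => σ (f i)) q.y)), HasFewSolutions M q.u₀ q.k φ ∧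
      ∀ x b, φ.Realize M (join M (fun i => x (f i)) b) ↔ q.Sat x b := by
  obtain ⟨F, hF, h⟩ := (definable_realize (M := M) q.φ).exists_support
  let G : Set ι := Sum.inl ⁻¹' F
  have : Finite G := hF.preimage Sum.inl_injective.injOn
  obtain ⟨m, ⟨c⟩⟩ := Finite.exists_equiv_fin G
  let f : Fin m → ι := fun i => (c.symm i).1
  obtain ⟨P, hP, hPq⟩ := h F subset_rfl
  have hex : ∀ z : F, ∃ r : Term L (Sum.elim (fun i => σ (f i)) q.y) (Sum.elim σ q.y z),
      ∀ (x : ∀ i, M.car (σ i)) b, r.value M (join M (fun i => x (f i)) b) = join M x b z := by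
    rintro ⟨i | l, hz⟩
    · obtain ⟨j, rfl⟩ : ∃ j, f j = i := ⟨c ⟨i, hz⟩, by simp [f]⟩
      exact ⟨.var (σ := Sum.elim (fun i => σ (f i)) q.y) (.inl j), fun _ _ => rfl⟩
    · exact ⟨.var (σ := Sum.elim (fun i => σ (f i)) q.y) (.inr l), fun _ _ => rfl⟩
  choose r hr using hex
  obtain ⟨φ, hφ⟩ := hP.subst r
  have key : ∀ x b, φ.Realize M (join M (fun i => x (f i)) b) ↔ q.Sat x b := fun x b =>
    (hφ _).trans (Iff.trans (iff_of_eq (congrArg P (funext fun z => hr z x b))) (hPq _))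
  refine ⟨m, f, φ, fun a b hb hbb => ?_, key⟩
  have hf : Function.Injective f := Subtype.val_injective.comp c.symm.injective
  -- Values for the selected variables extend to a full tuple; injectivity of f makes the
  -- prescription consistent.
  obtain ⟨x, rfl⟩ : ∃ x : ∀ i, M.car (σ i), (fun i => x (f i)) = a := by
    have hx : ∀ i : ι, ∃ t : M.car (σ i), ∀ j (e : f j = i), t = e ▸ a j := by
      intro i
      by_cases hi : ∃ j, f j = i
      · obtain ⟨j, rfl⟩ := hi
        refine ⟨a j, fun j' e => ?_⟩
        obtain rfl := hf e
        rfl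
      · exact ⟨(M.nonempty _).some, fun j e => absurd ⟨j, e⟩ hi⟩
    choose x hx using hx
    exact ⟨x, funext fun j => hx _ j rfl⟩
  exact q.few x b (fun i => (key _ _).mp (hb i)) hbb

end AlgForm

/-! ### Finite patterns: moving them and splitting them by formula -/

section Patterns

variable {M : Structure.{u, u + 1} L} {ι : Type*} {σ : ι → L.Srt} {C D C' : Set M.El}
  {Δ : Set (AlgForm M σ)} {x : ∀ i, M.car (σ i)}

/-- `Pattern Δ N x C`: there are `N` tuples, each satisfying with `x` some formula in `Δ`, and such
that the distinguished element of each is not algebraic over its other elements, the previous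
tuples, and `C`. -/
def Pattern (Δ : Set (AlgForm M σ)) : ℕ → (∀ i, M.car (σ i)) → Set M.El → Prop
  | 0, _, _ => True
  | N + 1, x, C => ∃ q ∈ Δ, ∃ b : ∀ l, M.car (q.y l), q.Sat x b ∧
      (⟨q.y q.u₀, b q.u₀⟩ : M.El) ∉ M.acl (C ∪ others q.u₀ b) ∧ Pattern Δ N x (C ∪ M.entries b)

theorem Pattern.mono {N : ℕ} (h : Pattern Δ N x C) (hC : C' ⊆ C) : Pattern Δ N x C' := by
  induction N generalizing C C' with
  | zero => trivial
  | succ N ih =>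
    obtain ⟨q, hq, b, h1, h2, h3⟩ := h
    exact ⟨q, hq, b, h1, fun h => h2 (acl_mono (Set.union_subset_union_left _ hC) h),
      ih h3 (Set.union_subset_union_left _ hC)⟩

theorem Pattern.of_le {N N' : ℕ} (h : Pattern Δ N x C) (hN : N' ≤ N) : Pattern Δ N' x C := by
  induction N' generalizing N C with
  | zero => trivial
  | succ N' ih =>
    obtain ⟨N, rfl⟩ := Nat.exists_eq_add_of_lt hN
    obtain ⟨q, hq, b, h1, h2, h3⟩ := h
    exact ⟨q, hq, b, h1, h2, ih h3 (by omega)⟩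

theorem Pattern.map {N : ℕ} (h : Pattern Δ N x C) (g : Automorphism M) :
    Pattern Δ N (g.map x) (g.act '' C) := by
  induction N generalizing C with
  | zero => trivial
  | succ N ih =>
    obtain ⟨q, hq, b, h1, h2, h3⟩ := h
    refine ⟨q, hq, g.map b, (q.sat_map g x b).mpr h1, ?_, ?_⟩
    · rw [others_map, ← Set.image_union]
      exact fun h => h2 (g.act_mem_acl_iff.mp h)
    · rw [g.entries_map, ← Set.image_union]
      exact ih h3

/-- A pattern over `C` can be moved to a pattern over a larger set. -/
theorem Pattern.exists_map (hM : IsSaturatedHomogeneous M) {N : ℕ} (h : Pattern Δ N x C)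
    (hC : Small.{u} C) (hD : Small.{u} D) :
    ∃ g : Automorphism M, (∀ e ∈ C, g.act e = e) ∧ Pattern Δ N (g.map x) (C ∪ D) := by
  induction N generalizing C x with
  | zero => exact ⟨.refl M, fun _ _ => rfl, trivial⟩
  | succ N ih =>
    obtain ⟨q, hq, b, h1, h2, h3⟩ := h
    have : Small.{u} (others q.u₀ b) := small_subset (others_subset _ _)
    -- The distinguished element is moved off the larger base first; the tail is then moved over the
    -- new head.
    obtain ⟨g, hg, hgu⟩ := hM.exists_act_notMem_acl (small_union _ _)
      (E := (C ∪ D) ∪ others q.u₀ b) (small_union _ _) h2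
    have h4 := h3.map g
    rw [Set.image_union, ← g.entries_map,
      Automorphism.image_eq_self fun e he => hg e (Or.inl he)] at h4
    obtain ⟨k, hk, h5⟩ := ih h4 (small_union _ _)
    have hkb : k.map (g.map b) = g.map b := k.map_eq_self fun e he => hk e (Or.inr he)
    refine ⟨g.trans k, fun e he => ?_, q, hq, g.map b, ?_, ?_, h5.mono ?_⟩
    · rw [Automorphism.act_trans, hg e (Or.inl he), hk e (Or.inl he)]
    · have := (q.sat_map k _ _).mpr ((q.sat_map g x b).mpr h1)
      rwa [hkb] at this
    · rw [others_map, Automorphism.image_eq_self fun e he => hg e (Or.inr he)]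
      exact hgu
    · rw [Set.union_right_comm]

/-- A long pattern for finitely many formulas contains a long pattern for one of them. -/
theorem Pattern.pigeonhole [DecidableEq (AlgForm M σ)] {s : Finset (AlgForm M σ)} {N : ℕ}
    (h : Pattern (s : Set (AlgForm M σ)) N x C) :
    ∃ c : AlgForm M σ → ℕ, ∑ q ∈ s, c q = N ∧ ∀ q, Pattern {q} (c q) x C := by
  induction N generalizing C with
  | zero => exact ⟨fun _ => 0, by simp, fun _ => trivial⟩
  | succ N ih =>
    obtain ⟨q, hq, b, h1, h2, h3⟩ := h
    obtain ⟨c, hc, hp⟩ := ih h3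
    -- The head is credited to its own formula; for every other formula it is dropped, which only
    -- shrinks the base of the tail.
    refine ⟨fun q' => c q' + if q' = q then 1 else 0, ?_, fun q' => ?_⟩
    · rw [Finset.sum_add_distrib, hc, Finset.sum_ite_eq' s q, if_pos (Finset.mem_coe.mp hq)]
    · by_cases hqq : q' = q
      · subst hqq
        beta_reduce
        rw [if_pos rfl]
        exact ⟨q', rfl, b, h1, h2, hp q'⟩
      · beta_reduce
        rw [if_neg hqq]
        exact (hp q').mono Set.subset_union_left

theorem Pattern.exists_bound {s : Set (AlgForm M σ)} (hs : s.Finite)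
    (h : ∀ q ∈ s, ∃ N, ∀ x, ¬ Pattern {q} N x ∅) : ∃ N, ∀ x, ¬ Pattern s N x ∅ := by
  classical
  obtain ⟨s, rfl⟩ := hs.exists_finset_coe
  choose! f hf using h
  refine ⟨∑ q ∈ s, f q + 1, fun x hx => ?_⟩
  obtain ⟨c, hc, hp⟩ := hx.pigeonhole
  have h1 : ∀ q ∈ s, c q ≤ f q := fun q hq => by
    by_contra! hlt
    exact hf q hq x ((hp q).of_le hlt.le)
  have := Finset.sum_le_sum h1
  omega

end Patterns

/-! ### Compactness for M-dividing and thorn-forking -/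

section ThornCompactness

variable {M : Structure.{u, u + 1} L} {ι : Type*} {σ : ι → L.Srt} {A B C : Set M.El}
  {x : ∀ i, M.car (σ i)}

/-- M-independence is tested on the base obtained from C by adding the other entries of b. -/
theorem MInd.mem_acl (h : MInd M A C B) {n : ℕ} {y : Fin n → L.Srt} {u₀ : Fin n}
    {b : ∀ l, M.car (y l)} (hb : M.entries b ⊆ M.acl (B ∪ C))
    (hu : (⟨y u₀, b u₀⟩ : M.El) ∈ M.acl (A ∪ others u₀ b)) :
    (⟨y u₀, b u₀⟩ : M.El) ∈ M.acl (C ∪ others u₀ b) := by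
  refine mInd_iff.mp h (C ∪ others u₀ b) Set.subset_union_left (Set.union_subset
    (Set.subset_union_right.trans subset_acl) ((others_subset _ _).trans hb)) _
    (acl_mono (Set.union_subset_union_right _ Set.subset_union_right) hu) ?_
  exact acl_mono (Set.union_subset_union_right _ Set.subset_union_left) (hb (mem_entries b u₀))

/-- An element algebraic over x and C' comes with a formula having few solutions whose remaining
parameters lie in C', so no other failures need to be excluded. -/
theorem mInd_entries (hM : IsSaturatedHomogeneous M) (hB : Small.{u} B) (hC : Small.{u} C)
    (h : ∀ (q : AlgForm M σ) (b : ∀ l, M.car (q.y l)), M.entries b ⊆ M.acl (B ∪ C) → q.Sat x b →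
      (⟨q.y q.u₀, b q.u₀⟩ : M.El) ∈ M.acl (C ∪ others q.u₀ b)) : MInd M (M.entries x) C B := by
  refine mInd_iff.mpr fun C' h1 h2 e he he' => ?_
  rw [Set.union_comm] at he
  obtain ⟨q, b, hq, rfl, hb⟩ := exists_algForm he
  refine acl_mono (Set.union_subset h1 hb) (h q b ?_ hq)
  refine (entries_subset_union_others q.u₀ b).trans (Set.insert_subset ?_ (hb.trans h2))
  rwa [hM.acl_union_eq hB hC h1 h2] at he'

/-- Formulas with parameters from `acl (B ∪ C)` that witness M-dividing over `C`. -/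
structure DividingInstance (σ : ι → L.Srt) (B C : Set M.El) where
  q : AlgForm M σ
  b : ∀ l, M.car (q.y l)
  entries_subset : M.entries b ⊆ M.acl (B ∪ C)
  notMem : (⟨q.y q.u₀, b q.u₀⟩ : M.El) ∉ M.acl (C ∪ others q.u₀ b)

/-- Compactness for tp(x/B ∪ C) together with the negations of all dividing instances over B' and C;
a realisation is conjugate to x over B ∪ C and has no dividing instance left. -/
theorem exists_map_mInd (hM : IsSaturatedHomogeneous M) [Small.{u} ι] {B' : Set M.El}
    (hB' : Small.{u} B') (hC : Small.{u} C) (hBB : B ⊆ B')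
    (h : ∀ B₀ ⊆ B ∪ C, B₀.Finite → ∀ s : Set (DividingInstance σ B' C), s.Finite →
      ∃ x', M.SameType B₀ x x' ∧ ∀ p ∈ s, ¬ p.q.Sat x' p.b) :
    ∃ g : Automorphism M, (∀ e ∈ B ∪ C, g.act e = e) ∧ MInd M (M.entries (g.map x)) C B' := by
  have hBC : B ∪ C ⊆ B' ∪ C := Set.union_subset_union_left _ hBB
  obtain ⟨x', hx'⟩ := hM.compactness (σ := σ) (A := M.acl (B' ∪ C)) inferInstance
    (Θ := {B₀ : Set M.El // B₀ ⊆ B ∪ C ∧ B₀.Finite} ⊕ DividingInstance σ B' C)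
    (fun θ x' => match θ with
      | .inl B₀ => M.SameType B₀ x x'
      | .inr p => ¬ p.q.Sat x' p.b) (by
      rintro (⟨B₀, hB₀, -⟩ | p)
      · exact (typeDefinableOver_sameType x).mono ((hB₀.trans hBC).trans subset_acl)
      · exact (p.q.definableOver_sat p.entries_subset).not.typeDefinableOver) (by
      intro s hs
      let S := Sum.inl ⁻¹' s
      have hS : S.Finite := hs.preimage Sum.inl_injective.injOn
      obtain ⟨x', h1, h2⟩ := h (⋃ B₀ ∈ S, B₀.1) (Set.iUnion₂_subset fun B₀ _ => B₀.2.1)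
        (hS.biUnion fun B₀ _ => B₀.2.2) (Sum.inr ⁻¹' s) (hs.preimage Sum.inr_injective.injOn)
      refine ⟨x', ?_⟩
      rintro (B₀ | p) hθ
      · exact sameType_mono h1 (Set.subset_biUnion_of_mem (u := fun B₀ : {B₀ : Set M.El //
          B₀ ⊆ B ∪ C ∧ B₀.Finite} => B₀.1) (show B₀ ∈ S from hθ))
      · exact h2 p hθ)
  have hB : Small.{u} B := small_subset hBB
  obtain ⟨g, hg, rfl⟩ := hM.exists_automorphism (small_union B C)
    (sameType_iff_finite.mpr fun B₀ h1 h2 => hx' (.inl ⟨B₀, h1, h2⟩))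
  refine ⟨g, hg, mInd_entries hM hB' hC fun q b hb hq => by_contra fun hn => ?_⟩
  exact hx' (.inr ⟨q, b, hb, hn⟩) hq

/-- Thorn-forking is witnessed by a finite disjunction of M-dividing formulas. -/
theorem exists_dividing_of_not_thornInd (hM : IsSaturatedHomogeneous M) [Small.{u} ι]
    (hC : Small.{u} C) (h : ¬ ThornInd M (M.entries x) C B) :
    ∃ B' : Set M.El, Small.{u} B' ∧ ∃ s : Set (DividingInstance σ B' C), s.Finite ∧
      ∃ B₀ ⊆ B ∪ C, B₀.Finite ∧ ∀ x', M.SameType B₀ x x' → ∃ p ∈ s, p.q.Sat x' p.b := by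
  unfold ThornInd at h
  push Not at h
  obtain ⟨B', hB', hBB, h⟩ := h
  by_contra! hcon
  obtain ⟨g, hg, h1⟩ := exists_map_mInd (x := x) hM hB' hC hBB fun B₀ h1 h2 s hs =>
    hcon B' hB' s hs B₀ h1 h2
  exact h _ ⟨g, hg, (g.entries_map x).symm⟩ h1

theorem thornInd_finiteCharacter (hM : IsSaturatedHomogeneous M) :
    FiniteCharacter (ThornInd M) := by
  intro A B C hA _ hC h B' hB' hBB
  obtain ⟨κ, σ, x, rfl⟩ := exists_entries_eq A
  obtain ⟨g, hg, h1⟩ := exists_map_mInd (x := x) hM hB' hC hBB fun B₀ h1 h2 s hs => by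
    choose m f φ hφ hf using fun p : s => p.1.q.exists_restrict
    have := hs.to_subtype
    -- Finitely many instances mention finitely many coordinates of x, and a conjugate of these that
    -- is M-independent from B' refutes all of them at once.
    let A₀ : Set M.El := ⋃ p, M.entries fun i => x (f p i)
    obtain ⟨_, ⟨g, hg, rfl⟩, h3⟩ := h A₀ (Set.iUnion_subset fun p => by
      rintro _ ⟨i, rfl⟩
      exact ⟨f p i, rfl⟩) (Set.finite_iUnion fun p => Set.finite_range _) B' hB' hBB
    refine ⟨g.map x, sameType_mono (sameType_map hg x) h1, fun p hp hsat => ?_⟩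
    let q : AlgForm M fun i => σ (f ⟨p, hp⟩ i) :=
      ⟨p.q.n, p.q.y, p.q.u₀, p.q.k, p.q.two_le, φ ⟨p, hp⟩, hφ ⟨p, hp⟩⟩
    have h4 : q.Sat (fun i => g.map x (f ⟨p, hp⟩ i)) p.b := (hf ⟨p, hp⟩ _ _).mpr hsat
    refine p.notMem (h3.mem_acl p.entries_subset (acl_mono
      (Set.union_subset_union_left _ ?_) h4.mem_acl))
    refine (g.entries_map (fun i => x (f ⟨p, hp⟩ i))).subset.trans (Set.image_mono ?_)
    exact Set.subset_iUnion (fun p : s => M.entries fun i => x (f p i)) ⟨p, hp⟩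
  exact ⟨_, ⟨g, hg, (g.entries_map x).symm⟩, h1⟩

end ThornCompactness

end ManySorted

/-! ### Bounded patterns imply local character and symmetry -/

namespace ManySorted

variable {L : Language.{u}} {M : Structure.{u, u + 1} L} {A B C : Set M.El}

/-- For every formula with few solutions, the length of its patterns is bounded. -/
def HasBoundedPatterns (M : Structure.{u, u + 1} L) : Prop :=
  ∀ (m : ℕ) (σ : Fin m → L.Srt) (q : AlgForm M σ), ∃ N, ∀ x, ¬ Pattern {q} N x ∅

/-- Each formula uses finitely many variables of the possibly infinite tuple x, and patterns survive
the restriction to these. -/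
theorem HasBoundedPatterns.exists_bound (hb : HasBoundedPatterns M) {ι : Type*} {σ : ι → L.Srt}
    {s : Set (AlgForm M σ)} (hs : s.Finite) : ∃ N, ∀ x, ¬ Pattern s N x ∅ := by
  refine Pattern.exists_bound hs fun q _ => ?_
  obtain ⟨m, f, φ, hφ, h⟩ := q.exists_restrict
  let q' : AlgForm M fun i => σ (f i) := ⟨q.n, q.y, q.u₀, q.k, q.two_le, φ, hφ⟩
  obtain ⟨N, hN⟩ := hb m _ q'
  refine ⟨N, fun x hx => hN (fun i => x (f i)) ?_⟩
  clear hN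
  revert hx
  generalize (∅ : Set M.El) = C
  induction N generalizing C with
  | zero => exact fun _ => trivial
  | succ N ih =>
    rintro ⟨_, rfl, b, h1, h2, h3⟩
    exact ⟨q', rfl, b, (h x b).mpr h1, h2, ih _ h3⟩

/-- For each finite Δ the finite set `C₀ Δ` minimises the length at which patterns for x cease to
exist. Forking over the union of these sets would produce a pattern of exactly the forbidden length.
-/
theorem thornInd_localCharacter (hM : IsSaturatedHomogeneous M) (hb : HasBoundedPatterns M) :
    LocalCharacter (ThornInd M) := by
  classical
  intro A hA
  obtain ⟨ι, σ, x, rfl⟩ := exists_entries_eq A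
  -- A union of finite sets, one for each finite set of formulas, is bounded by this cardinal
  -- independently of B.
  refine ⟨Order.succ (Cardinal.mk (Finset (AlgForm M σ) × ℕ)), fun B hB => ?_⟩
  have hex : ∀ s : Finset (AlgForm M σ), ∃ N, ∃ C₀ ⊆ B, C₀.Finite ∧
      ¬ Pattern (s : Set (AlgForm M σ)) N x C₀ := fun s => by
    obtain ⟨N, hN⟩ := hb.exists_bound s.finite_toSet
    exact ⟨N, ∅, Set.empty_subset _, Set.finite_empty, hN x⟩
  let N : Finset (AlgForm M σ) → ℕ := fun s => Nat.find (hex s)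
  choose C₀ hC₀B hC₀ hN using fun s => Nat.find_spec (hex s)
  have hmin : ∀ s, ∀ n < N s, ∀ C₁ ⊆ B, C₁.Finite → Pattern (s : Set (AlgForm M σ)) n x C₁ :=
    fun s n hn C₁ h1 h2 => by_contra fun h => Nat.find_min (hex s) hn ⟨C₁, h1, h2, h⟩
  have hCB : (⋃ s, C₀ s) ⊆ B := Set.iUnion_subset hC₀B
  refine ⟨⋃ s, C₀ s, hCB, ?_, ?_⟩
  · rw [Cardinal.lift_succ, Order.lt_succ_iff]
    have h1 : ∀ c : ↥(⋃ s, C₀ s), ∃ s, c.1 ∈ C₀ s := fun c => Set.mem_iUnion.mp c.2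
    choose f hf using h1
    have h2 : ∀ s, ∃ k : C₀ s → ℕ, Function.Injective k := fun s => by
      have := (hC₀ s).to_subtype
      exact Countable.exists_injective_nat _
    choose k hk using h2
    have h3 := Cardinal.lift_mk_le_lift_mk_of_injective
      (f := fun c : ↥(⋃ s, C₀ s) => (f c, k (f c) ⟨c.1, hf c⟩)) (by
        intro c c' h
        obtain ⟨h4, h5⟩ := Prod.mk.injEq _ _ _ _ ▸ h
        have h6 : ∀ s (h : s = f c'), k s ⟨c.1, h4.trans h.symm ▸ hf c⟩ =
            k (f c') ⟨c'.1, hf c'⟩ → c.1 = c'.1 := by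
          rintro _ rfl h
          exact Subtype.mk.inj (hk _ h)
        refine Subtype.ext (h6 (f c) h4 h5))
    rw [Cardinal.lift_id'.{u, u + 1}] at h3
    exact h3
  · by_contra hcon
    have hC : Small.{u} ↥(⋃ s, C₀ s) := small_subset hCB
    obtain ⟨B', hB', s, hs, B₀, hB₀, hB₀f, hdiv⟩ := exists_dividing_of_not_thornInd hM hC hcon
    rw [Set.union_eq_self_of_subset_right hCB] at hB₀
    let Δ : Finset (AlgForm M σ) := (hs.image fun p => p.q).toFinset
    have hΔ : ∀ p ∈ s, p.q ∈ (Δ : Set (AlgForm M σ)) := fun p hp => by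
      simpa [Δ] using ⟨p, hp, rfl⟩
    -- The empty pattern always exists, so the forbidden length is positive and its predecessor is
    -- attained over every finite subset of B.
    obtain ⟨n, hn⟩ : ∃ n, N Δ = n + 1 := Nat.exists_eq_succ_of_ne_zero fun h0 => by
      have := hN Δ
      change ¬ Pattern (Δ : Set (AlgForm M σ)) (N Δ) x _ at this
      rw [h0] at this
      exact this trivial
    have h1 := hmin Δ n (by omega) (C₀ Δ ∪ B₀) (Set.union_subset (hC₀B Δ) hB₀)
      ((hC₀ Δ).union hB₀f)
    have hCB₀ : Small.{u} ↥(C₀ Δ ∪ B₀) := small_subset (Set.union_subset (hC₀B Δ) hB₀)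
    have hE : Small.{u} ↥(⋃ p ∈ s, M.entries p.b) := by
      have := (hs.biUnion fun p (_ : p ∈ s) => Set.finite_range fun l =>
        (⟨p.q.y l, p.b l⟩ : M.El)).to_subtype
      change Small.{u} ↥(⋃ p ∈ s, Set.range fun l => (⟨p.q.y l, p.b l⟩ : M.El))
      infer_instance
    -- The maximal pattern is made to avoid the forking parameters. Since g fixes B₀, the moved
    -- tuple still satisfies one of the dividing instances, which becomes the new head.
    obtain ⟨g, hg, h2⟩ := h1.exists_map hM hCB₀ hE
    obtain ⟨p, hp, hsat⟩ := hdiv (g.map x)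
      (sameType_map (fun e he => hg e (Or.inr he)) x)
    have h3 : Pattern (Δ : Set (AlgForm M σ)) (n + 1) (g.map x) (C₀ Δ) := by
      refine ⟨p.q, hΔ p hp, p.b, hsat, fun h => p.notMem (acl_mono
        (Set.union_subset_union_left _ (Set.subset_iUnion C₀ Δ)) h), h2.mono ?_⟩
      exact Set.union_subset_union Set.subset_union_left
        (Set.subset_biUnion_of_mem (u := fun p : DividingInstance σ B' _ => M.entries p.b) hp)
    have h4 := h3.map g.symm
    rw [g.map_symm_map, Automorphism.image_eq_self (Automorphism.symm_fixes
      fun e he => hg e (Or.inl he)), ← hn] at h4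
    exact hN Δ h4

theorem ThornInd.union_right (h : ThornInd M A C B) : ThornInd M A C (B ∪ C) := by
  intro E hE hBE
  obtain ⟨A', hA', h1⟩ := h E hE (Set.subset_union_left.trans hBE)
  exact ⟨A', by rwa [Set.union_assoc, Set.union_self], h1⟩

theorem thornInd_empty : ThornInd M ∅ C B := by
  intro E _ _
  refine ⟨∅, ⟨.refl M, fun _ _ => rfl, by simp⟩, mInd_iff.mpr fun C' _ _ e he _ => ?_⟩
  rwa [Set.empty_union] at he

/-- Forking of B with A produces patterns of every length: copies of A independent from B and from
everything used so far carry copies of the dividing parameters, each of which adds a step. -/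
theorem thornInd_symm (hM : IsSaturatedHomogeneous M) (hb : HasBoundedPatterns M)
    (hA : Small.{u} A) (hB : Small.{u} B) (hC : Small.{u} C) (h : ThornInd M A C B) :
    ThornInd M B C A := by
  by_contra hcon
  obtain ⟨ι, σ, x, rfl⟩ := exists_entries_eq B
  obtain ⟨A', hA', s, hs, A₀, hA₀, -, hdiv⟩ := exists_dividing_of_not_thornInd hM hC hcon
  let Δ : Set (AlgForm M σ) := (fun p => p.q) '' s
  obtain ⟨N, hN⟩ := hb.exists_bound (hs.image fun p => p.q)
  let D : Set M.El := ⋃ p ∈ s, M.entries p.b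
  have hD : Small.{u} D := by
    have := (hs.biUnion fun p (_ : p ∈ s) => Set.finite_range fun l =>
      (⟨p.q.y l, p.b l⟩ : M.El)).to_subtype
    change Small.{u} ↥(⋃ p ∈ s, Set.range fun l => (⟨p.q.y l, p.b l⟩ : M.El))
    infer_instance
  have hbm : BaseMonotonicity (ThornInd M) := fun _ _ _ _ _ _ h1 h2 h3 => h3.base_mono h1 h2
  -- The pattern is built from its end: F contains the tuples already placed, and E stands for the
  -- parameters that will come before them.
  have key : ∀ N, ∃ F : Set M.El, Small.{u} F ∧ ∀ E : Set M.El, Small.{u} E → ThornInd M E C F →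
      Pattern Δ N x (C ∪ E) := by
    intro N
    induction N with
    | zero => exact ⟨∅, inferInstance, fun _ _ _ => trivial⟩
    | succ N ih =>
      obtain ⟨F, hF, ih⟩ := ih
      obtain ⟨_, ⟨g, hg, rfl⟩, h1⟩ := thornInd_extension hM A (M.entries x) C (M.entries x ∪ F)
        hA hB hC (small_union _ _) h Set.subset_union_left
      obtain ⟨_, ⟨k, hk, rfl⟩, h2⟩ := thornInd_extension hM (g.act '' D) (C ∪ g.act '' A)
        (C ∪ g.act '' A) ((C ∪ g.act '' A) ∪ F) inferInstance (small_union _ _) (small_union _ _)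
        (small_union _ _) (rel_self_of_localCharacter (thornInd_localCharacter hM hb) hbm
          inferInstance (small_union _ _)) Set.subset_union_left
      rw [Set.union_self] at hk
      have hgk : ∀ e ∈ C, (g.trans k).act e = e := fun e he => by
        rw [Automorphism.act_trans, hg e (Or.inr he), hk e (Or.inl he)]
      let D₂ := k.act '' (g.act '' D)
      have hD₂ : Small.{u} D₂ := inferInstance
      -- The copied parameters are independent from F over C and the copy of A, and that copy is
      -- independent from F over C.
      have h3 : ThornInd M D₂ C F := by
        have h4 := (h2.mono (small_union _ _) subset_rfl Set.subset_union_right).normality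
        have h5 := (h1.mono (small_union _ _) subset_rfl Set.subset_union_right).normality
        rw [Set.union_comm _ C] at h5
        exact (ThornInd.trans Set.subset_union_left h4 h5).mono hF Set.subset_union_left subset_rfl
      refine ⟨F ∪ D₂, small_union _ _, fun E hE hEF => ?_⟩
      have h4 : ThornInd M (E ∪ D₂) C F := by
        have h5 := (ThornInd.base_mono (C := C ∪ D₂) hEF.union_right Set.subset_union_left
          (Set.union_subset Set.subset_union_right
            (Set.subset_union_right.trans Set.subset_union_left))).normality
        have h6 := h5.mono (small_union _ _) subset_rfl
          (Set.subset_union_left.trans Set.subset_union_left : F ⊆ _)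
        have h7 := h3.normality
        rw [Set.union_comm] at h7
        exact (ThornInd.trans Set.subset_union_left h6 h7).mono hF
          (Set.union_subset_union_right _ Set.subset_union_right) subset_rfl
      have hgx : g.map x = x := g.map_eq_self fun e he => hg e (Or.inl he)
      -- On A, g leads into its image, which k fixes, so the conjugate of k⁻¹ fixes A ∪ C. As g
      -- fixes x, it maps x to the preimage of x under g followed by k; a dividing instance true
      -- there becomes one true of x with parameters in D₂.
      have hfix : ∀ e ∈ A ∪ C, ((g.trans k.symm).trans g.symm).act e = e := by
        have hk' := Automorphism.symm_fixes hk
        rintro e (he | he)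
        · rw [Automorphism.act_trans, Automorphism.act_trans,
            hk' _ (Or.inr ⟨e, he, rfl⟩), g.act_symm_act]
        · rw [Automorphism.act_trans, Automorphism.act_trans, hg e (Or.inr he),
            hk' _ (Or.inl he), Automorphism.symm_fixes hg e (Or.inr he)]
      obtain ⟨p, hp, hsat⟩ := hdiv _ (sameType_mono (sameType_map hfix x) hA₀)
      have hmap : ((g.trans k.symm).trans g.symm).map x = (g.trans k).symm.map x := by
        conv_rhs => rw [← hgx]
        rfl
      rw [hmap, ← p.q.sat_map (g.trans k), Automorphism.map_map_symm] at hsat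
      have hbD : M.entries ((g.trans k).map p.b) ⊆ D₂ := by
        rw [Automorphism.entries_map, Automorphism.image_trans]
        exact Set.image_mono (Set.image_mono (Set.subset_biUnion_of_mem
          (u := fun p : DividingInstance σ A' C => M.entries p.b) hp))
      refine ⟨p.q, ⟨p, hp, rfl⟩, (g.trans k).map p.b, hsat, fun hmem => ?_,
        (ih _ (small_union _ _) h4).mono ?_⟩
      · have h5 := (hEF.mInd (small_union _ _)).normality.mem_acl (u₀ := p.q.u₀)
          (b := (g.trans k).map p.b) ((hbD.trans
            (Set.subset_union_right.trans Set.subset_union_left)).trans subset_acl)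
          (by rwa [Set.union_comm E C])
        have hCeq : (g.trans k).act '' C = C := Automorphism.image_eq_self hgk
        rw [others_map] at h5
        have h6 : M.acl (C ∪ (g.trans k).act '' others p.q.u₀ p.b) =
            M.acl ((g.trans k).act '' (C ∪ others p.q.u₀ p.b)) := by
          rw [Set.image_union, hCeq]
        rw [h6] at h5
        exact p.notMem ((g.trans k).act_mem_acl_iff.mp h5)
      · rw [Set.union_assoc]
        exact Set.union_subset_union_right _ (Set.union_subset_union_right _ hbD)
  obtain ⟨F, -, h1⟩ := key N
  exact hN x ((h1 ∅ inferInstance thornInd_empty).mono (Set.empty_subset _))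

/-- Local character is the only axiom that can fail. -/
theorem isIndependenceRelation_thornInd (hM : IsSaturatedHomogeneous M)
    (hl : LocalCharacter (ThornInd M)) : IsIndependenceRelation (ThornInd M) where
  invariance _ _ _ _ _ _ h g := h.image g
  monotonicity _ _ _ _ _ _ hB _ h h1 h2 := h.mono hB h1 h2
  baseMonotonicity _ _ _ _ _ _ h1 h2 h3 := h3.base_mono h1 h2
  transitivity _ _ _ _ _ _ h1 _ h3 h4 := h3.trans h1 h4
  normality _ _ _ _ _ _ h := h.normality
  extension := thornInd_extension hM
  finiteCharacter := thornInd_finiteCharacter hM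
  localCharacter := hl

end ManySorted

namespace ManySorted

variable {L : Language.{u}}

/-! ### Patterns indexed by linear orders -/

section SequencePatterns

variable {M : Structure.{u, u + 1} L} {ι : Type*} {σ : ι → L.Srt} {A C D : Set M.El}

theorem TypeDefinableOver.and {R R' : (∀ i, M.car (σ i)) → Prop} (h : TypeDefinableOver A σ R)
    (h' : TypeDefinableOver A σ R') : TypeDefinableOver A σ fun x => R x ∧ R' x := by
  obtain ⟨p, hp, hR⟩ := h
  obtain ⟨p', hp', hR'⟩ := h'
  refine ⟨p ∪ p', fun P hP => hP.elim (hp P) (hp' P), fun x => ?_⟩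
  simp only [hR, hR', Set.mem_union, or_imp, forall_and]

theorem typeDefinableOver_forall {κ : Type*} {R : κ → (∀ i, M.car (σ i)) → Prop}
    (h : ∀ k, TypeDefinableOver A σ (R k)) : TypeDefinableOver A σ fun x => ∀ k, R k x := by
  choose p hp hR using h
  refine ⟨⋃ k, p k, fun P hP => ?_, fun x => ?_⟩
  · obtain ⟨k, hk⟩ := Set.mem_iUnion.mp hP
    exact hp k P hk
  · simp only [hR, Set.mem_iUnion, forall_exists_index]
    exact forall_comm

theorem TypeDefinableOver.reindex {β : Type*} {f : β → ι} {R : (∀ b, M.car (σ (f b))) → Prop}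
    (h : TypeDefinableOver A (fun b => σ (f b)) R) :
    TypeDefinableOver A σ fun x => R fun b => x (f b) := by
  obtain ⟨p, hp, hR⟩ := h
  refine ⟨(fun P x => P fun b => x (f b)) '' p, ?_, fun x => ?_⟩
  · rintro _ ⟨P, hP, rfl⟩
    exact (hp P hP).reindex
  · simp [hR]

/-- A dividing pattern of type `I` for a single formula, realised by `x`. -/
def SequencePattern (q : AlgForm M σ) {I : Type*} [LinearOrder I] (x : ∀ i, M.car (σ i))
    (b : I → ∀ l, M.car (q.y l)) (C : Set M.El) : Prop :=
  ∀ i, q.Sat x (b i) ∧ (⟨q.y q.u₀, b i q.u₀⟩ : M.El) ∉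
    M.acl ((C ∪ ⋃ j : Set.Iio i, M.entries (b j)) ∪ others q.u₀ (b i))

theorem SequencePattern.comp {q : AlgForm M σ} {I J : Type*} [LinearOrder I] [LinearOrder J]
    {x : ∀ i, M.car (σ i)} {b : I → ∀ l, M.car (q.y l)} (h : SequencePattern q x b C) {f : J → I}
    (hf : StrictMono f) : SequencePattern q x (fun j => b (f j)) C := by
  refine fun j => ⟨(h (f j)).1, fun hmem => (h (f j)).2 (acl_mono ?_ hmem)⟩
  refine Set.union_subset_union_left _ (Set.union_subset_union_right _ ?_)
  exact Set.iUnion_subset fun k =>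
    Set.subset_iUnion (fun i : Set.Iio (f j) => M.entries (b i)) ⟨f k, hf k.2⟩

theorem Pattern.exists_sequence {q : AlgForm M σ} {N : ℕ} {x : ∀ i, M.car (σ i)}
    (h : Pattern {q} N x C) : ∃ b : Fin N → ∀ l, M.car (q.y l), SequencePattern q x b C := by
  induction N generalizing C with
  | zero => exact ⟨fun i => i.elim0, fun i => i.elim0⟩
  | succ N ih =>
    obtain ⟨_, rfl, b, h1, h2, h3⟩ := h
    obtain ⟨c, hc⟩ := ih h3
    refine ⟨Fin.cons b c, fun i => ?_⟩
    refine Fin.cases ?_ (fun i => ?_) i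
    · refine ⟨h1, fun hmem => h2 (acl_mono ?_ hmem)⟩
      refine Set.union_subset_union_left _ (Set.union_subset subset_rfl ?_)
      exact Set.iUnion_subset fun j => absurd j.2 (Fin.not_lt_zero _)
    · refine ⟨(hc i).1, fun hmem => (hc i).2 (acl_mono ?_ hmem)⟩
      refine Set.union_subset_union_left _ ?_
      refine Set.union_subset (Set.subset_union_left.trans Set.subset_union_left)
        (Set.iUnion_subset fun ⟨j, hj⟩ => ?_)
      revert hj
      refine Fin.cases (fun _ => Set.subset_union_right.trans Set.subset_union_left)
        (fun j hj => ?_) j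
      exact (Set.subset_iUnion (fun j : Set.Iio i => M.entries (c j))
        ⟨j, Fin.succ_lt_succ_iff.mp hj⟩).trans Set.subset_union_right

theorem SequencePattern.pattern {q : AlgForm M σ} {N : ℕ} {x : ∀ i, M.car (σ i)}
    {b : Fin N → ∀ l, M.car (q.y l)} (h : SequencePattern q x b C) : Pattern {q} N x C := by
  induction N generalizing C with
  | zero => trivial
  | succ N ih =>
    refine ⟨q, rfl, b 0, (h 0).1, fun hmem => (h 0).2 (acl_mono
      (Set.union_subset_union_left _ Set.subset_union_left) hmem), ih (b := fun i => b i.succ) ?_⟩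
    refine fun i => ⟨(h i.succ).1, fun hmem => (h i.succ).2 (acl_mono ?_ hmem)⟩
    refine Set.union_subset_union_left _ (Set.union_subset (Set.union_subset_union_right _ ?_)
      ((Set.iUnion_subset fun j => ?_).trans Set.subset_union_right))
    · exact Set.subset_iUnion (fun j : Set.Iio i.succ => M.entries (b j)) ⟨0, Fin.succ_pos i⟩
    · exact Set.subset_iUnion (fun j : Set.Iio i.succ => M.entries (b j))
        ⟨j.1.succ, Fin.succ_lt_succ_iff.mpr j.2⟩

/-- Finite patterns give patterns of all order types. -/
theorem exists_sequencePattern (hM : IsSaturatedHomogeneous M) [Small.{u} ι] (hA : Small.{u} A)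
    {q : AlgForm M σ} {Q : (∀ i, M.car (σ i)) → Prop} (hQ : TypeDefinableOver A σ Q)
    (h : ∀ N, ∃ x, Q x ∧ ∃ b : Fin N → ∀ l, M.car (q.y l), SequencePattern q x b ∅)
    (I : Type*) [LinearOrder I] [Small.{u} I] :
    ∃ x, Q x ∧ ∃ b : I → ∀ l, M.car (q.y l), SequencePattern q x b ∅ := by
  classical
  -- One tuple of variables holds x and the whole sequence; `f F i` lists the coordinates,
  -- restricted to indices in F, over which the i-th distinguished element must not be algebraic.
  let τ : ι ⊕ (I × Fin q.n) → L.Srt := Sum.elim σ fun p => q.y p.2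
  let f : (F : Finset I) → (i : I) → {l // l ≠ q.u₀} ⊕ ({j // j ∈ F ∧ j < i} × Fin q.n) →
      ι ⊕ (I × Fin q.n) := fun F i => Sum.elim (fun l => .inr (i, l)) fun p => .inr (p.1, p.2)
  let T : (z : ∀ k, M.car (τ k)) → I → ∀ l, M.car (q.y l) := fun z i l => z (.inr (i, l))
  let R : Finset I → (∀ k, M.car (τ k)) → Prop := fun F z =>
    Q (fun i => z (.inl i)) ∧ ∀ i : F, q.Sat (fun i => z (.inl i)) (T z i) ∧
      (⟨τ (.inr (i.1, q.u₀)), z (.inr (i.1, q.u₀))⟩ : M.El) ∉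
        M.acl (∅ ∪ M.entries fun c => z (f F i c))
  have hR : ∀ F, TypeDefinableOver A τ (R F) := fun F => by
    refine (hQ.reindex (σ := τ) (f := Sum.inl)).and (typeDefinableOver_forall fun i => ?_)
    refine TypeDefinableOver.and ?_
      ((typeDefinableOver_notMem_acl (f F i) _).mono (Set.empty_subset _))
    refine DefinableOver.typeDefinableOver (Definable.over ?_ A)
    refine ((definable_realize (M := M) q.φ).subst (τ := τ) (fun z => match z with
      | .inl i => .var (σ := τ) (.inl i)
      | .inr l => .var (σ := τ) (.inr (i.1, l)))).congr fun z => ?_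
    refine iff_of_eq (congrArg _ (funext fun c => ?_))
    rcases c with c | c <;> rfl
  have hmono : ∀ {F G : Finset I} {z}, F ⊆ G → R G z → R F z := by
    intro F G z hFG hG
    refine ⟨hG.1, fun i => ⟨(hG.2 ⟨i, hFG i.2⟩).1, fun hmem => (hG.2 ⟨i, hFG i.2⟩).2
      (acl_mono (Set.union_subset_union_right _ ?_) hmem)⟩⟩
    rintro _ ⟨l | ⟨j, l⟩, rfl⟩
    · exact ⟨.inl l, rfl⟩
    · exact ⟨.inr (⟨j.1, hFG j.2.1, j.2.2⟩, l), rfl⟩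
  have hfin : ∀ F, ∃ z, R F z := fun F => by
    obtain ⟨x, hx, b, hb⟩ := h F.card
    let e := F.orderIsoOfFin rfl
    let c : I → ∀ l, M.car (q.y l) := fun i =>
      if hi : i ∈ F then b (e.symm ⟨i, hi⟩) else fun l => (M.nonempty _).some
    have hc : ∀ i : F, c i = b (e.symm i) := fun i => dif_pos i.2
    refine ⟨fun k => match k with
      | .inl i => x i
      | .inr p => c p.1 p.2, hx, fun i => ⟨?_, fun hmem => ?_⟩⟩
    · change q.Sat x (c i)
      rw [hc i]
      exact (hb (e.symm i)).1
    · have hbi := (hb (e.symm i)).2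
      rw [← hc i] at hbi
      refine hbi (acl_mono (Set.union_subset (Set.empty_subset _) ?_) hmem)
      rintro _ ⟨l | ⟨j, l⟩, rfl⟩
      · exact Or.inr ⟨l, rfl⟩
      · have hj : e.symm ⟨j.1, j.2.1⟩ < e.symm i := e.symm.lt_iff_lt.mpr j.2.2
        refine Or.inl (Or.inr (Set.mem_iUnion.mpr ⟨⟨_, hj⟩, ?_⟩))
        change _ ∈ M.entries (b (e.symm ⟨j.1, j.2.1⟩))
        rw [← hc ⟨j.1, j.2.1⟩]
        exact ⟨l, rfl⟩
  obtain ⟨z, hz⟩ := hM.compactness hA R hR fun s hs => by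
    obtain ⟨z, hz⟩ := hfin (hs.toFinset.sup id)
    exact ⟨z, fun F hF => hmono (Finset.le_sup (f := id) (hs.mem_toFinset.mpr hF)) hz⟩
  refine ⟨fun i => z (.inl i), (hz ∅).1, T z, fun i => ⟨((hz {i}).2 ⟨i, by simp⟩).1, fun hmem => ?_⟩⟩
  obtain ⟨A₀, hA₀, hfinA, hmem⟩ := exists_finite_mem_acl hmem
  -- Algebraicity would use finitely many parameters, all of which occur in the condition for a
  -- large enough finite set of indices.
  have hex : ∀ a : A₀, ∃ F : Finset I, ∀ G, F ⊆ G → a.1 ∈ M.entries fun c => z (f G i c) := by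
    rintro ⟨a, ha⟩
    rcases hA₀ ha with (h0 | h0) | ⟨l, rfl⟩
    · exact absurd h0 (Set.notMem_empty _)
    · obtain ⟨j, l, rfl⟩ := Set.mem_iUnion.mp h0
      exact ⟨{j.1}, fun G hG => ⟨.inr (⟨j, hG (by simp), j.2⟩, l), rfl⟩⟩
    · exact ⟨∅, fun G _ => ⟨.inl l, rfl⟩⟩
  choose F hF using hex
  have := hfinA.fintype
  refine ((hz (insert i (Finset.univ.sup F))).2 ⟨i, by simp⟩).2 (acl_mono ?_ hmem)
  rintro a ha
  exact Or.inr (hF ⟨a, ha⟩ _ ((Finset.le_sup (f := F) (Finset.mem_univ _)).trans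
    (Finset.subset_insert _ _)))

end SequencePatterns

/-! ### Dividing for pairs in Ξ_M as non-algebraicity -/

section Ranks

variable {M : Structure.{u, u + 1} L} {m : ℕ} {x : Fin m → L.Srt}

theorem InconsistencyPair.hasFewSolutions (q : InconsistencyPair M x) {u₀ : Fin q.n}
    (hu : ∀ b : (j : Fin q.k × Fin q.n) → M.car (q.y j.2), q.ψ.Realize M b ↔
      ∀ i j : Fin q.k, i < j → b (i, u₀) ≠ b (j, u₀) ∧ ∀ l : Fin q.n, l ≠ u₀ → b (i, l) = b (j, l)) :
    HasFewSolutions M u₀ q.k q.φ := by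
  intro a b hb hbb
  by_contra! hcon
  exact q.inconsistent ⟨a, fun j => b j.1 j.2, hb,
    (hu _).mpr fun i j hij => ⟨hcon i j hij, fun l hl => hbb i j l hl⟩⟩

/-- A dividing sequence varies u while keeping v constant, so it exhibits infinitely many conjugates
of u over C and v; conversely, a non-algebraic u has infinitely many such conjugates. -/
theorem InconsistencyPair.divides_iff (hM : IsSaturatedHomogeneous M) (q : InconsistencyPair M x)
    {u₀ : Fin q.n} (hu : ∀ b : (j : Fin q.k × Fin q.n) → M.car (q.y j.2), q.ψ.Realize M b ↔
      ∀ i j : Fin q.k, i < j → b (i, u₀) ≠ b (j, u₀) ∧ ∀ l : Fin q.n, l ≠ u₀ → b (i, l) = b (j, l))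
    (hk : 2 ≤ q.k) {b : ∀ l, M.car (q.y l)} {C : Set M.El} (hC : Small.{u} C) :
    q.Divides b C ↔ (⟨q.y u₀, b u₀⟩ : M.El) ∉ M.acl (C ∪ others u₀ b) := by
  constructor
  · rintro ⟨c, hc, hψ⟩ hmem
    have hpair : ∀ i j, i < j → c i u₀ ≠ c j u₀ ∧ ∀ l ≠ u₀, c i l = c j l := by
      intro i j hij
      -- Any pair i < j is completed to a strictly increasing map on all k indices, so that ψ can be
      -- read off for that pair.
      have hf1 : StrictMono fun t : Fin q.k => if t.1 = 0 then i else if t.1 = 1 then j else j + t.1 := by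
        intro s t hst
        have : s.1 < t.1 := hst
        dsimp only
        split_ifs <;> omega
      have h1 := (hu _).mp (hψ _ hf1) ⟨0, by omega⟩ ⟨1, by omega⟩ (Fin.mk_lt_mk.mpr one_pos)
      simpa using h1
    obtain ⟨g, hg, hgb⟩ := hM.exists_automorphism hC (hc 0)
    have hmem₀ := g.act_mem_acl hmem
    have he : g.act ⟨q.y u₀, b u₀⟩ = ⟨q.y u₀, c 0 u₀⟩ :=
      congrArg (Sigma.mk _) (congrFun hgb u₀)
    rw [Set.image_union, Automorphism.image_eq_self hg, ← others_map, hgb, he] at hmem₀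
    obtain ⟨Q, hQ, h1, h2⟩ := mem_acl_union_entries.mp hmem₀
    have hQ' := hQ.subst (τ := q.y) (fun z => match z with
      | .inl _ => .var u₀
      | .inr l => .var l.1)
    have hjoin : ∀ z : ∀ l, M.car (q.y l), (fun k : Unit ⊕ {l // l ≠ u₀} =>
        Term.value M z (match k with
          | .inl _ => .var u₀
          | .inr l => .var l.1 : Term L q.y (Sum.elim (fun _ => q.y u₀)
            (fun l : {l // l ≠ u₀} => q.y l) k))) = join M (fun _ : Unit => z u₀)
          fun l : {l // l ≠ u₀} => z l.1 := by
      intro z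
      funext k
      rcases k with k | k <;> rfl
    have h3 : ∀ i, c i u₀ ∈ {t | Q (join M (fun _ => t) fun l : {l // l ≠ u₀} => c 0 l)} := by
      intro i
      have h4 := (sameType_iff.mp (hc i) _ hQ').mp ((sameType_iff.mp (hc 0) _ hQ').mpr
        ((iff_of_eq (congrArg Q (hjoin (c 0)))).mpr h1))
      have h5 := (iff_of_eq (congrArg Q (hjoin (c i)))).mp h4
      have h6 : (fun l : {l // l ≠ u₀} => c i l) = fun l : {l // l ≠ u₀} => c 0 l := by
        funext l
        rcases Nat.eq_zero_or_pos i with rfl | hi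
        · rfl
        · exact ((hpair 0 i hi).2 l l.2).symm
      rwa [h6] at h5
    refine Set.infinite_of_injective_forall_mem (fun i j hij => ?_) h3 h2
    by_contra hne
    rcases Ne.lt_or_gt hne with h | h
    · exact (hpair i j h).1 hij
    · exact (hpair j i h).1 hij.symm
  · intro hmem
    let S : Set (M.car (q.y u₀)) := {t | ∃ g : Automorphism M, (∀ e ∈ C ∪ others u₀ b, g.act e = e) ∧
      g.perm _ (b u₀) = t}
    have hsm : Small.{u} (others u₀ b) := small_subset (others_subset _ _)
    -- A finite orbit would be a small set out of whose algebraic closure u can be moved, a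
    -- contradiction.
    have hS : S.Infinite := by
      intro hfin
      have := (hfin.image (Sigma.mk (q.y u₀))).to_subtype
      have h1 : Small.{u} ↥(Sigma.mk (q.y u₀) '' S) := inferInstance
      obtain ⟨g, hg, hgu⟩ := hM.exists_act_notMem_acl (small_union _ _) h1 hmem
      exact hgu (subset_acl ⟨_, ⟨g, hg, rfl⟩, rfl⟩)
    let t := hS.natEmbedding
    refine ⟨fun i => Function.update b u₀ (t i), fun i => ?_, fun f hf => ?_⟩
    · obtain ⟨g, hg, hgt⟩ := (t i).2
      have h1 : g.map b = Function.update b u₀ (t i) := by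
        funext l
        by_cases hl : l = u₀
        · subst hl
          rw [Function.update_self]
          exact hgt
        · rw [Function.update_of_ne hl]
          exact congrFun (g.map_eq_self (x := fun l : {l // l ≠ u₀} => b l)
            fun e he => hg e (Or.inr he)) ⟨l, hl⟩
      change M.SameType C b (Function.update b u₀ (t i))
      rw [← h1]
      exact sameType_map (fun e he => hg e (Or.inl he)) b
    · refine (hu _).mpr fun i j hij => ⟨fun h => ?_, fun l hl => ?_⟩
      · simp only [Function.update_self] at h
        exact (hf hij).ne (t.injective (Subtype.ext h))
      · simp [Function.update_of_ne hl]

end Ranks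

end ManySorted

namespace ManySorted

variable {L : Language.{u}} {M : Structure.{u, u + 1} L}

/-! ### Finite ranks are bounded patterns -/

section Ranks

variable {m : ℕ} {x : Fin m → L.Srt}

theorem InconsistencyPair.Divides.mono {q : InconsistencyPair M x} {b : ∀ l, M.car (q.y l)}
    {C D : Set M.El} (h : q.Divides b D) (hCD : C ⊆ D) : q.Divides b C := by
  obtain ⟨c, hc, hψ⟩ := h
  exact ⟨c, fun i => sameType_mono (hc i) hCD, hψ⟩

theorem IsDividingPattern.comp {q : InconsistencyPair M x} {C : Set M.El}
    {p : Set (M.FormulaOver C x)} {I J : Type*} [LinearOrder I] [LinearOrder J]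
    (h : IsDividingPattern p fun _ : I => q) {f : J → I} (hf : StrictMono f) :
    IsDividingPattern p fun _ : J => q := by
  obtain ⟨b, hb, hdiv⟩ := h
  refine ⟨fun j => b (f j), fun p₀ J₀ hp₀ hfin hJ₀ => ?_, fun j => (hdiv (f j)).mono ?_⟩
  · obtain ⟨a, h1, h2⟩ := hb p₀ (f '' J₀) hp₀ hfin (hJ₀.image f)
    exact ⟨a, h1, fun j hj => h2 _ ⟨j, hj, rfl⟩⟩
  · refine Set.union_subset_union_right _ (Set.iUnion_subset fun k => ?_)
    exact Set.subset_iUnion (fun i : Set.Iio (f j) => M.entries (b i)) ⟨f k, hf k.2⟩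

/-- Patterns of every order type include all finite lengths, and a supremum of naturals in `ℕ∞` is
finite exactly when they are bounded; so both branches of the rank fit one criterion. -/
theorem rankD_singleton_lt_top_iff {q : InconsistencyPair M x} {C : Set M.El}
    {p : Set (M.FormulaOver C x)} : rankD {q} p < ⊤ ↔
      ∃ N : ℕ, ∀ n : ℕ, IsDividingPattern p (fun _ : Fin n => q) → n ≤ N := by
  have hconst : ∀ {I : Type u} [LinearOrder I], (∃ ξ : I → InconsistencyPair M x,
      (∀ i, ξ i ∈ ({q} : Set _)) ∧ IsDividingPattern p ξ) ↔ IsDividingPattern p fun _ : I => q := by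
    intro I _
    refine ⟨?_, fun h => ⟨_, fun _ => rfl, h⟩⟩
    rintro ⟨ξ, hξ, h⟩
    obtain rfl : ξ = fun _ => q := funext hξ
    exact h
  have hconst' : ∀ n, (∃ ξ : Fin n → InconsistencyPair M x,
      (∀ i, ξ i ∈ ({q} : Set _)) ∧ IsDividingPattern p ξ) ↔
      IsDividingPattern p fun _ : Fin n => q := by
    intro n
    refine ⟨?_, fun h => ⟨_, fun _ => rfl, h⟩⟩
    rintro ⟨ξ, hξ, h⟩
    obtain rfl : ξ = fun _ => q := funext hξ
    exact h
  unfold rankD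
  simp only [hconst, hconst']
  split_ifs with hall
  · simp only [lt_self_iff_false, false_iff, not_exists, not_forall]
    intro N
    exact ⟨N + 1, (hconst.mp (hall (ULift (Fin (N + 1))))).comp (f := ULift.up) fun _ _ h => h,
      by omega⟩
  · constructor
    · intro hlt
      obtain ⟨N, hN⟩ := ENat.ne_top_iff_exists.mp hlt.ne
      refine ⟨N, fun n hn => ?_⟩
      have : (n : ℕ∞) ≤ N := by
        rw [hN]
        exact le_sSup ⟨n, rfl, hn⟩
      exact_mod_cast this
    · rintro ⟨N, hN⟩
      refine lt_of_le_of_lt (sSup_le (a := (N : ℕ∞)) ?_) (ENat.natCast_lt_top N)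
      rintro _ ⟨n, rfl, hn⟩
      exact_mod_cast hN n hn

theorem hasBoundedPatterns_of_finiteXiMRanks (hM : IsSaturatedHomogeneous M)
    (h : FiniteXiMRanks M) : HasBoundedPatterns M := by
  intro m σ q
  have hdef : Definable M (fun j : Fin q.k × Fin q.n => q.y j.2) fun b =>
      ∀ p : {p : Fin q.k × Fin q.k // p.1 < p.2}, ¬ b (p.1.1, q.u₀) = b (p.1.2, q.u₀) ∧
        ∀ l : {l // l ≠ q.u₀}, b (p.1.1, l) = b (p.1.2, l) := by
    refine definable_forall_finite _ fun p => Definable.and (Definable.not ?_)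
      (definable_forall_finite _ fun l => ?_)
    · exact definable_equal (σ := fun j : Fin q.k × Fin q.n => q.y j.2) (s := q.y q.u₀)
        (.var (σ := fun j : Fin q.k × Fin q.n => q.y j.2) (p.1.1, q.u₀))
        (.var (σ := fun j : Fin q.k × Fin q.n => q.y j.2) (p.1.2, q.u₀))
    · exact definable_equal (σ := fun j : Fin q.k × Fin q.n => q.y j.2) (s := q.y l)
        (.var (σ := fun j : Fin q.k × Fin q.n => q.y j.2) (p.1.1, l.1))
        (.var (σ := fun j : Fin q.k × Fin q.n => q.y j.2) (p.1.2, l.1))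
  obtain ⟨ψ, hψ⟩ := hdef
  have hψ' : ∀ b : (j : Fin q.k × Fin q.n) → M.car (q.y j.2), ψ.Realize M b ↔
      ∀ i j : Fin q.k, i < j →
        b (i, q.u₀) ≠ b (j, q.u₀) ∧ ∀ l : Fin q.n, l ≠ q.u₀ → b (i, l) = b (j, l) := by
    intro b
    rw [hψ]
    exact ⟨fun h i j hij => ⟨(h ⟨(i, j), hij⟩).1, fun l hl => (h ⟨(i, j), hij⟩).2 ⟨l, hl⟩⟩,
      fun h p => ⟨(h _ _ p.2).1, fun l => (h _ _ p.2).2 l l.2⟩⟩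
  let q' : InconsistencyPair M σ := ⟨q.n, q.y, q.k, q.φ, ψ, by
    rintro ⟨a, b, hb, hb'⟩
    rw [hψ'] at hb'
    obtain ⟨i, j, hij, he⟩ := q.few a (fun i l => b (i, l)) hb fun i j l hl => by
      rcases lt_trichotomy i j with hij | rfl | hij
      · exact (hb' i j hij).2 l hl
      · rfl
      · exact ((hb' j i hij).2 l hl).symm
    exact (hb' i j hij).1 he⟩
  obtain ⟨N, hN⟩ := rankD_singleton_lt_top_iff.mp (h m σ q' ⟨q.u₀, hψ'⟩)
  refine ⟨N + 1, fun a ha => ?_⟩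
  obtain ⟨b, hb⟩ := ha.exists_sequence
  have := hN (N + 1) ⟨b, fun p₀ I₀ hp₀ _ _ => ⟨a, fun θ hθ => absurd (hp₀ hθ) (Set.notMem_empty _),
    fun i _ => (hb i).1⟩, fun i => ?_⟩
  · omega
  · have hsm : Small.{u} ↥(∅ ∪ ⋃ j : Set.Iio i, M.entries (b j)) := small_union _ _
    exact (q'.divides_iff hM (u₀ := q.u₀) hψ' q.two_le hsm).mpr (hb i).2

theorem finiteXiMRanks_of_hasBoundedPatterns (hM : IsSaturatedHomogeneous M)
    (h : HasBoundedPatterns M) : FiniteXiMRanks M := by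
  rintro m x q ⟨u₀, hu⟩
  rw [rankD_singleton_lt_top_iff]
  rcases Nat.lt_or_ge q.k 2 with hk | hk
  · refine ⟨0, fun n hn => ?_⟩
    by_contra! hpos
    obtain ⟨b, hb, -⟩ := hn
    obtain ⟨a, -, ha⟩ := hb ∅ {⟨0, hpos⟩} subset_rfl Set.finite_empty (Set.finite_singleton _)
    refine q.inconsistent ⟨a, fun j => b ⟨0, hpos⟩ j.2, fun _ => ha _ rfl, (hu _).mpr ?_⟩
    intro i j hij
    have := Fin.lt_def.mp hij
    omega
  · let q' : AlgForm M x := ⟨q.n, q.y, u₀, q.k, hk, q.φ, q.hasFewSolutions hu⟩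
    obtain ⟨N, hN⟩ := h m x q'
    refine ⟨N, fun n hn => ?_⟩
    by_contra! hlt
    obtain ⟨b, hb, hdiv⟩ := hn
    obtain ⟨a, -, ha⟩ := hb ∅ Set.univ subset_rfl Set.finite_empty Set.finite_univ
    refine hN a (Pattern.of_le (SequencePattern.pattern (q := q') (b := b) fun i => ⟨ha i trivial, ?_⟩)
      hlt.le)
    have hsm : Small.{u} ↥(∅ ∪ ⋃ j : Set.Iio i, M.entries (b j)) := small_union _ _
    exact (q.divides_iff hM hu hk hsm).mp (hdiv i)

theorem finiteXiMRanks_iff (hM : IsSaturatedHomogeneous M) :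
    FiniteXiMRanks M ↔ HasBoundedPatterns M :=
  ⟨hasBoundedPatterns_of_finiteXiMRanks hM, finiteXiMRanks_of_hasBoundedPatterns hM⟩

end Ranks

/-! ### Consequences of unbounded patterns -/

section Unbounded

theorem exists_sequencePattern_nat (hM : IsSaturatedHomogeneous M) (h : ¬ HasBoundedPatterns M) :
    ∃ (m : ℕ) (σ : Fin m → L.Srt) (q : AlgForm M σ) (x : ∀ i, M.car (σ i))
      (b : ℕ → ∀ l, M.car (q.y l)), SequencePattern q x b ∅ := by
  unfold HasBoundedPatterns at h
  push Not at h
  obtain ⟨m, σ, q, h⟩ := h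
  obtain ⟨x, -, b, hb⟩ := exists_sequencePattern hM (A := ∅) inferInstance (q := q)
    (Q := fun _ => True) (definable_true.over _).typeDefinableOver (fun N => by
      obtain ⟨x, hx⟩ := h N
      exact ⟨x, trivial, hx.exists_sequence⟩) ℕ
  exact ⟨m, σ, q, x, b, hb⟩

/-- In a pattern longer than κ in cofinality, a base of fewer than κ elements lies below some index
i, and the i-th tuple then contradicts M-independence over it. -/
theorem hasBoundedPatterns_of_localCharacter (hM : IsSaturatedHomogeneous M)
    (h : LocalCharacter (MInd M)) : HasBoundedPatterns M := by
  by_contra hcon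
  obtain ⟨m, σ, q, x, b, hb⟩ := exists_sequencePattern_nat hM hcon
  obtain ⟨κ, hκ⟩ := h (M.entries x) inferInstance
  let I : Type u := (Order.succ (max κ Cardinal.aleph0)).ord.ToType
  have hcof : κ < Order.cof I := by
    rw [Ordinal.cof_toType, (Cardinal.isRegular_succ (le_max_right _ _)).cof_ord]
    exact (le_max_left κ _).trans_lt (Order.lt_succ _)
  -- Prescribing the type of x over its own entries keeps x, on which κ depends, while the sequence
  -- is lengthened.
  obtain ⟨x', hx', c, hc⟩ := exists_sequencePattern hM (A := M.entries x) inferInstance (q := q)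
    (Q := fun x' => M.SameType (M.entries x) x x') (typeDefinableOver_sameType x)
    (fun N => ⟨x, fun _ => Iff.rfl, _, hb.comp (f := fun i : Fin N => i.1) fun _ _ h => h⟩) I
  obtain ⟨g, hg, rfl⟩ := hM.exists_automorphism inferInstance hx'
  rw [g.map_eq_self hg] at hc
  obtain ⟨C, hC, hcard, hind⟩ := hκ (⋃ i, M.entries (c i)) inferInstance
  choose f hf using fun e : C => Set.mem_iUnion.mp (hC e.2)
  have hrange : Cardinal.mk (Set.range f) < Order.cof I := by
    refine lt_of_lt_of_le ?_ hcof.le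
    have h1 := Cardinal.mk_range_le_lift (f := f)
    rw [Cardinal.lift_id'.{u, u + 1}] at h1
    exact Cardinal.lift_lt.mp (h1.trans_lt hcard)
  have hnot : ¬ IsCofinal (Set.range f) := fun hcf => absurd (Order.cof_le hcf) (not_le.mpr hrange)
  obtain ⟨i, hi⟩ : ∃ i, ∀ e, f e < i := by
    unfold IsCofinal at hnot
    push Not at hnot
    obtain ⟨i, hi⟩ := hnot
    exact ⟨i, fun e => hi _ ⟨e, rfl⟩⟩
  have hCi : C ⊆ ⋃ j : Set.Iio i, M.entries (c j) := fun e he =>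
    Set.mem_iUnion.mpr ⟨⟨f ⟨e, he⟩, hi _⟩, hf ⟨e, he⟩⟩
  refine (hc i).2 (acl_mono ?_ (hind.mem_acl (b := c i) (u₀ := q.u₀) ?_ (hc i).1.mem_acl))
  · exact Set.union_subset_union_left _ (hCi.trans Set.subset_union_right)
  · exact ((Set.subset_iUnion (fun i => M.entries (c i)) i).trans Set.subset_union_left).trans
      subset_acl

/-- Limits of sequences along an ultrafilter. -/
theorem exists_limit (hM : IsSaturatedHomogeneous M) {n : ℕ} {y : Fin n → L.Srt}
    (b : ℕ → ∀ l, M.car (y l)) (U : Ultrafilter ℕ) {E : Set M.El} (hE : Small.{u} E) :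
    ∃ b' : ∀ l, M.car (y l), ∀ P, DefinableOver E y P →
      (P b' ↔ ∀ᶠ i in (U : Filter ℕ), P (b i)) := by
  obtain ⟨b', hb'⟩ := hM.exists_realizesLimit hE (U.map b)
  refine ⟨b', fun P hP => ⟨fun h => ?_, fun h => hb' P hP h⟩⟩
  by_contra hn
  exact hb' _ hP.not (Ultrafilter.eventually_not.mpr hn) h

/-- A limit c of an infinite pattern is independent from x over the pattern. In the reversed
direction its distinguished element would be algebraic over finitely many earlier tuples and its
other entries, and so would that of some late tuple. -/
theorem hasBoundedPatterns_of_thornInd_mInd (hM : IsSaturatedHomogeneous M)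
    (h : ∀ A B C : Set M.El, Small.{u} A → Small.{u} B → Small.{u} C →
      ThornInd M A C B → MInd M B C A) : HasBoundedPatterns M := by
  by_contra hcon
  obtain ⟨m, σ, q, x, b, hb⟩ := exists_sequencePattern_nat hM hcon
  let C : Set M.El := ⋃ i, M.entries (b i)
  have hC : Small.{u} C := inferInstance
  let U : Ultrafilter ℕ := Filter.hyperfilter ℕ
  obtain ⟨c, hc⟩ := exists_limit hM b U (E := M.entries x ∪ C) (small_union _ _)
  -- Over any larger set the type of c extends to a limit type. A formula with parameters that holds
  -- of the limit holds of some `b i`, and the entries of `b i` lie in C.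
  have hthorn : ThornInd M (M.entries c) C (M.entries x) := by
    intro B' hB' hBB
    obtain ⟨c', hc'⟩ := exists_limit hM b U (E := M.acl (B' ∪ C)) inferInstance
    have hsub : M.entries x ∪ C ⊆ M.acl (B' ∪ C) :=
      (Set.union_subset_union_left _ hBB).trans subset_acl
    obtain ⟨g, hg, rfl⟩ := hM.exists_automorphism (small_union (M.entries x) C)
      (sameType_iff.mpr fun P hP => (hc P hP).trans (hc' P (hP.mono hsub)).symm)
    refine ⟨_, ⟨g, hg, (g.entries_map c).symm⟩, mInd_entries hM hB' hC fun r d hd hsat => ?_⟩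
    obtain ⟨i, hi⟩ := ((hc' _ (r.definableOver_sat hd)).mp hsat).exists
    exact acl_mono (Set.union_subset_union_left _
      (Set.subset_iUnion (fun i => M.entries (b i)) i)) hi.mem_acl
  have hind := h _ _ _ inferInstance inferInstance hC hthorn
  have hsat : q.Sat x c := by
    have hdef : DefinableOver (M.entries x ∪ C) q.y fun c => q.Sat x c := by
      have h1 := (definable_realize (M := M) q.φ).subst (τ := Sum.elim q.y σ) (fun z => match z with
        | .inl i => .var (σ := Sum.elim q.y σ) (.inr i)
        | .inr l => .var (σ := Sum.elim q.y σ) (.inl l))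
      refine (h1.definableOver x Set.subset_union_left).congr fun c => ?_
      refine iff_of_eq (congrArg _ (funext fun z => ?_))
      rcases z with z | z <;> rfl
    exact (hc _ hdef).mpr (Filter.Eventually.of_forall fun i => (hb i).1)
  have hmem := hind.mem_acl (b := c) (u₀ := q.u₀) (Set.subset_union_left.trans subset_acl)
    hsat.mem_acl
  obtain ⟨A₀, hA₀, hfin, hmem⟩ := exists_finite_mem_acl hmem
  have hD : (A₀ ∩ C).Finite := hfin.inter_of_left C
  replace hmem : (⟨q.y q.u₀, c q.u₀⟩ : M.El) ∈ M.acl ((A₀ ∩ C) ∪ others q.u₀ c) :=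
    acl_mono (fun e he => (hA₀ he).imp (fun h => ⟨he, h⟩) id) hmem
  obtain ⟨P, hP, hPc, hPz⟩ := exists_definableOver_of_mem_acl
    (f := fun l : {l // l ≠ q.u₀} => l.1) c q.u₀ hmem
  have hev := (hc P (hP.mono (Set.inter_subset_right.trans Set.subset_union_right))).mp hPc
  choose f hf using fun e : ↥(A₀ ∩ C) => Set.mem_iUnion.mp e.2.2
  have := hD.to_subtype
  obtain ⟨N, hN⟩ := (Set.finite_range f).bddAbove
  -- The ultrafilter is non-principal, so an index beyond all those supplying the finitely many
  -- parameters can be chosen.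
  have hlarge : ∀ᶠ i in (U : Filter ℕ), N < i := by
    have h1 : ∀ᶠ i in (Filter.cofinite : Filter ℕ), N < i := by
      rw [Nat.cofinite_eq_atTop]
      exact Filter.eventually_gt_atTop N
    exact Filter.hyperfilter_le_cofinite h1
  obtain ⟨i, hPi, hNi⟩ := (hev.and hlarge).exists
  refine (hb i).2 (acl_mono (Set.union_subset_union_left _ ?_) (hPz (b i) hPi))
  intro e he
  refine Or.inr (Set.mem_iUnion.mpr ⟨⟨f ⟨e, he⟩, ?_⟩, hf ⟨e, he⟩⟩)
  exact (hN ⟨⟨e, he⟩, rfl⟩).trans_lt hNi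

end Unbounded

/-! ### The cycle of implications -/

section Equivalence

/-- Characterisations of the theories in which thorn-forking is an independence relation. -/
theorem IsSaturatedHomogeneous.tfae (hM : IsSaturatedHomogeneous M) :
    List.TFAE [
      IsIndependenceRelation (ThornInd M),
      LocalCharacter (ThornInd M),
      LocalCharacter (MInd M),
      FiniteXiMRanks M,
      ∀ A B C : Set M.El, Small.{u} A → Small.{u} B → Small.{u} C →
        ThornInd M A C B → ThornInd M B C A,
      ∀ A B C : Set M.El, Small.{u} A → Small.{u} B → Small.{u} C →
        ThornInd M A C B → MInd M B C A,
      ∃ R : TernaryRel M, IsStrictIndependenceRelation R] := by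
  tfae_have 1 → 2 := fun h => h.localCharacter
  tfae_have 2 → 3 := fun h A hA => by
    obtain ⟨κ, hκ⟩ := h A hA
    refine ⟨κ, fun B hB => ?_⟩
    obtain ⟨C, hC, hcard, hind⟩ := hκ B hB
    exact ⟨C, hC, hcard, hind.mInd hB⟩
  tfae_have 3 → 4 := fun h =>
    (finiteXiMRanks_iff hM).mpr (hasBoundedPatterns_of_localCharacter hM h)
  tfae_have 4 → 1 := fun h => isIndependenceRelation_thornInd hM
    (thornInd_localCharacter hM ((finiteXiMRanks_iff hM).mp h))
  tfae_have 4 → 5 := fun h _ _ _ hA hB hC =>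
    thornInd_symm hM ((finiteXiMRanks_iff hM).mp h) hA hB hC
  tfae_have 5 → 6 := fun h A B C hA hB hC hind => (h A B C hA hB hC hind).mInd hA
  tfae_have 6 → 4 := fun h =>
    (finiteXiMRanks_iff hM).mpr (hasBoundedPatterns_of_thornInd_mInd hM h)
  tfae_have 1 → 7 := fun h => ⟨_, h, thornInd_antiReflexivity⟩
  tfae_have 7 → 2 := fun ⟨R, hR⟩ A hA => by
    obtain ⟨κ, hκ⟩ := hR.localCharacter A hA
    refine ⟨κ, fun B hB => ?_⟩
    obtain ⟨C, hC, hcard, hind⟩ := hκ B hB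
    exact ⟨C, hC, hcard, hR.thornInd hA hB (small_subset hC) hind⟩
  tfae_finish

end Equivalence

end ManySorted

namespace ManySorted

variable {L : Language.{u}} {M : Structure.{u, u + 1} L}

/-! ### Translating M^eq into M through representatives -/

section Representatives

/-- The index set of the tuples that represent the elements of a sort of `M^eq`. -/
def RepIndex : L.Srt ⊕ ImaginarySort M → Type
  | .inl _ => Unit
  | .inr S => Fin S.n

/-- The sorts of the tuples that represent the elements of a sort of `M^eq`. -/
def repSort : (s : L.Srt ⊕ ImaginarySort M) → RepIndex s → L.Srt
  | .inl s, _ => s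
  | .inr S, i => S.s i

/-- The element of `M^eq` that is represented by a tuple. -/
def repProj : (s : L.Srt ⊕ ImaginarySort M) → (∀ i, M.car (repSort s i)) → M.eq.car s
  | .inl _, x => x ()
  | .inr S, x => Quotient.mk S.setoid x

theorem repProj_surjective (s : L.Srt ⊕ ImaginarySort M) : Function.Surjective (repProj s) := by
  rcases s with s | S
  · exact fun a => ⟨fun _ => a, rfl⟩
  · exact Quotient.mk_surjective

theorem definable_repProj_eq (s : L.Srt ⊕ ImaginarySort M) :
    Definable M (Sum.elim (repSort s) (repSort s)) fun x =>
      repProj s (fun i => x (.inl i)) = repProj s fun i => x (.inr i) := by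
  rcases s with s | S
  · exact definable_equal
      (.var (σ := Sum.elim (repSort (M := M) (.inl s)) (repSort (.inl s))) (.inl ()))
      (.var (σ := Sum.elim (repSort (M := M) (.inl s)) (repSort (.inl s))) (.inr ()))
  · refine (definable_realize S.E).congr fun x => ?_
    refine Iff.trans (iff_of_eq (congrArg (S.E.Realize M) ?_))
      (Quotient.eq (r := S.setoid)).symm
    funext z
    rcases z with z | z <;> rfl

variable {α : Type*} {σ : α → L.Srt ⊕ ImaginarySort M}

/-- The sorts of the representatives of a tuple of elements of `M^eq`. -/
def repSorts (σ : α → L.Srt ⊕ ImaginarySort M) (z : Σ a, RepIndex (σ a)) : L.Srt :=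
  repSort (σ z.1) z.2

/-- The tuple of elements of `M^eq` with given representatives. -/
def repTuple (x : ∀ z, M.car (repSorts σ z)) (a : α) : M.eq.car (σ a) :=
  repProj (σ a) fun i => x ⟨a, i⟩

theorem repTuple_surjective : Function.Surjective (repTuple (σ := σ)) := by
  intro y
  choose x hx using fun a => repProj_surjective (σ a) (y a)
  exact ⟨fun z => x z.1 z.2, funext hx⟩

/-- No function symbol of `eqLanguage M` takes imaginary arguments, so a projection can only be the
outermost symbol of a term. -/
theorem Term.exists_rep {σ : α → (eqLanguage M).Srt} {s : (eqLanguage M).Srt}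
    (t : Term (eqLanguage M) σ s) :
    ∃ r : ∀ i, Term L (repSorts σ) (repSort s i), ∀ x,
      t.value M.eq (repTuple x) = repProj s fun i => (r i).value M x := by
  induction t with
  | var a => exact ⟨fun i => .var (σ := repSorts σ) ⟨a, i⟩, fun _ => rfl⟩
  | app f t ih =>
    choose r hr using ih
    cases f with
    | old f =>
      refine ⟨fun _ => .app f fun i => r i (), fun x => ?_⟩
      exact congrArg (M.fn f) (funext fun i => hr i x)
    | proj S =>
      refine ⟨fun i => r i (), fun x => ?_⟩
      exact congrArg (Quotient.mk S.setoid) (funext fun i => hr i x)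

/-- Equality of classes becomes the defining equivalence, and a quantifier over an imaginary sort
becomes a block of quantifiers over representatives. -/
theorem BFormula.definable_rep {σ : α → (eqLanguage M).Srt} {l : List (eqLanguage M).Srt}
    (φ : BFormula (eqLanguage M) σ l) :
    Definable M (repSorts (Sum.elim σ l.get)) fun x =>
      φ.Holds M.eq (fun a => repTuple x (.inl a)) fun i => repTuple x (.inr i) := by
  have key : ∀ {l : List (eqLanguage M).Srt} (x : ∀ z, M.car (repSorts (Sum.elim σ l.get) z)),
      join M.eq (σ := σ) (τ := l.get) (fun a => repTuple x (.inl a)) (fun i => repTuple x (.inr i)) =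
        repTuple x := by
    intro l x
    funext z
    rcases z with z | z <;> rfl
  induction φ with
  | falsum => exact definable_false
  | @equal l s t t' =>
    obtain ⟨r, hr⟩ := Term.exists_rep (σ := Sum.elim σ l.get) t
    obtain ⟨r', hr'⟩ := Term.exists_rep (σ := Sum.elim σ l.get) t'
    refine ((definable_repProj_eq s).subst (τ := repSorts (Sum.elim σ l.get)) fun z => match z with
      | .inl i => r i
      | .inr i => r' i).congr fun x => ?_
    refine iff_of_eq (congrArg₂ Eq ((hr x).symm.trans ?_) ((hr' x).symm.trans ?_))
    · exact congrArg (fun y => t.value M.eq y) (key x).symm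
    · exact congrArg (fun y => t'.value M.eq y) (key x).symm
  | @rel l n d R t =>
    choose r hr using fun i => Term.exists_rep (σ := Sum.elim σ l.get) (t i)
    cases R with
    | old R =>
      refine (definable_rel R fun i => r i ()).congr fun x => ?_
      refine iff_of_eq (congrArg (M.rel R) (funext fun i => (hr i x).symm.trans ?_))
      exact congrArg (fun y => (t i).value M.eq y) (key x).symm
  | imp φ φ' ih ih' => exact ih.imp ih'
  | @all l s φ ih =>
    let τ := Sum.elim (repSorts (Sum.elim σ l.get)) (repSort s)
    let t : ∀ z : Σ a, RepIndex (Sum.elim σ (s :: l).get a),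
        Term L τ (repSorts (Sum.elim σ (s :: l).get) z) := fun z => match z with
      | ⟨.inl a, i⟩ => .var (σ := τ) (.inl ⟨.inl a, i⟩)
      | ⟨.inr j, i⟩ => Fin.cases (motive := fun j => ∀ i : RepIndex ((s :: l).get j),
          Term L τ (repSort ((s :: l).get j) i))
          (fun i => .var (σ := τ) (.inr i)) (fun j i => .var (σ := τ) (.inl ⟨.inr j, i⟩)) j i
    refine (ih.subst (τ := τ) t).not.exists_block.not.congr fun x => ?_
    have key' : ∀ b : ∀ i, M.car (repSort s i),
        (fun i => repTuple (σ := Sum.elim σ (s :: l).get)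
          (fun z => (t z).value M (join M x b)) (.inr i)) =
        consVal M.eq (repProj s b) fun i => repTuple x (.inr i) := by
      intro b
      funext j
      refine Fin.cases ?_ (fun j => ?_) j <;> rfl
    rw [not_exists]
    refine Iff.trans ?_ (repProj_surjective s).forall.symm
    refine forall_congr' fun b => not_not.trans ?_
    exact iff_of_eq (congrArg (φ.Holds M.eq _) (key' b))

theorem Definable.rep {P : (∀ a, M.eq.car (σ a)) → Prop}
    (hP : Definable (L := eqLanguage M) M.eq σ P) :
    Definable M (repSorts σ) fun x => P (repTuple x) := by
  obtain ⟨φ, hφ⟩ := hP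
  refine (φ.definable_rep.subst (τ := repSorts σ) fun z => match z with
    | ⟨.inl a, i⟩ => .var (σ := repSorts σ) ⟨a, i⟩
    | ⟨.inr j, _⟩ => j.elim0).congr fun x => Iff.trans ?_ (hφ _)
  refine iff_of_eq (congrArg (φ.Holds M.eq (repTuple x)) ?_)
  funext j
  exact j.elim0

end Representatives

/-! ### Definable predicates of M remain definable in M^eq -/

section Inclusion

variable {α : Type*} {σ : α → L.Srt}

/-- Terms of `L` as terms of `L^eq`. -/
def Term.toEq (M : Structure.{u, u + 1} L) : {s : L.Srt} → Term L σ s →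
    Term (eqLanguage M) (fun a => (.inl (σ a) : L.Srt ⊕ ImaginarySort M)) (.inl s)
  | _, .var a => .var (L := eqLanguage M) (σ := fun a => (.inl (σ a) : L.Srt ⊕ ImaginarySort M)) a
  | _, .app f t => .app (L := eqLanguage M) (EqFn.old f) fun i => (t i).toEq M

theorem Term.value_toEq {s : L.Srt} (t : Term L σ s) (x : ∀ a, M.car (σ a)) :
    (t.toEq M).value M.eq x = t.value M x := by
  induction t with
  | var a => rfl
  | app f t ih => exact congrArg (M.fn f) (funext ih)

theorem BFormula.definable_eq {l : List L.Srt} (φ : BFormula L σ l) :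
    Definable (L := eqLanguage M) M.eq
      (fun z => (.inl (Sum.elim σ l.get z) : L.Srt ⊕ ImaginarySort M)) fun x =>
      φ.Holds M (fun a => x (.inl a)) fun i => x (.inr i) := by
  have key : ∀ {l : List L.Srt} (x : ∀ z, M.car (Sum.elim σ l.get z)),
      join M (σ := σ) (τ := l.get) (fun a => x (.inl a)) (fun i => x (.inr i)) = x := by
    intro l x
    funext z
    rcases z with z | z <;> rfl
  induction φ with
  | falsum => exact definable_false
  | @equal l s t t' =>
    refine (definable_equal (t.toEq M) (t'.toEq M)).congr fun x => ?_
    refine iff_of_eq (congrArg₂ Eq ((t.value_toEq x).trans ?_) ((t'.value_toEq x).trans ?_))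
    · exact congrArg (fun y => t.value M y) (key x).symm
    · exact congrArg (fun y => t'.value M y) (key x).symm
  | @rel l n d R t =>
    refine (definable_rel (L := eqLanguage M) (EqRel.old R) fun i => (t i).toEq M).congr fun x => ?_
    refine iff_of_eq (congrArg (M.rel R) (funext fun i => ((t i).value_toEq x).trans ?_))
    exact congrArg (fun y => (t i).value M y) (key x).symm
  | imp φ φ' ih ih' => exact ih.imp ih'
  | @all l s φ ih =>
    let τ : (α ⊕ Fin l.length) ⊕ Unit → L.Srt ⊕ ImaginarySort M :=
      Sum.elim (fun z => .inl (Sum.elim σ l.get z)) fun _ => .inl s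
    let t : ∀ z : α ⊕ Fin (s :: l).length,
        Term (eqLanguage M) τ (.inl (Sum.elim σ (s :: l).get z)) := fun z => match z with
      | .inl a => .var (L := eqLanguage M) (σ := τ) (.inl (.inl a))
      | .inr j => Fin.cases (motive := fun j => Term (eqLanguage M) τ (.inl ((s :: l).get j)))
          (.var (L := eqLanguage M) (σ := τ) (.inr ()))
          (fun j => .var (L := eqLanguage M) (σ := τ) (.inl (.inr j))) j
    refine (ih.subst (τ := τ) t).forall_last.congr fun x => ?_
    refine forall_congr' fun a => iff_of_eq (congrArg (φ.Holds M _) ?_)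
    funext j
    refine Fin.cases ?_ (fun j => ?_) j <;> rfl

theorem Definable.toEq {P : (∀ a, M.car (σ a)) → Prop} (hP : Definable M σ P) :
    Definable (L := eqLanguage M) M.eq (fun a => (.inl (σ a) : L.Srt ⊕ ImaginarySort M)) P := by
  obtain ⟨φ, hφ⟩ := hP
  refine (φ.definable_eq.subst
    (τ := fun a => (.inl (σ a) : L.Srt ⊕ ImaginarySort M)) fun z => match z with
    | .inl a => .var (L := eqLanguage M) (σ := fun a => (.inl (σ a) : L.Srt ⊕ ImaginarySort M)) a
    | .inr j => j.elim0).congr fun x => Iff.trans ?_ (hφ _)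
  refine iff_of_eq (congrArg (φ.Holds M _) ?_)
  funext j
  exact j.elim0

/-- The projection onto a sort of `M^eq` as a term of `L^eq`. -/
def projTerm : (s : L.Srt ⊕ ImaginarySort M) →
    Term (eqLanguage M) (fun i => (.inl (repSort s i) : L.Srt ⊕ ImaginarySort M)) s
  | .inl s => .var (L := eqLanguage M)
      (σ := fun i => (.inl (repSort (.inl s) i) : L.Srt ⊕ ImaginarySort M)) ()
  | .inr S => .app (L := eqLanguage M) (EqFn.proj S) fun i => .var (L := eqLanguage M)
      (σ := fun i => (.inl (repSort (.inr S) i) : L.Srt ⊕ ImaginarySort M)) i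

theorem value_projTerm (s : L.Srt ⊕ ImaginarySort M) (x : ∀ i, M.car (repSort s i)) :
    (projTerm s).value M.eq x = repProj s x := by
  rcases s with s | S <;> rfl

end Inclusion

/-! ### Saturation and homogeneity of M^eq -/

section Extension

/-- The extension of an automorphism of `M` to `M^eq`. -/
def Automorphism.eq (g : Automorphism M) : Automorphism M.eq where
  perm
    | .inl s => g.perm s
    | .inr S => Quotient.congr (Equiv.piCongrRight fun i => g.perm (S.s i)) fun a b => by
        refine Iff.trans ((definable_realize S.E).map_iff g (join M a b)).symm
          (iff_of_eq (congrArg (S.E.Realize M) ?_))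
        funext z
        rcases z with z | z <;> rfl
  map_fn f x := by
    cases f with
    | old f => exact g.map_fn f x
    | proj S => rfl
  map_rel r x := by
    cases r with
    | old r => exact g.map_rel r x

theorem Automorphism.eq_perm_repProj (g : Automorphism M) (s : L.Srt ⊕ ImaginarySort M)
    (x : ∀ i, M.car (repSort s i)) : g.eq.perm s (repProj s x) = repProj s (g.map x) := by
  rcases s with s | S <;> rfl

instance (s : L.Srt ⊕ ImaginarySort M) : Small.{u} (RepIndex s) := by
  rcases s with s | S
  · exact inferInstanceAs (Small.{u} Unit)
  · exact inferInstanceAs (Small.{u} (Fin S.n))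

/-- Choosing representatives of the parameters turns the type into conditions on a representing
tuple in M, where compactness applies. -/
theorem IsSaturatedHomogeneous.eq_saturated (hM : IsSaturatedHomogeneous M) (A : Set M.eq.El)
    (hA : Small.{u} A) (s : L.Srt ⊕ ImaginarySort M)
    (p : Set (M.eq.FormulaOver A (fun _ : Unit => s)))
    (hp : ∀ p₀ ⊆ p, p₀.Finite → ∃ a : M.eq.car s, ∀ φ ∈ p₀, M.eq.RealizeOver φ (fun _ => a)) :
    ∃ a : M.eq.car s, ∀ φ ∈ p, M.eq.RealizeOver φ (fun _ => a) := by
  obtain ⟨w, hw⟩ := repTuple_surjective (σ := fun a : A => a.1.1) fun a => a.1.2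
  suffices h : ∃ x : ∀ i, M.car (repSort s i), ∀ φ : p,
      M.eq.RealizeOver φ.1 fun _ => repProj s x by
    obtain ⟨x, hx⟩ := h
    exact ⟨repProj s x, fun φ hφ => hx ⟨φ, hφ⟩⟩
  refine hM.compactness (A := M.entries w) (small_entries w) _ (fun φ => ?_) fun q hq => ?_
  · refine DefinableOver.typeDefinableOver (Definable.definableOver
      (((definable_realize φ.1).rep (σ := Sum.elim (fun _ : Unit => s) fun a : A => a.1.1)).subst
        (τ := Sum.elim (repSort s) (repSorts fun a : A => a.1.1)) fun z => match z with
      | ⟨.inl _, i⟩ => .var (σ := Sum.elim (repSort s) (repSorts fun a : A => a.1.1)) (.inl i)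
      | ⟨.inr a, i⟩ =>
        .var (σ := Sum.elim (repSort s) (repSorts fun a : A => a.1.1)) (.inr ⟨a, i⟩)) w le_rfl
      |>.congr fun x => ?_)
    refine iff_of_eq (congrArg (φ.1.Realize M.eq) ?_)
    funext z
    rcases z with z | z
    · rfl
    · exact congrFun hw z
  · obtain ⟨a, ha⟩ := hp (Subtype.val '' q) (by rintro _ ⟨φ, _, rfl⟩; exact φ.2) (hq.image _)
    obtain ⟨x, rfl⟩ := repProj_surjective s a
    exact ⟨x, fun φ hφ => ha _ ⟨φ, hφ, rfl⟩⟩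

/-- The classes in the second tuple get new representatives with the same type as those of the
first; an automorphism of M between the representatives then extends to M^eq. -/
theorem IsSaturatedHomogeneous.eq_homogeneous (hM : IsSaturatedHomogeneous M) {ι : Type u}
    {σ : ι → L.Srt ⊕ ImaginarySort M} (x y : (i : ι) → M.eq.car (σ i))
    (h : M.eq.SameType ∅ x y) : ∃ g : Automorphism M.eq, ∀ i, g.perm (σ i) (x i) = y i := by
  obtain ⟨x, rfl⟩ := repTuple_surjective x
  obtain ⟨w, rfl⟩ := repTuple_surjective y
  let R : {P : (∀ z, M.car (repSorts σ z)) → Prop // Definable M (repSorts σ) P ∧ P x} ⊕ ι →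
      (∀ z, M.car (repSorts σ z)) → Prop
    | .inl P, z => P.1 z
    | .inr i, z => repTuple z i = repTuple w i
  suffices h : ∃ y, ∀ θ, R θ y by
    obtain ⟨y, hy⟩ := h
    have hxy : M.SameType ∅ x y := sameType_empty_iff.mpr fun P hP =>
      ⟨fun h => hy (.inl ⟨P, hP, h⟩), fun h => by_contra fun h' => hy (.inl ⟨_, hP.not, h'⟩) h⟩
    obtain ⟨g, -, rfl⟩ := hM.exists_automorphism (small_subset (Set.empty_subset (M.entries w))) hxy
    exact ⟨g.eq, fun i => (g.eq_perm_repProj _ _).trans (hy (.inr i))⟩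
  refine hM.compactness (A := M.entries w) (small_entries w) R ?_ ?_
  · rintro (P | i)
    · exact (P.2.1.over _).typeDefinableOver
    · exact (Definable.definableOver ((definable_repProj_eq (σ i)).subst
        (τ := Sum.elim (repSorts σ) (repSorts σ)) fun z => match z with
        | .inl j => .var (σ := Sum.elim (repSorts σ) (repSorts σ)) (.inl ⟨i, j⟩)
        | .inr j => .var (σ := Sum.elim (repSorts σ) (repSorts σ)) (.inr ⟨i, j⟩))
        w le_rfl).typeDefinableOver
  · intro s hs
    let τ : ι ⊕ (Σ i, RepIndex (σ i)) → L.Srt ⊕ ImaginarySort M :=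
      Sum.elim σ fun z => .inl (repSorts σ z)
    have h1 : Definable M (repSorts σ) fun z => ∀ P ∈ Sum.inl ⁻¹' s, P.1 z :=
      definable_forall_mem_finite (hs.preimage Sum.inl_injective.injOn) _ fun P _ => P.2.1
    have h2 : Definable (L := eqLanguage M) M.eq τ fun z => ∀ i ∈ Sum.inr ⁻¹' s,
        repTuple (σ := σ) (fun z' => z (.inr z')) i = z (.inl i) := by
      refine definable_forall_mem_finite (hs.preimage Sum.inr_injective.injOn) _ fun i _ => ?_
      refine (definable_equal (L := eqLanguage M) (σ := τ)
        ((projTerm (σ i)).subst (τ := τ) fun j => .var (L := eqLanguage M) (σ := τ) (.inr ⟨i, j⟩))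
        (.var (L := eqLanguage M) (σ := τ) (.inl i))).congr fun z => ?_
      refine iff_of_eq (congrArg (· = z (.inl i)) ?_)
      exact (Term.value_subst (L := eqLanguage M) M.eq _ _ _).trans (value_projTerm _ _)
    have h3 : Definable (L := eqLanguage M) M.eq τ fun z => ∀ P ∈ Sum.inl ⁻¹' s,
        P.1 fun z' => z (.inr z') :=
      h1.toEq.subst (τ := τ) fun z => .var (L := eqLanguage M) (σ := τ) (.inr z)
    -- That suitable representatives exist is a formula about the tuple of classes, true of the
    -- first tuple and hence of the second.
    obtain ⟨z, hz1, hz2⟩ := (sameType_empty_iff.mp h _ (h3.and h2).exists_block).mp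
      ⟨x, fun P _ => P.2.2, fun _ _ => rfl⟩
    refine ⟨z, ?_⟩
    rintro (P | i) hi
    · exact hz1 P hi
    · exact hz2 i hi

theorem IsSaturatedHomogeneous.eq (hM : IsSaturatedHomogeneous M) :
    IsSaturatedHomogeneous M.eq :=
  ⟨hM.eq_saturated, hM.eq_homogeneous⟩

end Extension

end ManySorted

theorem mainTheorem5 {L : ManySorted.Language.{u}} (T : Set (ManySorted.Sentence L))
    (hT : ManySorted.IsCompleteTheory T) (M : ManySorted.Structure.{u, u + 1} L)
    (hM : ManySorted.IsBigModel T M) :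
    List.TFAE [
      ManySorted.IsIndependenceRelation (ManySorted.ThornInd M),
      ManySorted.LocalCharacter (ManySorted.ThornInd M),
      ManySorted.LocalCharacter (ManySorted.MInd M),
      ManySorted.FiniteXiMRanks M,
      ∀ A B C : Set M.El, Small.{u} A → Small.{u} B → Small.{u} C →
        ManySorted.ThornInd M A C B → ManySorted.ThornInd M B C A,
      ∀ A B C : Set M.El, Small.{u} A → Small.{u} B → Small.{u} C →
        ManySorted.ThornInd M A C B → ManySorted.MInd M B C A,
      ∃ R : ManySorted.TernaryRel M, ManySorted.IsStrictIndependenceRelation R] ∧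
    (ManySorted.IsIndependenceRelation (ManySorted.ThornInd M) →
      ManySorted.IsStrictIndependenceRelation (ManySorted.ThornInd M) ∧
      ∀ R : ManySorted.TernaryRel M, ManySorted.IsStrictIndependenceRelation R →
        ∀ A B C : Set M.El, Small.{u} A → Small.{u} B → Small.{u} C →
          R A C B → ManySorted.ThornInd M A C B) ∧
    List.TFAE [
      ManySorted.IsRosy M,
      ManySorted.LocalCharacter (ManySorted.ThornInd M.eq),
      ManySorted.LocalCharacter (ManySorted.MInd M.eq),
      ManySorted.FiniteXiMRanks M.eq,
      ∀ A B C : Set M.eq.El, Small.{u} A → Small.{u} B → Small.{u} C →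
        ManySorted.ThornInd M.eq A C B → ManySorted.ThornInd M.eq B C A,
      ∀ A B C : Set M.eq.El, Small.{u} A → Small.{u} B → Small.{u} C →
        ManySorted.ThornInd M.eq A C B → ManySorted.MInd M.eq B C A,
      ∃ R : ManySorted.TernaryRel M.eq, ManySorted.IsStrictIndependenceRelation R] := by
  have hM' := hM.isSaturatedHomogeneous
  exact ⟨hM'.tfae, fun h => ⟨⟨h, ManySorted.thornInd_antiReflexivity⟩,
    fun R hR A B C hA hB hC hind => hR.thornInd hA hB hC hind⟩, hM'.eq.tfae⟩
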